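/- Let $\mathcal P_1(\mathbb R)$ be the set of Borel probability measures on $\mathbb R$ with finite first moment. For $m,m'\in\mathcal P_1(\mathbb R)$ write $m\le_c m'$ (convex order) if $\int\varphi\,dm\le\int\varphi\,dm'$ in $(-\infty,\infty]$ for every convex $\varphi:\mathbb R\to\mathbb R$. For finite measures, $m\le_+m'$ means $m(B)\le m'(B)$ for every Borel set $B$. Let $T\subset[0,\infty)$ be a countable set with $0\in T$ that has a maximal element. A peacock is a family $(\mu_t)_{t\in T}$ in $\mathcal P_1(\mathbb R)$ with $\mu_s\le_c\mu_t$ for all $s\le t$ in $T$. A peacock $(\mu_t)_{t\in T}$ is called non self-improvable (NSI) if every peacock $(\eta_t)_{t\in T}$ with $\eta_0=\mu_0$ and $\eta_t\le_+2\mu_t$ for all $t\in T$ satisfies $\mu_t\le_c\eta_t$ for all $t\in T$. Let $(\mu_t)_{t\in T}$ be a peacock and let $a\mapsto\tilde\nu^a$ be a measurable map from $[0,1]$ to $\mathcal P_1(\mathbb R)$. Let $\mathcal A$ be the set of all families $(\theta^a)_{a\in[0,1]}$ of peacocks $\theta^a=(\theta^a_t)_{t\in T}$ that depend measurably on $a$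 and satisfy $\theta^a_0=\tilde\nu^a$ for all $a\in[0,1]$ and $\int_0^1\theta^a_t\,da=\mu_t$ for all $t\in T$. For $t\in T$ put $$c_t(a,\theta)=(1-a)\int_{\mathbb R}\left(x+\sqrt{1+x^2}\right)d\theta_t(x),\qquad \mathsf V_t=\inf_{(\theta^a)\in\mathcal A}\int_0^1c_t(a,\theta^a)\,da .$$ Suppose that $\mathsf V_t<\infty$ for all $t\in T$, and that $(\theta^a)_{a\in[0,1]}\in\mathcal A$ is a simultaneous minimizer, i.e. $\int_0^1c_t(a,\theta^a)\,da=\mathsf V_t$ for all $t\in T$. Then the peacock $(\theta^a_t)_{t\in T}$ is NSI for Lebesgue-almost every $a\in[0,1]$. -/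

import Mathlib

open MeasureTheory Set
open scoped ENNReal

namespace PeacockNSI

/-- `μ` is a probability measure on `ℝ` with finite first moment. -/
structure IsP1 (μ : Measure ℝ) : Prop where
  prob : IsProbabilityMeasure μ
  moment : Integrable (fun x : ℝ => x) μ

/-- The convex order: `∫ φ dμ ≤ ∫ φ dμ'` for all convex `φ : ℝ → ℝ`.
For finite measures with finite first moment both integrals are well defined in `(-∞, ∞]`, and an
integral is `+∞` exactly when `φ` is not integrable. Thus the inequality is void if `φ` is not
`μ'`-integrable, and otherwise says that `φ` is `μ`-integrable with `∫ φ dμ ≤ ∫ φ dμ'`. -/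
def ConvexLE (μ μ' : Measure ℝ) : Prop :=
  ∀ φ : ℝ → ℝ, ConvexOn ℝ univ φ → Integrable φ μ' →
    Integrable φ μ ∧ ∫ x, φ x ∂μ ≤ ∫ x, φ x ∂μ'

/-- A peacock indexed by a totally ordered set: a family of probability measures on `ℝ` with finite
first moments that is increasing in convex order. -/
structure IsPeacock {T : Type*} [LinearOrder T] (μ : T → Measure ℝ) : Prop where
  mem : ∀ t, IsP1 (μ t)
  mono : ∀ s t, s ≤ t → ConvexLE (μ s) (μ t)

/-- A peacock `μ` is non self-improvable if `μ t ≤_c η t` for all `t`, for every peacock `η` with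
`η o = μ o` and `η t ≤ 2 μ t` (as measures) for all `t`. Here `o` is the minimal index. -/
structure IsNSI {T : Type*} [LinearOrder T] (o : T) (μ : T → Measure ℝ) : Prop where
  peacock : IsPeacock μ
  le : ∀ η : T → Measure ℝ, IsPeacock η → η o = μ o → (∀ t, η t ≤ (2 : ℝ≥0∞) • μ t) →
    ∀ t, ConvexLE (μ t) (η t)

/-- The admissible families `(θ ^ a)`, `a ∈ [0,1]`: measurable families of peacocks with initial
marginals `ν ^ a` whose Lebesgue mixture is `μ`. Families of measures carry the product over `T` of
the `σ`-algebras generated by the evaluations `m ↦ m B`; on probability measures with finite first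
moment this is the Borel `σ`-algebra of the Wasserstein-1 topology. -/
structure IsAdmissible {T : Type*} [LinearOrder T] (o : T) (ν : unitInterval → Measure ℝ)
    (μ : T → Measure ℝ) (θ : unitInterval → T → Measure ℝ) : Prop where
  peacock : ∀ a, IsPeacock (θ a)
  measurable : Measurable θ
  init : ∀ a, θ a o = ν a
  mixture : ∀ t, ∀ B : Set ℝ, MeasurableSet B → ∫⁻ a, θ a t B = μ t B

/-- The total cost `∫₀¹ c(a, θ ^ a) da` of a family, for a cost `c ≥ 0`. -/
noncomputable def totalCost {T : Type*} (c : unitInterval → (T → Measure ℝ) → ℝ)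
    (θ : unitInterval → T → Measure ℝ) : ℝ≥0∞ :=
  ∫⁻ a, ENNReal.ofReal (c a (θ a))

/-- The infimum of the total cost over the admissible families. -/
noncomputable def optValue {T : Type*} [LinearOrder T] (o : T) (ν : unitInterval → Measure ℝ)
    (μ : T → Measure ℝ) (c : unitInterval → (T → Measure ℝ) → ℝ) : ℝ≥0∞ :=
  ⨅ θ ∈ {θ | IsAdmissible o ν μ θ}, totalCost c θ

/-- `θ` is an admissible family that attains the infimum. -/
structure IsMinimizer {T : Type*} [LinearOrder T] (o : T) (ν : unitInterval → Measure ℝ)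
    (μ : T → Measure ℝ) (c : unitInterval → (T → Measure ℝ) → ℝ)
    (θ : unitInterval → T → Measure ℝ) : Prop where
  admissible : IsAdmissible o ν μ θ
  optimal : totalCost c θ = optValue o ν μ c

/-- The cost `c_t(a, θ) = (1 - a) ∫ x + √(1 + x²) dθ_t(x)`. -/
noncomputable def cost {T : Type*} (t : T) (a : unitInterval) (θ : T → Measure ℝ) : ℝ :=
  (1 - (a : ℝ)) * ∫ x, (x + Real.sqrt (1 + x ^ 2)) ∂(θ t)

end PeacockNSI

/-! Measures are encoded by their call functions x ↦ ∫ (y - x)⁺ dm(y). For probability measures with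
equal means, convex order is the pointwise order of call functions; domination m ≤₊ m' makes the
difference of the call functions convex. The whole argument is thus about convex functions of one
variable.

Fix r in [0,1]. Among the families W t that increase in t, lie above the accumulated initial
potential ∫₀ʳ call (θ b o) db, and have a convex complement call (μ t) - W t, there is a smallest
one, `minCall`. It is the limit of iterated shadows f - conv(f - g) along finite chains that exhaust
T.

Since 1 - a = ∫ₐ¹ dr, and x + √(1 + x²) is a positive mixture of the functions (x + z)⁺ over a
measure κ, the cost at time t equals ∫∫ accCall θ r t (-z) dr dκ(z) (`flowCost_eq`). Every
admissible family satisfies `minCall` ≤ `accCall` (`minCall_le_accCall`). This bound is attained at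
all times at once: the increments of `minCall` in r are convex in x and increase with t, so its
derivative in r gives the call functions of a peacock for almost every r, and integrating the
derivative recovers `minCall` (`exists_competitor`). Strict convexity of √(1 + x²) makes κ charge
every interval, so a simultaneous minimizer has `accCall` = `minCall` for every r
(`accCall_eq_minCall`).

It remains to see that this minimality forces almost every slice to be NSI. Let `improvedCall` be
the least potential that the definition of NSI allows for θ a. Half of the improved potentials over
(a, a + 2s] fits under what θ uses on (a, a + 2s], because η ≤ 2θ. Added to the accumulation up to
a, it competes with `minCall` at a + s, up to an o(s) error in the initial marginal
(`integral_call_le`). Dividing by s and differentiating gives call (θ a t) ≤ `improvedCall` for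
almost every a, which implies NSI (`IsPeacock.isNSI`). -/

namespace PeacockNSI

open Filter Topology

/-! ### Supporting lines and convex envelopes on the line -/

/-- A finite convex function on the line is continuous. -/
lemma continuous_of_convexOn {f : ℝ → ℝ} (hf : ConvexOn ℝ univ f) : Continuous f :=
  continuousOn_univ.mp (hf.continuousOn isOpen_univ)

lemma _root_.ConvexOn.of_eq {f g : ℝ → ℝ} (hf : ConvexOn ℝ univ f) (h : ∀ x, g x = f x) :
    ConvexOn ℝ univ g := by
  rwa [show g = f from funext h]

/-- A finite convex function on the line has a supporting line at each point. -/
lemma exists_support_of_convexOn {f : ℝ → ℝ} (hf : ConvexOn ℝ univ f) (x : ℝ) :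
    ∃ β : ℝ, ∀ p, f x + β * (p - x) ≤ f p := by
  refine ⟨derivWithin f (Ioi x) x, fun p => ?_⟩
  rcases lt_trichotomy p x with h | h | h
  · have h1 := hf.slope_le_leftDeriv_of_mem_interior (mem_univ p) (by simp : x ∈ interior univ) h
    have h2 := hf.leftDeriv_le_rightDeriv_of_mem_interior (by simp : x ∈ interior univ)
    have h3 := h1.trans h2
    rw [slope_def_field, div_le_iff₀ (by linarith)] at h3
    linarith
  · simp [h]
  · have h1 := hf.rightDeriv_le_slope_of_mem_interior (by simp : x ∈ interior univ) (mem_univ p) h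
    rw [slope_def_field, le_div_iff₀ (by linarith)] at h1
    linarith

lemma convexOn_of_support {f : ℝ → ℝ} (hf : ∀ x, ∃ β : ℝ, ∀ p, f x + β * (p - x) ≤ f p) :
    ConvexOn ℝ univ f := by
  refine ⟨convex_univ, fun x _ y _ a b ha hb hab => ?_⟩
  simp only [smul_eq_mul]
  obtain ⟨β, hβ⟩ := hf (a * x + b * y)
  have h1 := mul_le_mul_of_nonneg_left (hβ x) ha
  have h2 := mul_le_mul_of_nonneg_left (hβ y) hb
  obtain rfl : b = 1 - a := by linarith
  nlinarith

lemma convexOn_of_tendsto {ι : Type*} {l : Filter ι} [l.NeBot] {u : ι → ℝ → ℝ} {v : ℝ → ℝ}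
    (hu : ∀ᶠ i in l, ConvexOn ℝ univ (u i)) (h : ∀ x, Tendsto (fun i => u i x) l (𝓝 (v x))) :
    ConvexOn ℝ univ v := by
  refine ⟨convex_univ, fun x _ y _ a b ha hb hab => ?_⟩
  refine le_of_tendsto_of_tendsto (h _) (((h x).const_smul a).add ((h y).const_smul b)) ?_
  filter_upwards [hu] with i hi
  exact hi.2 (mem_univ x) (mem_univ y) ha hb hab

/-- The value at `x` of the chord of `h` over `[x - s, x + t]`. -/
noncomputable def chord (h : ℝ → ℝ) (x s t : ℝ) : ℝ := (t * h (x - s) + s * h (x + t)) / (s + t)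

/-- The convex envelope of a continuous function on the line. -/
noncomputable def convexEnv (h : ℝ → ℝ) (x : ℝ) : ℝ :=
  ⨅ p : {p : ℚ × ℚ // 0 < p.1 ∧ 0 < p.2}, chord h x p.1.1 p.1.2

instance : Nonempty {p : ℚ × ℚ // 0 < p.1 ∧ 0 < p.2} := ⟨⟨(1, 1), by norm_num⟩⟩

lemma le_chord {c : ℝ → ℝ} (hc : ConvexOn ℝ univ c) {x s t : ℝ} (hs : 0 < s) (ht : 0 < t) :
    c x ≤ chord c x s t := by
  have h := hc.2 (mem_univ (x - s)) (mem_univ (x + t))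
    (show 0 ≤ t / (s + t) by positivity) (show 0 ≤ s / (s + t) by positivity)
    (by field_simp; ring)
  have e : (t / (s + t)) • (x - s) + (s / (s + t)) • (x + t) = x := by
    simp only [smul_eq_mul]; field_simp; ring
  rw [e] at h
  refine h.trans_eq ?_
  simp only [smul_eq_mul, chord]; field_simp

lemma chord_mono {h h' : ℝ → ℝ} (hh : ∀ x, h x ≤ h' x) {x s t : ℝ} (hs : 0 < s) (ht : 0 < t) :
    chord h x s t ≤ chord h' x s t := by
  unfold chord
  have := hh (x - s)
  have := hh (x + t)
  gcongr

lemma bddBelow_chord {h c : ℝ → ℝ} (hc : ConvexOn ℝ univ c) (hch : ∀ x, c x ≤ h x) (x : ℝ) :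
    BddBelow (range fun p : {p : ℚ × ℚ // 0 < p.1 ∧ 0 < p.2} => chord h x p.1.1 p.1.2) := by
  refine ⟨c x, ?_⟩
  rintro _ ⟨⟨⟨s, t⟩, hs, ht⟩, rfl⟩
  exact (le_chord hc (by exact_mod_cast hs) (by exact_mod_cast ht)).trans
    (chord_mono hch (by exact_mod_cast hs) (by exact_mod_cast ht))

lemma le_convexEnv {h c : ℝ → ℝ} (hc : ConvexOn ℝ univ c) (hch : ∀ x, c x ≤ h x) (x : ℝ) :
    c x ≤ convexEnv h x := by
  refine le_ciInf ?_
  rintro ⟨⟨s, t⟩, hs, ht⟩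
  exact (le_chord hc (by exact_mod_cast hs) (by exact_mod_cast ht)).trans
    (chord_mono hch (by exact_mod_cast hs) (by exact_mod_cast ht))

lemma convexEnv_mono {h h' c : ℝ → ℝ} (hc : ConvexOn ℝ univ c) (hch : ∀ x, c x ≤ h x)
    (hh : ∀ x, h x ≤ h' x) (x : ℝ) : convexEnv h x ≤ convexEnv h' x := by
  refine ciInf_mono (bddBelow_chord hc hch x) ?_
  rintro ⟨⟨s, t⟩, hs, ht⟩
  exact chord_mono hh (by exact_mod_cast hs) (by exact_mod_cast ht)

/-- Continuity of `h` passes from the rational chords of the definition to all chords. -/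
lemma convexEnv_le_chord {h c : ℝ → ℝ} (hh : Continuous h) (hc : ConvexOn ℝ univ c)
    (hch : ∀ x, c x ≤ h x) {x s t : ℝ} (hs : 0 < s) (ht : 0 < t) :
    convexEnv h x ≤ chord h x s t := by
  obtain ⟨u, -, hu, hul⟩ := Real.exists_seq_rat_strictAnti_tendsto s
  obtain ⟨v, -, hv, hvl⟩ := Real.exists_seq_rat_strictAnti_tendsto t
  have hl : Tendsto (fun n => chord h x (u n) (v n)) atTop (𝓝 (chord h x s t)) := by
    unfold chord
    have h1 : Tendsto (fun n => h (x - u n)) atTop (𝓝 (h (x - s))) :=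
      (hh.tendsto _).comp (hul.const_sub x)
    have h2 : Tendsto (fun n => h (x + v n)) atTop (𝓝 (h (x + t))) :=
      (hh.tendsto _).comp (hvl.const_add x)
    exact ((hvl.mul h1).add (hul.mul h2)).div (hul.add hvl) (by positivity)
  refine ge_of_tendsto' hl fun n => ?_
  have hun : (0 : ℝ) < u n := hs.trans (hu n)
  have hvn : (0 : ℝ) < v n := ht.trans (hv n)
  exact ciInf_le (bddBelow_chord hc hch x)
    ⟨(u n, v n), by exact_mod_cast hun, by exact_mod_cast hvn⟩

/-- The degenerate chord s = t = 0 is excluded from the infimum, so `h x` is reached as the limit of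
symmetric chords. -/
lemma convexEnv_le {h c : ℝ → ℝ} (hh : Continuous h) (hc : ConvexOn ℝ univ c)
    (hch : ∀ x, c x ≤ h x) (x : ℝ) : convexEnv h x ≤ h x := by
  have hl : Tendsto (fun s : ℝ => (h (x - s) + h (x + s)) / 2) (𝓝[>] 0) (𝓝 (h x)) := by
    have : Continuous fun s : ℝ => (h (x - s) + h (x + s)) / 2 := by fun_prop
    have h0 := (this.tendsto 0).mono_left (nhdsWithin_le_nhds (s := Ioi 0))
    simpa using h0
  refine ge_of_tendsto hl ?_
  filter_upwards [self_mem_nhdsWithin] with s (hs : 0 < s)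
  refine (convexEnv_le_chord hh hc hch hs hs).trans_eq ?_
  unfold chord; field_simp; ring

/-- At each point some affine function below `h` touches the envelope of `h`. -/
lemma exists_support_convexEnv {h c : ℝ → ℝ} (hh : Continuous h) (hc : ConvexOn ℝ univ c)
    (hch : ∀ x, c x ≤ h x) (x : ℝ) :
    ∃ β : ℝ, ∀ p, convexEnv h x + β * (p - x) ≤ h p := by
  set k := convexEnv h x with hk
  -- Seen from the point (x, k), every slope to the left is at most every slope to the right. The
  -- supremum of the left slopes therefore separates them and is the slope of a line below `h`.
  have key : ∀ s t : ℝ, 0 < s → 0 < t → (k - h (x - s)) / s ≤ (h (x + t) - k) / t := by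
    intro s t hs ht
    have h1 := convexEnv_le_chord hh hc hch (x := x) hs ht
    unfold chord at h1
    rw [le_div_iff₀ (by positivity)] at h1
    rw [div_le_div_iff₀ hs ht]
    nlinarith
  refine ⟨⨆ s : Ioi (0 : ℝ), (k - h (x - s)) / s, fun p => ?_⟩
  have bdd : BddAbove (range fun s : Ioi (0 : ℝ) => (k - h (x - s)) / s) := by
    refine ⟨(h (x + 1) - k) / 1, ?_⟩
    rintro _ ⟨⟨s, hs⟩, rfl⟩
    exact key s 1 hs one_pos
  rcases lt_trichotomy p x with hp | hp | hp
  · have h1 := le_ciSup bdd ⟨x - p, by simpa using hp⟩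
    simp only [sub_sub_cancel] at h1
    rw [div_le_iff₀ (by linarith)] at h1
    linarith
  · subst hp
    simpa using convexEnv_le hh hc hch p
  · have : Nonempty (Ioi (0 : ℝ)) := ⟨⟨1, mem_Ioi.mpr one_pos⟩⟩
    have h1 : (⨆ s : Ioi (0 : ℝ), (k - h (x - s)) / s) ≤ (h (x + (p - x)) - k) / (p - x) :=
      ciSup_le fun s => key s (p - x) s.2 (by linarith)
    rw [le_div_iff₀ (by linarith), add_sub_cancel] at h1
    linarith

lemma convexOn_affine (a β x : ℝ) : ConvexOn ℝ univ fun p : ℝ => a + β * (p - x) :=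
  convexOn_of_support fun y => ⟨β, fun p => le_of_eq (by ring)⟩

/-- An affine function below `h` is below the envelope by maximality, so the line touching at x is a
supporting line of the envelope itself. -/
lemma convexOn_convexEnv {h c : ℝ → ℝ} (hh : Continuous h) (hc : ConvexOn ℝ univ c)
    (hch : ∀ x, c x ≤ h x) : ConvexOn ℝ univ (convexEnv h) := by
  refine convexOn_of_support fun x => ?_
  obtain ⟨β, hβ⟩ := exists_support_convexEnv hh hc hch x
  exact ⟨β, fun p => le_convexEnv (convexOn_affine _ β x) hβ p⟩

/-- The difference of a convex function `f` and the convex envelope of `f - g`, with `g` convex, is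
convex. -/
lemma convexOn_sub_convexEnv {f g c : ℝ → ℝ} (hf : ConvexOn ℝ univ f) (hg : ConvexOn ℝ univ g)
    (hc : ConvexOn ℝ univ c) (hch : ∀ x, c x ≤ f x - g x) :
    ConvexOn ℝ univ fun x => f x - convexEnv (fun y => f y - g y) x := by
  have hfc := continuous_of_convexOn hf
  have hgc := continuous_of_convexOn hg
  have hh : Continuous fun y => f y - g y := hfc.sub hgc
  have hk := convexOn_convexEnv hh hc hch
  have hkh := convexEnv_le hh hc hch
  have hmax : ∀ m : ℝ → ℝ, ConvexOn ℝ univ m → (∀ p, m p ≤ f p - g p) →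
    ∀ p, m p ≤ convexEnv (fun y => f y - g y) p := fun m hm hmh => le_convexEnv hm hmh
  set k := convexEnv fun y => f y - g y with hkdef
  -- Suppose convexity fails at y between x and z. Adding to `f` the chord of `k - f` gives a convex
  -- `v` that meets `k` at x and z and exceeds it at y. The supporting line of `v` at y turns out to
  -- lie below `f - g` everywhere, hence below the envelope `k`, which is absurd at y.
  refine LinearOrder.convexOn_of_lt convex_univ ?_
  intro x _ z _ hxz a b ha hb hab
  simp only [smul_eq_mul]
  set y := a * x + b * z with hy
  by_contra! hcon
  have hb' : b = 1 - a := by linarith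
  have hxy : x < y := by rw [hy, hb']; nlinarith
  have hyz : y < z := by rw [hy, hb']; nlinarith
  -- chord of `k - f` over `[x, z]`
  set σ := ((k z - f z) - (k x - f x)) / (z - x) with hσ
  have hσz : σ * (z - x) = (k z - f z) - (k x - f x) := by
    rw [hσ]; field_simp [sub_ne_zero.mpr hxz.ne']
  set v : ℝ → ℝ := fun p => f p + ((k x - f x) + σ * (p - x)) with hv
  have hvc : ConvexOn ℝ univ v := hf.add (convexOn_affine _ _ _)
  have hvx : v x = k x := by simp [hv]
  have hvz : v z = k z := by simp only [hv, hσz]; ring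
  have hvy : k y < v y := by
    have : y - x = b * (z - x) := by rw [hy, hb']; ring
    have e : σ * (y - x) = b * ((k z - f z) - (k x - f x)) := by rw [this, ← hσz]; ring
    simp only [hv, e]
    rw [hb'] at hcon ⊢
    linarith
  obtain ⟨β, hβ⟩ := exists_support_of_convexOn hvc y
  have hle : ∀ p, v y + β * (p - y) ≤ f p - g p := by
    intro p
    by_cases hpx : p < x
    -- The line is at most `k` at x and above `k` at y, so it is steeper than a supporting line of
    -- `k` at x. To the left of x it stays below that supporting line, hence below `k`.
    · obtain ⟨γ, hγ⟩ := exists_support_of_convexOn hk x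
      have h1 := hγ p
      have h2 := hγ y
      have h3 := hβ x
      rw [hvx] at h3
      have h4 : γ < β := by
        by_contra! hle
        nlinarith
      have := hkh p
      nlinarith
    by_cases hpz : z < p
    · obtain ⟨γ, hγ⟩ := exists_support_of_convexOn hk z
      have h1 := hγ p
      have h2 := hγ y
      have h3 := hβ z
      rw [hvz] at h3
      have h4 : β < γ := by
        by_contra! hle
        nlinarith
      have := hkh p
      nlinarith
    push Not at hpx hpz
    refine (hβ p).trans ?_
    -- `g` lies below the chord of `f - k`
    have hgx := hkh x
    have hgz := hkh z
    have hcv : g p ≤ (f x - k x) - σ * (p - x) := by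
      have hm : ConvexOn ℝ univ fun p => g p + σ * (p - x) := by
        have := hg.add (convexOn_affine 0 σ x)
        simp only [zero_add] at this
        exact this
      have := hm.le_max_of_mem_Icc (mem_univ x) (mem_univ z) ⟨hpx, hpz⟩
      have h2 : max (g x + σ * (x - x)) (g z + σ * (z - x)) ≤ f x - k x := by
        refine max_le ?_ ?_
        · simp; linarith
        · rw [hσz]; linarith
      linarith
    simp only [hv]; linarith
  have := hmax _ (convexOn_affine (v y) β y) hle y
  simp at this
  linarith

/-- The reason for restricting the definition to rational chords: the infimum is countable. -/
lemma measurable_convexEnv {α : Type*} [MeasurableSpace α] {h : α → ℝ → ℝ}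
    (hh : ∀ x, Measurable fun a => h a x) (x : ℝ) : Measurable fun a => convexEnv (h a) x := by
  unfold convexEnv chord
  refine Measurable.iInf fun p => ?_
  exact (((hh _).const_mul _).add ((hh _).const_mul _)).div_const _

/-! ### Shadows of potential functions -/

/-- The shadow of `g` in `f`, for potential functions `f` and `g`. -/
noncomputable def shadow (f g : ℝ → ℝ) (x : ℝ) : ℝ := f x - convexEnv (fun y => f y - g y) x

section Shadow

variable {f g c : ℝ → ℝ}

/-- The auxiliary convex `c` with g + c ≤ f keeps the envelope of f - g finite, here and below; in
the application it is the potential of mass not yet used. -/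
lemma convexOn_shadow (hf : ConvexOn ℝ univ f) (hg : ConvexOn ℝ univ g) (hc : ConvexOn ℝ univ c)
    (h : ∀ x, g x + c x ≤ f x) : ConvexOn ℝ univ (shadow f g) :=
  convexOn_sub_convexEnv hf hg hc fun x => by linarith [h x]

lemma le_shadow (hf : ConvexOn ℝ univ f) (hg : ConvexOn ℝ univ g) (hc : ConvexOn ℝ univ c)
    (h : ∀ x, g x + c x ≤ f x) (x : ℝ) : g x ≤ shadow f g x := by
  have := convexEnv_le (h := fun y => f y - g y)
    ((continuous_of_convexOn hf).sub (continuous_of_convexOn hg)) hc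
    (fun x => by linarith [h x]) x
  unfold shadow; linarith

lemma shadow_add_le (hc : ConvexOn ℝ univ c) (h : ∀ x, g x + c x ≤ f x) (x : ℝ) :
    shadow f g x + c x ≤ f x := by
  have := le_convexEnv (h := fun y => f y - g y) hc (fun x => by linarith [h x]) x
  unfold shadow; linarith

lemma shadow_mono {g' : ℝ → ℝ} (hc : ConvexOn ℝ univ c) (h : ∀ x, g' x + c x ≤ f x)
    (hgg : ∀ x, g x ≤ g' x) (x : ℝ) : shadow f g x ≤ shadow f g' x := by
  have := convexEnv_mono (h := fun y => f y - g' y) (h' := fun y => f y - g y) hc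
    (fun x => by linarith [h x]) (fun x => by linarith [hgg x]) x
  unfold shadow; linarith

/-- Minimality of the shadow: `f - w` is a convex minorant of `f - g`, so it lies below the
envelope. -/
lemma shadow_le {w : ℝ → ℝ} (hw : ConvexOn ℝ univ fun x => f x - w x) (hgw : ∀ x, g x ≤ w x)
    (x : ℝ) : shadow f g x ≤ w x := by
  have := le_convexEnv (h := fun y => f y - g y) hw (fun x => by linarith [hgw x]) x
  unfold shadow; linarith

lemma convexOn_sub_shadow (hf : ConvexOn ℝ univ f) (hg : ConvexOn ℝ univ g)
    (hc : ConvexOn ℝ univ c) (h : ∀ x, g x + c x ≤ f x) :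
    ConvexOn ℝ univ fun x => f x - shadow f g x := by
  simp only [shadow, sub_sub_cancel]
  exact convexOn_convexEnv ((continuous_of_convexOn hf).sub (continuous_of_convexOn hg)) hc
    fun x => by linarith [h x]

/-- Associativity of shadows: what is left after removing the shadows of `g` and then `d` is what is
left after removing that of g + d. If E is the envelope of f - g - d, then E + d is a convex
minorant of f - g. -/
lemma convexEnv_sub_eq {d : ℝ → ℝ} (hf : ConvexOn ℝ univ f) (hg : ConvexOn ℝ univ g)
    (hd : ConvexOn ℝ univ d) (hc : ConvexOn ℝ univ c) (h : ∀ x, g x + d x + c x ≤ f x) :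
    convexEnv (fun y => convexEnv (fun z => f z - g z) y - d y) =
      convexEnv (fun z => f z - (g z + d z)) := by
  have hcf := continuous_of_convexOn hf
  have hcg := continuous_of_convexOn hg
  have hcd := continuous_of_convexOn hd
  have hfg : Continuous fun z => f z - g z := hcf.sub hcg
  have hfgd : Continuous fun z => f z - (g z + d z) := hcf.sub (hcg.add hcd)
  have hdc := hd.add hc
  have h1 : ∀ x, (d + c) x ≤ f x - g x := fun x => by simp; linarith [h x]
  have he := convexOn_convexEnv hfg hdc h1
  have h2 : ∀ x, c x ≤ convexEnv (fun z => f z - g z) x - d x := fun x => by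
    have := le_convexEnv hdc h1 x
    simp at this; linarith
  have h3 : ∀ x, c x ≤ f x - (g x + d x) := fun x => by linarith [h x]
  have hE := convexOn_convexEnv hfgd hc h3
  have hEle := convexEnv_le hfgd hc h3
  ext x
  apply le_antisymm
  · refine convexEnv_mono hc h2 (fun y => ?_) x
    have := convexEnv_le hfg hdc h1 y
    linarith
  · refine le_convexEnv hE (fun y => ?_) x
    have := le_convexEnv (h := fun z => f z - g z) (hE.add hd) (fun z => by
      have := hEle z
      simp only [Pi.add_apply]; linarith) y
    simp only [Pi.add_apply] at this
    linarith

/-- By associativity the difference is the shadow of g' - g in the part of `f` left over by the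
shadow of `g`. -/
lemma convexOn_shadow_sub_shadow {g' : ℝ → ℝ} (hf : ConvexOn ℝ univ f) (hg : ConvexOn ℝ univ g)
    (hd : ConvexOn ℝ univ fun x => g' x - g x) (hc : ConvexOn ℝ univ c)
    (h : ∀ x, g' x + c x ≤ f x) :
    ConvexOn ℝ univ fun x => shadow f g' x - shadow f g x := by
  have h1 : ∀ x, g x + (g' x - g x) + c x ≤ f x := fun x => by linarith [h x]
  have he := convexEnv_sub_eq hf hg hd hc h1
  have hdc := hd.add hc
  have h2 : ∀ x, (fun x => (g' x - g x)) x + c x ≤ f x - g x := fun x => by simp; linarith [h x]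
  have hfg : Continuous fun z => f z - g z :=
    (continuous_of_convexOn hf).sub (continuous_of_convexOn hg)
  have hk := convexOn_convexEnv hfg hdc h2
  have := convexOn_sub_convexEnv hk hd hc fun x => by
    have := le_convexEnv hdc h2 x
    simp only [Pi.add_apply] at this
    linarith
  convert this using 2 with x
  rw [he]
  simp only [shadow, add_sub_cancel]
  ring

end Shadow

/-! ### Iterated shadows along finite chains of times -/

section Iterate

variable {T : Type*} {f : T → ℝ → ℝ} {g c : ℝ → ℝ}

/-- The successive shadows of `g` in `f s`, for `s` in the list `L`. -/
noncomputable def iterShadow (f : T → ℝ → ℝ) (g : ℝ → ℝ) (L : List T) : ℝ → ℝ :=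
  L.foldl (fun g s => shadow (f s) g) g

lemma iterShadow_concat (a : T) (L : List T) :
    iterShadow f g (L ++ [a]) = shadow (f a) (iterShadow f g L) := by
  simp [iterShadow]

lemma measurable_iterShadow {α : Type*} [MeasurableSpace α] {f : α → T → ℝ → ℝ} {g : α → ℝ → ℝ}
    (hf : ∀ t x, Measurable fun a => f a t x) (hg : ∀ x, Measurable fun a => g a x) (L : List T)
    (x : ℝ) : Measurable fun a => iterShadow (f a) (g a) L x := by
  induction L generalizing g x with
  | nil => exact hg x
  | cons s L ih =>
    exact ih (fun x => (hf s x).sub (measurable_convexEnv (fun y => (hf s y).sub (hg y)) x)) x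

variable [LinearOrder T]

/-- A shadow in `f a` leaves room for the same `c` inside `f a`, hence inside every later `f t`, so
one `c` serves the whole chain. -/
lemma iterShadow_basic (hf : ∀ t, ConvexOn ℝ univ (f t)) (hmono : ∀ s t, s ≤ t → ∀ x, f s x ≤ f t x)
    (hc : ConvexOn ℝ univ c) (L : List T) (hL : L.Pairwise (· ≤ ·)) (hg : ConvexOn ℝ univ g)
    (h : ∀ s ∈ L, ∀ x, g x + c x ≤ f s x) :
    ConvexOn ℝ univ (iterShadow f g L) ∧ (∀ x, g x ≤ iterShadow f g L x) ∧
      ∀ t, (∀ s ∈ L, s ≤ t) → (∀ x, g x + c x ≤ f t x) →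
        ∀ x, iterShadow f g L x + c x ≤ f t x := by
  induction L generalizing g with
  | nil => exact ⟨hg, fun x => le_rfl, fun t _ ht => ht⟩
  | cons a L ih =>
    rw [List.pairwise_cons] at hL
    have ha := h a (by simp)
    obtain ⟨h1, h2, h3⟩ := ih hL.2 (convexOn_shadow (hf a) hg hc ha) fun s hs x =>
      (shadow_add_le hc ha x).trans (hmono a s (hL.1 s hs) x)
    refine ⟨h1, fun x => (le_shadow (hf a) hg hc ha x).trans (h2 x), fun t ht hgt => ?_⟩
    exact h3 t (fun s hs => ht s (by simp [hs])) fun x =>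
      (shadow_add_le hc ha x).trans (hmono a t (ht a (by simp)) x)

/-- An extra time inserts one more shadow, which can only raise the potential. This makes the
potentials monotone along the exhaustion of T. -/
lemma iterShadow_mono (hf : ∀ t, ConvexOn ℝ univ (f t)) (hmono : ∀ s t, s ≤ t → ∀ x, f s x ≤ f t x)
    (hc : ConvexOn ℝ univ c) {L L' : List T} (hs : L.Sublist L') (hL' : L'.Pairwise (· ≤ ·))
    {g' : ℝ → ℝ} (hg' : ConvexOn ℝ univ g') (hgg : ∀ x, g x ≤ g' x)
    (h : ∀ s ∈ L', ∀ x, g' x + c x ≤ f s x) (x : ℝ) : iterShadow f g L x ≤ iterShadow f g' L' x := by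
  induction hs generalizing g g' with
  | slnil => exact hgg x
  | cons a _ ih =>
    rw [List.pairwise_cons] at hL'
    have ha := h a (by simp)
    exact ih hL'.2 (convexOn_shadow (hf a) hg' hc ha)
      (fun x => (hgg x).trans (le_shadow (hf a) hg' hc ha x))
      fun s hs x => (shadow_add_le hc ha x).trans (hmono a s (hL'.1 s hs) x)
  | cons_cons a _ ih =>
    rw [List.pairwise_cons] at hL'
    have ha := h a (by simp)
    exact ih hL'.2 (convexOn_shadow (hf a) hg' hc ha) (shadow_mono hc ha hgg)
      fun s hs x => (shadow_add_le hc ha x).trans (hmono a s (hL'.1 s hs) x)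

lemma iterShadow_le {W : T → ℝ → ℝ} (hW : ∀ t, ConvexOn ℝ univ fun x => f t x - W t x)
    (hWm : ∀ s t, s ≤ t → ∀ x, W s x ≤ W t x) (L : List T) (hL : L.Pairwise (· ≤ ·))
    (h : ∀ s ∈ L, ∀ x, g x ≤ W s x) (t : T) (ht : ∀ s ∈ L, s ≤ t) (hgt : ∀ x, g x ≤ W t x)
    (x : ℝ) : iterShadow f g L x ≤ W t x := by
  induction L generalizing g with
  | nil => exact hgt x
  | cons a L ih =>
    rw [List.pairwise_cons] at hL
    have ha := shadow_le (hW a) (h a (by simp))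
    exact ih hL.2 (fun s hs x => (ha x).trans (hWm a s (hL.1 s hs) x))
      (fun s hs => ht s (by simp [hs])) fun x => (ha x).trans (hWm a t (ht a (by simp)) x)

lemma convexOn_iterShadow_sub (hf : ∀ t, ConvexOn ℝ univ (f t))
    (hmono : ∀ s t, s ≤ t → ∀ x, f s x ≤ f t x)
    (hc : ConvexOn ℝ univ c) {g' : ℝ → ℝ} (L : List T) (hL : L.Pairwise (· ≤ ·))
    (hg : ConvexOn ℝ univ g) (hd : ConvexOn ℝ univ fun x => g' x - g x)
    (h : ∀ s ∈ L, ∀ x, g' x + c x ≤ f s x) :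
    ConvexOn ℝ univ fun x => iterShadow f g' L x - iterShadow f g L x := by
  induction L generalizing g g' with
  | nil => exact hd
  | cons a L ih =>
    rw [List.pairwise_cons] at hL
    have ha := h a (by simp)
    refine ih hL.2 ?_ (convexOn_shadow_sub_shadow (hf a) hg hd hc ha)
      fun s hs x => (shadow_add_le hc ha x).trans (hmono a s (hL.1 s hs) x)
    refine convexOn_shadow (hf a) hg (hd.add hc) fun x => ?_
    simp only [Pi.add_apply]
    linarith [ha x]

end Iterate

/-! ### Obstructed shadows over a countable set of times -/

section Obstructed

variable {T : Type*} [LinearOrder T] {f : T → ℝ → ℝ} {g c : ℝ → ℝ}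

/-- The conditions under which the obstructed shadow of `g` in `f` is well behaved. -/
structure Obstructs (f : T → ℝ → ℝ) (g c : ℝ → ℝ) : Prop where
  convex_f : ∀ t, ConvexOn ℝ univ (f t)
  mono_f : ∀ s t, s ≤ t → ∀ x, f s x ≤ f t x
  convex_g : ConvexOn ℝ univ g
  convex_c : ConvexOn ℝ univ c
  add_le : ∀ t x, g x + c x ≤ f t x

lemma Obstructs.basic (h : Obstructs f g c) (L : List T) (hL : L.Pairwise (· ≤ ·)) :
    ConvexOn ℝ univ (iterShadow f g L) ∧ (∀ x, g x ≤ iterShadow f g L x) ∧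
      ∀ t, (∀ s ∈ L, s ≤ t) → ∀ x, iterShadow f g L x + c x ≤ f t x := by
  obtain ⟨h1, h2, h3⟩ := iterShadow_basic h.convex_f h.mono_f h.convex_c L hL h.convex_g
    fun s _ => h.add_le s
  exact ⟨h1, h2, fun t ht => h3 t ht (h.add_le t)⟩

variable [Countable T] [Nonempty T]

/-- An increasing sequence of finite sets that exhausts the countable type `T`. -/
noncomputable def exhaustion (T : Type*) [LinearOrder T] [Countable T] [Nonempty T] (n : ℕ) :
    Finset T :=
  (Finset.range n).image (exists_surjective_nat T).choose

lemma exhaustion_mono : Monotone (exhaustion T) := fun _ _ h =>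
  Finset.image_subset_image (Finset.range_subset_range.mpr h)

lemma exists_mem_exhaustion (t : T) : ∃ n, t ∈ exhaustion T n := by
  obtain ⟨n, hn⟩ := (exists_surjective_nat T).choose_spec t
  exact ⟨n + 1, Finset.mem_image.mpr ⟨n, by simp, hn⟩⟩

/-- The chain of the first `n` elements of `T` that lie below `t`, followed by `t`. -/
noncomputable def chain (n : ℕ) (t : T) : List T :=
  ((exhaustion T n).filter (· < t)).sort ++ [t]

lemma le_of_mem_chain {n : ℕ} {s t : T} (h : s ∈ chain n t) : s ≤ t := by
  simp only [chain, List.mem_append, Finset.mem_sort, Finset.mem_filter, List.mem_singleton] at h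
  rcases h with h | h
  · exact h.2.le
  · exact h.le

lemma pairwise_chain (n : ℕ) (t : T) : (chain n t).Pairwise (· ≤ ·) := by
  rw [chain, List.pairwise_append]
  refine ⟨Finset.pairwise_sort _ _, by simp, ?_⟩
  intro a ha b hb
  simp only [Finset.mem_sort, Finset.mem_filter, List.mem_singleton] at ha hb
  exact hb ▸ ha.2.le

lemma nodup_chain (n : ℕ) (t : T) : (chain n t).Nodup := by
  rw [chain, List.nodup_append]
  refine ⟨Finset.sort_nodup _ _, by simp, ?_⟩
  intro a ha b hb
  simp only [Finset.mem_sort, Finset.mem_filter, List.mem_singleton] at ha hb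
  exact hb ▸ ha.2.ne

/-- The time s ends its own chain at every stage, even before it is enumerated; hence the condition
`hs` for it to occur in the chain of t. -/
lemma chain_sublist {m n : ℕ} (hmn : m ≤ n) {s t : T} (hst : s ≤ t)
    (hs : s = t ∨ s ∈ exhaustion T n) : (chain m s).Sublist (chain n t) := by
  refine List.sublist_of_subperm_of_pairwise (List.subperm_of_subset (nodup_chain m s) ?_)
    (pairwise_chain m s) (pairwise_chain n t)
  intro a ha
  simp only [chain, List.mem_append, Finset.mem_sort, Finset.mem_filter, List.mem_singleton]
    at ha ⊢
  rcases ha with ha | rfl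
  · exact Or.inl ⟨exhaustion_mono hmn ha.1, ha.2.trans_le hst⟩
  · rcases hs with h | h
    · exact Or.inr h
    · rcases hst.lt_or_eq with h' | h'
      · exact Or.inl ⟨h, h'⟩
      · exact Or.inr h'

/-- The potential functions of the smallest peacock that starts above `g` and is dominated by the
measures with potentials `f t`. -/
noncomputable def obstructedShadow (f : T → ℝ → ℝ) (g : ℝ → ℝ) (t : T) (x : ℝ) : ℝ :=
  ⨆ n, iterShadow f g (chain n t) x

namespace Obstructs

lemma chain_add_le (h : Obstructs f g c) (n : ℕ) (t : T) (x : ℝ) :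
    iterShadow f g (chain n t) x + c x ≤ f t x :=
  (h.basic _ (pairwise_chain n t)).2.2 t (fun _ hs => le_of_mem_chain hs) x

lemma bddAbove (h : Obstructs f g c) (t : T) (x : ℝ) :
    BddAbove (range fun n => iterShadow f g (chain n t) x) := by
  refine ⟨f t x - c x, ?_⟩
  rintro _ ⟨n, rfl⟩
  linarith [h.chain_add_le n t x]

lemma chain_le_chain (h : Obstructs f g c) {m n : ℕ} (hmn : m ≤ n) {s t : T} (hst : s ≤ t)
    (hs : s = t ∨ s ∈ exhaustion T n) (x : ℝ) :
    iterShadow f g (chain m s) x ≤ iterShadow f g (chain n t) x :=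
  iterShadow_mono h.convex_f h.mono_f h.convex_c (chain_sublist hmn hst hs) (pairwise_chain n t)
    h.convex_g (fun _ => le_rfl) (fun s _ => h.add_le s) x

lemma tendsto (h : Obstructs f g c) (t : T) (x : ℝ) :
    Tendsto (fun n => iterShadow f g (chain n t) x) atTop (𝓝 (obstructedShadow f g t x)) :=
  tendsto_atTop_ciSup (fun _ _ hmn => h.chain_le_chain hmn le_rfl (Or.inl rfl) x) (h.bddAbove t x)

lemma convexOn (h : Obstructs f g c) (t : T) : ConvexOn ℝ univ (obstructedShadow f g t) :=
  convexOn_of_tendsto (Eventually.of_forall fun n => (h.basic _ (pairwise_chain n t)).1)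
    (h.tendsto t)

/-- The last shadow of each chain is taken in `f t` itself, so its complement there is convex, and
convexity passes to the limit. -/
lemma convexOn_sub (h : Obstructs f g c) (t : T) :
    ConvexOn ℝ univ fun x => f t x - obstructedShadow f g t x := by
  refine convexOn_of_tendsto (l := atTop) (Eventually.of_forall fun n => ?_)
    fun x => (h.tendsto t x).const_sub (f t x)
  have hp := pairwise_chain n t
  rw [chain, List.pairwise_append] at hp
  obtain ⟨h1, -, h3⟩ := h.basic _ hp.1
  simp only [chain, iterShadow_concat]
  refine convexOn_sub_shadow (h.convex_f t) h1 h.convex_c (h3 t fun s hs => ?_)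
  simp only [Finset.mem_sort, Finset.mem_filter] at hs
  exact hs.2.le

lemma mono (h : Obstructs f g c) {s t : T} (hst : s ≤ t) (x : ℝ) :
    obstructedShadow f g s x ≤ obstructedShadow f g t x := by
  refine ciSup_le fun n => ?_
  obtain ⟨k, hk⟩ := exists_mem_exhaustion s
  refine (h.chain_le_chain (le_max_left n k) hst (Or.inr ?_) x).trans
    (le_ciSup (h.bddAbove t x) (max n k))
  exact exhaustion_mono (le_max_right n k) hk

lemma le (h : Obstructs f g c) (t : T) (x : ℝ) : g x ≤ obstructedShadow f g t x :=
  ((h.basic _ (pairwise_chain 0 t)).2.1 x).trans (le_ciSup (h.bddAbove t x) 0)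

lemma obstructed_add_le (h : Obstructs f g c) (t : T) (x : ℝ) :
    obstructedShadow f g t x + c x ≤ f t x := by
  have : obstructedShadow f g t x ≤ f t x - c x :=
    ciSup_le fun n => by linarith [h.chain_add_le n t x]
  linarith

end Obstructs

/-- The obstructed shadow is the smallest admissible family. -/
lemma obstructedShadow_le {W : T → ℝ → ℝ} (hW : ∀ t, ConvexOn ℝ univ fun x => f t x - W t x)
    (hWm : ∀ s t, s ≤ t → ∀ x, W s x ≤ W t x) (hg : ∀ t x, g x ≤ W t x) (t : T) (x : ℝ) :
    obstructedShadow f g t x ≤ W t x :=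
  ciSup_le fun n => iterShadow_le hW hWm _ (pairwise_chain n t) (fun s _ => hg s) t
    (fun _ hs => le_of_mem_chain hs) (hg t) x

namespace Obstructs

lemma convexOn_sub_obstructed (h : Obstructs f g c) {g' c' : ℝ → ℝ} (h' : Obstructs f g' c')
    (hd : ConvexOn ℝ univ fun x => g' x - g x) (t : T) :
    ConvexOn ℝ univ fun x => obstructedShadow f g' t x - obstructedShadow f g t x :=
  convexOn_of_tendsto (Eventually.of_forall fun n =>
    convexOn_iterShadow_sub h.convex_f h.mono_f h'.convex_c _ (pairwise_chain n t) h.convex_g hd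
      fun s _ => h'.add_le s) fun x => (h'.tendsto t x).sub (h.tendsto t x)

/-- The competitor `W` follows the obstructed shadow of `g` up to time s and afterwards adds the
growth of the obstructed shadow of g'. Its complement after s is the complement for g' plus the
difference of the two shadows at s, both convex. Minimality of the obstructed shadow of `g` at t is
the claim. -/
lemma sub_le_sub (h : Obstructs f g c) {g' c' : ℝ → ℝ} (h' : Obstructs f g' c')
    (hd : ConvexOn ℝ univ fun x => g' x - g x) {s t : T} (hst : s ≤ t) (x : ℝ) :
    obstructedShadow f g' s x - obstructedShadow f g s x ≤
      obstructedShadow f g' t x - obstructedShadow f g t x := by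
  have key := obstructedShadow_le (f := f) (g := g)
    (W := fun u x => if u ≤ s then obstructedShadow f g u x else
      obstructedShadow f g s x + (obstructedShadow f g' u x - obstructedShadow f g' s x))
    ?_ ?_ ?_ t x
  · rcases hst.lt_or_eq with hlt | rfl
    · simp only [not_le.mpr hlt, if_false] at key
      linarith
    · exact le_rfl
  · intro u
    by_cases hu : u ≤ s
    · simpa [hu] using h.convexOn_sub u
    · simp only [hu, if_false]
      refine ((h'.convexOn_sub u).add (h.convexOn_sub_obstructed h' hd s)).of_eq fun x => ?_
      simp only [Pi.add_apply]
      ring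
  · intro u v huv x
    by_cases hu : u ≤ s <;> by_cases hv : v ≤ s
    · simpa [hu, hv] using h.mono huv x
    · simp only [hu, hv, if_true, if_false]
      have h1 := h.mono hu x
      have h2 := h'.mono (not_le.mp hv).le x
      linarith
    · exact absurd (huv.trans hv) hu
    · simp only [hu, hv, if_false]
      linarith [h'.mono huv x]
  · intro u x
    by_cases hu : u ≤ s
    · simpa [hu] using h.le u x
    · simp only [hu, if_false]
      have h1 := h.le s x
      have h2 := h'.mono (not_le.mp hu).le x
      linarith

/-- Lowering the obstructed shadow of g' by the convex function g' - g gives a competitor for `g`.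
-/
lemma add_le_obstructed {g' c' : ℝ → ℝ} (h' : Obstructs f g' c')
    (hd : ConvexOn ℝ univ fun x => g' x - g x) (t : T) (x : ℝ) :
    obstructedShadow f g t x + (g' x - g x) ≤ obstructedShadow f g' t x := by
  have key := obstructedShadow_le (f := f) (g := g)
    (W := fun u x => obstructedShadow f g' u x - (g' x - g x)) ?_ ?_ ?_ t x
  · linarith
  · intro u
    refine ((h'.convexOn_sub u).add hd).of_eq fun x => ?_
    simp only [Pi.add_apply]
    ring
  · intro u v huv x
    simpa using h'.mono huv x
  · intro u x
    linarith [h'.le u x]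

/-- If the complement of `g` at the minimal index is convex, the obstructed shadow starts at `g`. -/
lemma obstructed_bot (h : Obstructs f g c) {o : T} (ho : ∀ t, o ≤ t)
    (hd : ConvexOn ℝ univ fun x => f o x - g x) (x : ℝ) : obstructedShadow f g o x = g x := by
  refine le_antisymm ?_ (h.le o x)
  have key := obstructedShadow_le (f := f) (g := g)
    (W := fun u x => f u x - (f o x - g x)) ?_ ?_ ?_ o x
  · linarith
  · intro u
    simpa using hd
  · intro u v huv x
    linarith [h.mono_f u v huv x]
  · intro u x
    linarith [h.mono_f o u (ho u) x]

end Obstructs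

lemma measurable_obstructedShadow {α : Type*} [MeasurableSpace α] {f : α → T → ℝ → ℝ}
    {g : α → ℝ → ℝ} (hf : ∀ t x, Measurable fun a => f a t x)
    (hg : ∀ x, Measurable fun a => g a x) (t : T) (x : ℝ) :
    Measurable fun a => obstructedShadow (f a) (g a) t x :=
  Measurable.iSup fun n => measurable_iterShadow hf hg (chain n t) x

end Obstructed

/-! ### Convex functions as mixtures of (y - x)⁺ -/

section RightDerivative

variable {k : ℝ → ℝ}

lemma monotone_rightDeriv (hk : ConvexOn ℝ univ k) :
    Monotone fun x => derivWithin k (Ioi x) x := by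
  have := hk.monotoneOn_rightDeriv
  rw [interior_univ] at this
  exact monotoneOn_univ.mp this

lemma rightDeriv_le_sub (hk : ConvexOn ℝ univ k) (x : ℝ) :
    derivWithin k (Ioi x) x ≤ k (x + 1) - k x := by
  have h := hk.rightDeriv_le_slope_of_mem_interior (by simp : x ∈ interior univ)
    (mem_univ (x + 1)) (by linarith)
  rw [slope_def_field] at h
  simpa using h

lemma sub_le_rightDeriv (hk : ConvexOn ℝ univ k) (x : ℝ) :
    k x - k (x - 1) ≤ derivWithin k (Ioi x) x := by
  have h1 := hk.slope_le_leftDeriv_of_mem_interior (mem_univ (x - 1))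
    (by simp : x ∈ interior univ) (by linarith)
  have h2 := hk.leftDeriv_le_rightDeriv_of_mem_interior (by simp : x ∈ interior univ)
  rw [slope_def_field] at h1
  have h3 := h1.trans h2
  simpa using h3

/-- The right-continuous version of the derivative of a convex function. -/
noncomputable def derivStieltjes (hk : ConvexOn ℝ univ k) : StieltjesFunction ℝ :=
  (monotone_rightDeriv hk).stieltjesFunction

lemma sub_le_derivStieltjes (hk : ConvexOn ℝ univ k) (x : ℝ) :
    k x - k (x - 1) ≤ derivStieltjes hk x :=
  (sub_le_rightDeriv hk x).trans ((monotone_rightDeriv hk).le_rightLim le_rfl)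

/-- A right limit at x is bounded by the derivative at x + 1, which shifts the increment by one. The
shift is harmless for the limits at ±∞. -/
lemma derivStieltjes_le_sub (hk : ConvexOn ℝ univ k) (x : ℝ) :
    derivStieltjes hk x ≤ k (x + 1 + 1) - k (x + 1) :=
  ((monotone_rightDeriv hk).rightLim_le (by linarith : x < x + 1)).trans
    (rightDeriv_le_sub hk (x + 1))

lemma integral_derivStieltjes (hk : ConvexOn ℝ univ k) {a b : ℝ} (hab : a ≤ b) :
    ∫ z in a..b, derivStieltjes hk z = k b - k a := by
  have hm := monotone_rightDeriv hk
  have hae : ∀ᵐ z : ℝ, derivStieltjes hk z = derivWithin k (Ioi z) z := by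
    have := hm.countable_not_continuousAt.ae_notMem volume
    filter_upwards [this] with z hz
    simp only [not_not] at hz
    exact hz.continuousWithinAt.rightLim_eq
  rw [intervalIntegral.integral_congr_ae (hae.mono fun z hz _ => hz)]
  refine intervalIntegral.integral_eq_sub_of_hasDeriv_right_of_le hab
    (continuous_of_convexOn hk).continuousOn (fun z _ => ?_) hm.intervalIntegrable
  exact hk.hasDerivWithinAt_rightDeriv_of_mem_interior (by simp)

lemma derivStieltjes_tendsto_atTop (hk : ConvexOn ℝ univ k) (h0 : Tendsto k atTop (𝓝 0)) :
    Tendsto (derivStieltjes hk) atTop (𝓝 0) := by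
  refine tendsto_of_tendsto_of_tendsto_of_le_of_le (g := fun x => k x - k (x - 1))
    (h := fun x => k (x + 1 + 1) - k (x + 1)) ?_ ?_ (sub_le_derivStieltjes hk)
    (derivStieltjes_le_sub hk)
  · simpa [← sub_eq_add_neg] using
      h0.sub (h0.comp (tendsto_atTop_add_const_right _ (-1) tendsto_id))
  · have h1 := h0.comp (tendsto_atTop_add_const_right _ (1 : ℝ) tendsto_id)
    simpa using (h1.comp (tendsto_atTop_add_const_right _ (1 : ℝ) tendsto_id)).sub h1

lemma derivStieltjes_tendsto_atBot (hk : ConvexOn ℝ univ k) {m : ℝ}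
    (h0 : Tendsto (fun x => k x + x) atBot (𝓝 m)) :
    Tendsto (derivStieltjes hk) atBot (𝓝 (-1)) := by
  refine tendsto_of_tendsto_of_tendsto_of_le_of_le (g := fun x => k x - k (x - 1))
    (h := fun x => k (x + 1 + 1) - k (x + 1)) ?_ ?_ (sub_le_derivStieltjes hk)
    (derivStieltjes_le_sub hk)
  · have h1 := h0.comp (tendsto_atBot_add_const_right _ (-1 : ℝ) tendsto_id)
    have := (h0.sub h1).sub_const 1
    simp only [sub_self, zero_sub] at this
    refine this.congr fun x => ?_
    simp only [Function.comp, id]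
    rw [← sub_eq_add_neg]; ring
  · have h1 := h0.comp (tendsto_atBot_add_const_right _ (1 : ℝ) tendsto_id)
    have h2 := h1.comp (tendsto_atBot_add_const_right _ (1 : ℝ) tendsto_id)
    have := (h2.sub h1).sub_const 1
    simp only [sub_self, zero_sub] at this
    refine this.congr fun x => ?_
    simp only [Function.comp, id]
    ring

/-- Layer-cake formula: the mass of (x + t, ∞) is -k'(x + t), and integrating this over t > 0 gives
`k x`, because `k` vanishes at +∞. -/
lemma lintegral_derivStieltjes (hk : ConvexOn ℝ univ k) (h0 : Tendsto k atTop (𝓝 0)) (x : ℝ) :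
    ∫⁻ y, ENNReal.ofReal (y - x) ∂(derivStieltjes hk).measure = ENNReal.ofReal (k x) := by
  have hS := derivStieltjes_tendsto_atTop hk h0
  have hSle : ∀ z, derivStieltjes hk z ≤ 0 := fun z =>
    (derivStieltjes hk).mono.ge_of_tendsto hS z
  have e1 : ∫⁻ y, ENNReal.ofReal (y - x) ∂(derivStieltjes hk).measure =
      ∫⁻ y, ENNReal.ofReal (max (y - x) 0) ∂(derivStieltjes hk).measure := by
    simp [ENNReal.ofReal_max]
  have hpos : 0 ≤ᵐ[(derivStieltjes hk).measure] fun y => max (y - x) 0 :=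
    Eventually.of_forall fun y => le_max_right _ _
  rw [e1, lintegral_eq_lintegral_meas_lt _ hpos (by fun_prop)]
  have e2 : ∀ t ∈ Ioi (0 : ℝ), (derivStieltjes hk).measure {y | t < max (y - x) 0} =
      ENNReal.ofReal (-derivStieltjes hk (x + t)) := by
    intro t (ht : 0 < t)
    have : {y | t < max (y - x) 0} = Ioi (x + t) := by
      ext y
      simp only [mem_ofPred_eq, lt_max_iff, mem_Ioi]
      constructor
      · rintro (h | h) <;> linarith
      · intro h; left; linarith
    rw [this, StieltjesFunction.measure_Ioi _ hS, zero_sub]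
  rw [setLIntegral_congr_fun measurableSet_Ioi e2]
  have hint : ∀ a b : ℝ, IntervalIntegrable (fun t => -derivStieltjes hk (x + t)) volume a b := by
    intro a b
    have : Monotone fun t => derivStieltjes hk (x + t) := fun s t hst =>
      (derivStieltjes hk).mono (by linarith)
    exact this.intervalIntegrable.neg
  have hN : ∀ N : ℝ, 0 ≤ N → ∫ t in (0 : ℝ)..N, -derivStieltjes hk (x + t) = k x - k (x + N) := by
    intro N hN
    rw [intervalIntegral.integral_neg,
      intervalIntegral.integral_comp_add_left (fun z => derivStieltjes hk z),
      integral_derivStieltjes hk (by linarith)]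
    simp
  have hlim : Tendsto (fun N => ∫ t in (0 : ℝ)..N, -derivStieltjes hk (x + t)) atTop
      (𝓝 (k x)) := by
    have : Tendsto (fun N => k x - k (x + N)) atTop (𝓝 (k x - 0)) :=
      (h0.comp (tendsto_atTop_add_const_left _ x tendsto_id)).const_sub _
    rw [sub_zero] at this
    refine this.congr' ?_
    filter_upwards [eventually_ge_atTop 0] with N h using (hN N h).symm
  have hI : IntegrableOn (fun t => -derivStieltjes hk (x + t)) (Ioi 0) := by
    refine integrableOn_Ioi_of_intervalIntegral_norm_tendsto (k x) 0 (b := id) (l := atTop)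
      (fun N => ?_) tendsto_id ?_
    · exact (intervalIntegrable_iff.mp (hint 0 N)).mono_set (by
        intro z hz
        rw [uIoc_of_le (hz.1.le.trans hz.2 : 0 ≤ N)]; exact hz)
    · refine hlim.congr fun N => ?_
      refine intervalIntegral.integral_congr fun t _ => ?_
      simp [abs_of_nonpos (hSle _)]
  rw [← ofReal_integral_eq_lintegral_ofReal hI
    (Eventually.of_forall fun t => by simpa using hSle (x + t))]
  congr 1
  exact tendsto_nhds_unique (intervalIntegral_tendsto_integral_Ioi 0 hI tendsto_id) hlim

end RightDerivative

/-- A convex function that vanishes at `+∞` is an integral of the functions `x ↦ (y - x)⁺`. -/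
lemma exists_measure_lintegral_eq {k : ℝ → ℝ} (hk : ConvexOn ℝ univ k)
    (h0 : Tendsto k atTop (𝓝 0)) :
    ∃ κ : Measure ℝ, SFinite κ ∧ ∀ x, ∫⁻ y, ENNReal.ofReal (y - x) ∂κ = ENNReal.ofReal (k x) :=
  ⟨(derivStieltjes hk).measure, inferInstance, lintegral_derivStieltjes hk h0⟩

/-! ### Call functions -/

/-- The call function `x ↦ ∫ (y - x)⁺ dm(y)` of a measure. -/
noncomputable def call (m : Measure ℝ) (x : ℝ) : ℝ := ∫ y, max (y - x) 0 ∂m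

section Call

variable {m m' : Measure ℝ}

lemma call_nonneg (m : Measure ℝ) (x : ℝ) : 0 ≤ call m x :=
  integral_nonneg fun _ => le_max_right _ _

section Finite

variable [IsFiniteMeasure m]

lemma integrable_call (hm : Integrable (fun x : ℝ => x) m) (x : ℝ) :
    Integrable (fun y => max (y - x) 0) m :=
  (hm.sub (integrable_const x)).pos_part

lemma ofReal_call (hm : Integrable (fun x : ℝ => x) m) (x : ℝ) :
    ENNReal.ofReal (call m x) = ∫⁻ y, ENNReal.ofReal (y - x) ∂m := by
  rw [call, ofReal_integral_eq_lintegral_ofReal (integrable_call hm x)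
    (Eventually.of_forall fun _ => le_max_right _ _)]
  simp [ENNReal.ofReal_max]

lemma convexOn_call (hm : Integrable (fun x : ℝ => x) m) : ConvexOn ℝ univ (call m) := by
  refine ⟨convex_univ, fun x _ y _ a b ha hb hab => ?_⟩
  simp only [smul_eq_mul, call]
  rw [← integral_const_mul, ← integral_const_mul, ← integral_add
    ((integrable_call hm x).const_mul a) ((integrable_call hm y).const_mul b)]
  refine integral_mono (integrable_call hm _)
    (((integrable_call hm x).const_mul a).add ((integrable_call hm y).const_mul b)) fun z => ?_
  refine max_le ?_ (by positivity)
  have h1 := mul_le_mul_of_nonneg_left (le_max_left (z - x) 0) ha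
  have h2 := mul_le_mul_of_nonneg_left (le_max_left (z - y) 0) hb
  have : z = a * z + b * z := by rw [← add_mul, hab, one_mul]
  change _ ≤ a * max (z - x) 0 + b * max (z - y) 0
  linarith

lemma call_antitone (hm : Integrable (fun x : ℝ => x) m) : Antitone (call m) := fun x y hxy =>
  integral_mono (integrable_call hm y) (integrable_call hm x) fun z =>
    max_le_max_right _ (by linarith)

lemma call_tendsto_atTop (hm : Integrable (fun x : ℝ => x) m) :
    Tendsto (call m) atTop (𝓝 0) := by
  have : Tendsto (fun x => ∫ y, max (y - x) 0 ∂m) atTop (𝓝 (∫ _, 0 ∂m)) := by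
    refine tendsto_integral_filter_of_dominated_convergence (fun y => max (y - 0) 0)
      (Eventually.of_forall fun x => by fun_prop) ?_ (integrable_call hm 0) ?_
    · filter_upwards [eventually_ge_atTop 0] with x hx
      refine Eventually.of_forall fun y => ?_
      rw [Real.norm_of_nonneg (le_max_right _ _)]
      exact max_le_max_right _ (by linarith)
    · refine Eventually.of_forall fun y => ?_
      refine tendsto_const_nhds.congr' ?_
      filter_upwards [eventually_ge_atTop y] with x hx
      rw [max_eq_right (by linarith)]
  rwa [integral_zero] at this

lemma call_add {m' : Measure ℝ} [IsFiniteMeasure m'] (hm : Integrable (fun x : ℝ => x) m)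
    (hm' : Integrable (fun x : ℝ => x) m') (x : ℝ) : call (m + m') x = call m x + call m' x :=
  integral_add_measure (integrable_call hm x) (integrable_call hm' x)

end Finite

namespace IsP1

/-- Put–call parity: (y - x)⁺ + x = y + (x - y)⁺. -/
lemma call_add_eq (hm : IsP1 m) (x : ℝ) :
    call m x + x = ∫ y, y ∂m + ∫ y, max (x - y) 0 ∂m := by
  have := hm.prob
  have hp : Integrable (fun y => max (x - y) 0) m :=
    ((integrable_const x).sub hm.moment).pos_part
  have e : x = ∫ _, x ∂m := by simp
  nth_rw 2 [e]
  rw [call, ← integral_add (integrable_call hm.moment x) (integrable_const _),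
    ← integral_add hm.moment hp]
  congr 1; ext y
  rcases le_total x y with h | h
  · rw [max_eq_left (by linarith), max_eq_right (by linarith)]; ring
  · rw [max_eq_right (by linarith), max_eq_left (by linarith)]; ring

lemma mean_le (hm : IsP1 m) (x : ℝ) : ∫ y, y ∂m ≤ call m x + x := by
  rw [hm.call_add_eq]
  have : 0 ≤ ∫ y, max (x - y) 0 ∂m := integral_nonneg fun y => le_max_right (x - y) 0
  linarith

lemma call_add_mono (hm : IsP1 m) : Monotone fun x => call m x + x := by
  intro x y hxy
  have := hm.prob
  have hp : ∀ x, Integrable (fun y => max (x - y) 0) m := fun x =>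
    ((integrable_const x).sub hm.moment).pos_part
  simp only [hm.call_add_eq]
  have : ∫ z, max (x - z) 0 ∂m ≤ ∫ z, max (y - z) 0 ∂m :=
    integral_mono (hp x) (hp y) fun z => max_le_max_right _ (by linarith)
  linarith

lemma call_add_tendsto_atBot (hm : IsP1 m) :
    Tendsto (fun x => call m x + x) atBot (𝓝 (∫ y, y ∂m)) := by
  have := hm.prob
  have : Tendsto (fun x => ∫ y, max (x - y) 0 ∂m) atBot (𝓝 (∫ _, 0 ∂m)) := by
    refine tendsto_integral_filter_of_dominated_convergence (fun y => max (0 - y) 0)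
      (Eventually.of_forall fun x => by fun_prop) ?_
      (((integrable_const 0).sub hm.moment).pos_part) ?_
    · filter_upwards [eventually_le_atBot 0] with x hx
      refine Eventually.of_forall fun y => ?_
      rw [Real.norm_of_nonneg (le_max_right _ _)]
      exact max_le_max_right _ (by linarith)
    · refine Eventually.of_forall fun y => ?_
      refine tendsto_const_nhds.congr' ?_
      filter_upwards [eventually_le_atBot y] with x hx
      rw [max_eq_right (by linarith)]
  simp only [hm.call_add_eq]
  simpa using this.const_add (∫ y, y ∂m)

/-- Tails are right difference quotients of the call function. Hence the call function determines
the measure, and measurability of call functions gives measurability of the measure. -/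
lemma tendsto_call_slope (hm : IsP1 m) (x : ℝ) :
    Tendsto (fun n : ℕ => ((n : ℝ) + 1) * (call m x - call m (x + 1 / ((n : ℝ) + 1)))) atTop
      (𝓝 (m.real (Ioi x))) := by
  have := hm.prob
  have e : ∀ n : ℕ, ((n : ℝ) + 1) * (call m x - call m (x + 1 / ((n : ℝ) + 1))) =
      ∫ y, ((n : ℝ) + 1) * (max (y - x) 0 - max (y - (x + 1 / ((n : ℝ) + 1))) 0) ∂m := by
    intro n
    rw [integral_const_mul, integral_sub (integrable_call hm.moment _)
      (integrable_call hm.moment _)]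
    rfl
  simp only [e]
  have e2 : m.real (Ioi x) = ∫ y, (Ioi x).indicator (fun _ => (1 : ℝ)) y ∂m := by
    rw [integral_indicator_const _ measurableSet_Ioi]; simp
  rw [e2]
  refine tendsto_integral_of_dominated_convergence (fun _ => 1) (fun n => by fun_prop)
    (integrable_const _) (fun n => Eventually.of_forall fun y => ?_)
    (Eventually.of_forall fun y => ?_)
  · have hn : (0 : ℝ) < (n : ℝ) + 1 := by positivity
    have h1 : 0 ≤ max (y - x) 0 - max (y - (x + 1 / ((n : ℝ) + 1))) 0 := by
      have : 0 < 1 / ((n : ℝ) + 1) := by positivity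
      rw [sub_nonneg]; exact max_le_max_right _ (by linarith)
    have h2 : max (y - x) 0 - max (y - (x + 1 / ((n : ℝ) + 1))) 0 ≤ 1 / ((n : ℝ) + 1) := by
      have : 0 < 1 / ((n : ℝ) + 1) := by positivity
      rw [sub_le_iff_le_add]
      refine max_le ?_ ?_
      · linarith [le_max_left (y - (x + 1 / ((n : ℝ) + 1))) 0]
      · linarith [le_max_right (y - (x + 1 / ((n : ℝ) + 1))) 0]
    rw [Real.norm_of_nonneg (by positivity)]
    calc _ ≤ ((n : ℝ) + 1) * (1 / ((n : ℝ) + 1)) := by gcongr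
      _ = 1 := by field_simp
  · by_cases hy : x < y
    · rw [indicator_of_mem (mem_Ioi.mpr hy)]
      refine tendsto_const_nhds.congr' ?_
      have := tendsto_one_div_add_atTop_nhds_zero_nat (𝕜 := ℝ)
      filter_upwards [this.eventually_lt_const (sub_pos.mpr hy)] with n hn
      rw [max_eq_left (by linarith), max_eq_left (by linarith)]
      field_simp; ring
    · rw [indicator_of_notMem (by simpa using hy)]
      refine tendsto_const_nhds.congr fun n => ?_
      have : 0 < 1 / ((n : ℝ) + 1) := by positivity
      rw [max_eq_right (by linarith), max_eq_right (by linarith)]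
      simp

lemma continuous_call (hm : IsP1 m) : Continuous (call m) :=
  have := hm.prob
  continuous_of_convexOn (convexOn_call hm.moment)

lemma ext_of_call (hm : IsP1 m) (hm' : IsP1 m') (h : ∀ q : ℚ, call m q = call m' q) : m = m' := by
  have := hm.prob
  have := hm'.prob
  have hc : call m = call m' :=
    Rat.isDenseEmbedding_coe_real.dense.equalizer hm.continuous_call hm'.continuous_call
      (funext h)
  refine Measure.ext_of_Iic m m' fun x => ?_
  have h1 := hm.tendsto_call_slope x
  rw [hc] at h1
  have h2 : m.real (Ioi x) = m'.real (Ioi x) := tendsto_nhds_unique h1 (hm'.tendsto_call_slope x)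
  have h3 : m (Ioi x) = m' (Ioi x) := by
    rwa [measureReal_def, measureReal_def, ENNReal.toReal_eq_toReal_iff' (by simp) (by simp)] at h2
  rw [← compl_Ioi, prob_compl_eq_one_sub measurableSet_Ioi,
    prob_compl_eq_one_sub measurableSet_Ioi, h3]

end IsP1

/-- A convex function with the asymptotic behaviour of a call function is a call function. -/
lemma exists_isP1_call_eq {k : ℝ → ℝ} (hk : ConvexOn ℝ univ k) (h0 : Tendsto k atTop (𝓝 0))
    (hn : ∀ x, 0 ≤ k x) {a : ℝ} (ha : Tendsto (fun x => k x + x) atBot (𝓝 a)) :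
    ∃ m : Measure ℝ, IsP1 m ∧ call m = k ∧ ∫ y, y ∂m = a := by
  set κ := (derivStieltjes hk).measure with hκ
  have hS0 := derivStieltjes_tendsto_atTop hk h0
  have hS1 := derivStieltjes_tendsto_atBot hk ha
  have hprob : IsProbabilityMeasure κ := ⟨by
    rw [hκ, StieltjesFunction.measure_univ _ hS1 hS0]; simp⟩
  have hl := lintegral_derivStieltjes hk h0
  have hmom : Integrable (fun x : ℝ => x) κ := by
    have hp : Integrable (fun y : ℝ => max (y - 0) 0) κ := by
      refine ⟨by fun_prop, ?_⟩
      have hpos : 0 ≤ᵐ[κ] fun y : ℝ => max (y - 0) 0 :=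
        Eventually.of_forall fun y => le_max_right _ _
      rw [hasFiniteIntegral_iff_ofReal hpos]
      have := hl 0
      simp only [sub_zero] at this
      simp [ENNReal.ofReal_max, hκ, this]
    -- the negative part is controlled by the mass below `0`
    have hq : Integrable (fun y : ℝ => max (-y) 0) κ := by
      refine ⟨by fun_prop, ?_⟩
      have hpos : 0 ≤ᵐ[κ] fun y : ℝ => max (-y) 0 :=
        Eventually.of_forall fun y => le_max_right _ _
      rw [hasFiniteIntegral_iff_ofReal hpos]
      have hmono : Monotone fun (n : ℕ) (y : ℝ) => ENNReal.ofReal (min (max (-y) 0) n) := by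
        intro i j hij y
        exact ENNReal.ofReal_le_ofReal (min_le_min_left _ (by exact_mod_cast hij))
      have hsup : ∀ y : ℝ, Tendsto (fun n : ℕ => ENNReal.ofReal (min (max (-y) 0) n)) atTop
          (𝓝 (ENNReal.ofReal (max (-y) 0))) := by
        intro y
        refine tendsto_const_nhds.congr' ?_
        obtain ⟨N, hN⟩ := exists_nat_ge (max (-y) 0)
        filter_upwards [eventually_ge_atTop N] with n hn
        rw [min_eq_left (hN.trans (by exact_mod_cast hn))]
      have ht := lintegral_tendsto_of_tendsto_of_monotone (μ := κ)
        (f := fun (n : ℕ) (y : ℝ) => ENNReal.ofReal (min (max (-y) 0) n))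
        (fun n => by fun_prop) (Eventually.of_forall fun y i j hij => hmono hij y)
        (Eventually.of_forall hsup)
      -- From min(y⁻, n) + (y + n)⁺ = y⁺ + n, the truncated negative part has integral k(0) + n -
      -- k(-n), which converges to k(0) - a.
      have hb : ∀ n : ℕ, ∫⁻ y, ENNReal.ofReal (min (max (-y) 0) n) ∂κ ≤
          ENNReal.ofReal (k 0 - (k (-n) + (-n : ℝ))) := by
        intro n
        have e : ∀ y : ℝ, ENNReal.ofReal (min (max (-y) 0) n) + ENNReal.ofReal (y - (-n)) =
            ENNReal.ofReal (y - 0) + ENNReal.ofReal n := by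
          intro y
          have hn : (0 : ℝ) ≤ n := n.cast_nonneg
          have : ∀ z : ℝ, ENNReal.ofReal z = ENNReal.ofReal (max z 0) := fun z => by
            simp [ENNReal.ofReal_max]
          rw [this (y - (-n)), this (y - 0), ← ENNReal.ofReal_add (by positivity) (by positivity),
            ← ENNReal.ofReal_add (by positivity) (by positivity)]
          congr 1
          rcases le_total 0 y with h | h
          · rw [max_eq_right (by linarith : -y ≤ 0), min_eq_left (by linarith),
              max_eq_left (by linarith), max_eq_left (by linarith)]
            ring
          · rw [max_eq_left (by linarith : 0 ≤ -y), max_eq_right (by linarith : y - 0 ≤ 0)]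
            rcases le_total (-y) n with h' | h'
            · rw [min_eq_left h', max_eq_left (by linarith)]; ring
            · rw [min_eq_right h', max_eq_right (by linarith)]; ring
        have h1 : ∫⁻ y, ENNReal.ofReal (min (max (-y) 0) n) ∂κ + ENNReal.ofReal (k (-n)) =
            ENNReal.ofReal (k 0) + ENNReal.ofReal n := by
          rw [← hl (-n), ← hl 0, ← lintegral_add_left (by fun_prop)]
          simp only [e]
          rw [lintegral_add_right _ (by fun_prop)]
          simp [← hκ]
        rw [show k 0 - (k (-n) + (-n : ℝ)) = k 0 + n - k (-n) by ring,
          ENNReal.ofReal_sub _ (hn _), ENNReal.ofReal_add (hn 0) n.cast_nonneg, ← h1]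
        exact ENNReal.le_sub_of_add_le_right (by simp) le_rfl
      have hlim : Tendsto (fun n : ℕ => ENNReal.ofReal (k 0 - (k (-n) + (-n : ℝ)))) atTop
          (𝓝 (ENNReal.ofReal (k 0 - a))) := by
        refine ENNReal.tendsto_ofReal (Tendsto.const_sub _ ?_)
        exact ha.comp (tendsto_neg_atTop_atBot.comp tendsto_natCast_atTop_atTop)
      exact (le_of_tendsto_of_tendsto' ht hlim hb).trans_lt ENNReal.ofReal_lt_top
    refine (hp.sub hq).congr (Eventually.of_forall fun y => ?_)
    rcases le_total 0 y with h | h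
    · simp [h]
    · simp [h]
  have hP : IsP1 κ := ⟨hprob, hmom⟩
  have hck : call κ = k := by
    ext x
    have := ofReal_call hmom x
    rw [hl x] at this
    rwa [ENNReal.ofReal_eq_ofReal_iff (call_nonneg _ _) (hn x)] at this
  exact ⟨κ, hP, hck, tendsto_nhds_unique (hck ▸ hP.call_add_tendsto_atBot) ha⟩

end Call

/-! ### Convex order through call functions -/

section Order

variable {m m' : Measure ℝ}

lemma ConvexLE.call_le (h : ConvexLE m m') (hm' : IsP1 m') (x : ℝ) : call m x ≤ call m' x := by
  have := hm'.prob
  refine (h (fun y => max (y - x) 0) ?_ (integrable_call hm'.moment x)).2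
  refine convexOn_of_support fun z => ?_
  rcases le_total z x with hz | hz
  · exact ⟨0, fun p => by simp [max_eq_right (sub_nonpos.mpr hz)]⟩
  · refine ⟨1, fun p => ?_⟩
    rw [max_eq_left (sub_nonneg.mpr hz)]
    linarith [le_max_left (p - x) 0]

lemma ConvexLE.mean_eq (h : ConvexLE m m') (hm' : IsP1 m') : ∫ y, y ∂m = ∫ y, y ∂m' := by
  refine le_antisymm (h (fun y => y) (convexOn_id convex_univ) hm'.moment).2 ?_
  have := (h (fun y => -y) ((convexOn_affine 0 (-1) 0).of_eq fun x => by ring) hm'.moment.neg).2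
  rw [integral_neg, integral_neg] at this
  linarith

/-- Split `ψ` at its minimum 0 into a right half, reflected, and a left half. Both are convex and
vanish at +∞, so `ψ` is a positive mixture of calls and puts. -/
lemma lintegral_convex_le (hm : IsP1 m) (hm' : IsP1 m') (hmean : ∫ y, y ∂m = ∫ y, y ∂m')
    (h : ∀ x, call m x ≤ call m' x) {ψ : ℝ → ℝ} (hψ : ConvexOn ℝ univ ψ) (h0 : ψ 0 = 0)
    (hn : ∀ x, 0 ≤ ψ x) : ∫⁻ x, ENNReal.ofReal (ψ x) ∂m ≤ ∫⁻ x, ENNReal.ofReal (ψ x) ∂m' := by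
  have := hm.prob
  have := hm'.prob
  have c1 : ConvexOn ℝ univ fun x => ψ (max (-x) 0) := by
    refine convexOn_of_support fun x => ?_
    rcases le_or_gt 0 x with hx | hx
    · refine ⟨0, fun p => ?_⟩
      simp [hx, h0, hn]
    · obtain ⟨β, hβ⟩ := exists_support_of_convexOn hψ (-x)
      refine ⟨-β, fun p => ?_⟩
      rw [max_eq_left (by linarith)]
      rcases le_or_gt 0 p with hp | hp
      · rw [max_eq_right (by linarith)]
        have h1 := hβ 0
        have h2 := hn (-x)
        rw [h0] at h1 ⊢
        have : 0 ≤ β := by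
          by_contra! hneg
          nlinarith
        nlinarith
      · rw [max_eq_left (by linarith)]
        linarith [hβ (-p)]
  have c2 : ConvexOn ℝ univ fun x => ψ (min x 0) := by
    refine convexOn_of_support fun x => ?_
    rcases le_or_gt 0 x with hx | hx
    · refine ⟨0, fun p => ?_⟩
      simp [hx, h0, hn]
    · obtain ⟨β, hβ⟩ := exists_support_of_convexOn hψ x
      refine ⟨β, fun p => ?_⟩
      rw [min_eq_left hx.le]
      rcases le_or_gt 0 p with hp | hp
      · rw [min_eq_right hp]
        have h1 := hβ 0
        have h2 := hn x
        rw [h0] at h1 ⊢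
        have : β ≤ 0 := by
          by_contra! hneg
          nlinarith
        nlinarith
      · rw [min_eq_left hp.le]
        linarith [hβ p]
  have l1 : Tendsto (fun x => ψ (max (-x) 0)) atTop (𝓝 0) := by
    refine tendsto_const_nhds.congr' ?_
    filter_upwards [eventually_ge_atTop 0] with x hx
    rw [max_eq_right (by linarith), h0]
  have l2 : Tendsto (fun x => ψ (min x 0)) atTop (𝓝 0) := by
    refine tendsto_const_nhds.congr' ?_
    filter_upwards [eventually_ge_atTop 0] with x hx
    rw [min_eq_right hx, h0]
  obtain ⟨κ, _, hκ⟩ := exists_measure_lintegral_eq c1 l1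
  obtain ⟨ρ, _, hρ⟩ := exists_measure_lintegral_eq c2 l2
  -- Parity turns puts into calls minus the mean, so the right side increases with the call function
  -- once the mean is fixed.
  have key : ∀ {n : Measure ℝ}, IsP1 n → ∫⁻ x, ENNReal.ofReal (ψ x) ∂n =
      ∫⁻ y, ENNReal.ofReal (call n (-y)) ∂κ +
        ∫⁻ y, ENNReal.ofReal (call n y + y - ∫ z, z ∂n) ∂ρ := by
    intro n hn1
    have := hn1.prob
    have hψc := continuous_of_convexOn hψ
    have e : ∀ x, ENNReal.ofReal (ψ x) =
        ∫⁻ y, ENNReal.ofReal (y + x) ∂κ + ∫⁻ y, ENNReal.ofReal (y - x) ∂ρ := by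
      intro x
      have h1 := hκ (-x)
      simp only [sub_neg_eq_add, neg_neg] at h1
      rw [h1, hρ x, ← ENNReal.ofReal_add (hn _) (hn _)]
      rcases le_total 0 x with hx | hx
      · rw [max_eq_left hx, min_eq_right hx, h0, add_zero]
      · rw [max_eq_right hx, min_eq_left hx, h0, zero_add]
    simp only [e]
    have hmeas : Measurable fun x => ∫⁻ y, ENNReal.ofReal (y + x) ∂κ :=
      Measurable.lintegral_prod_right' (f := fun p : ℝ × ℝ => ENNReal.ofReal (p.2 + p.1))
        (by fun_prop)
    rw [lintegral_add_left hmeas]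
    congr 1
    · rw [lintegral_lintegral_swap (by fun_prop)]
      refine lintegral_congr fun y => ?_
      rw [ofReal_call hn1.moment]
      simp [add_comm]
    · rw [lintegral_lintegral_swap (by fun_prop)]
      refine lintegral_congr fun y => ?_
      have hp : Integrable (fun z => max (y - z) 0) n :=
        ((integrable_const y).sub hn1.moment).pos_part
      have hpos : 0 ≤ᵐ[n] fun z => max (y - z) 0 :=
        Eventually.of_forall fun _ => le_max_right _ _
      rw [hn1.call_add_eq, add_sub_cancel_left, ofReal_integral_eq_lintegral_ofReal hp hpos]
      simp [ENNReal.ofReal_max]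
  rw [key hm, key hm', hmean]
  gcongr with y y
  · exact h _
  · exact h _

/-- Subtracting a supporting line at 0 reduces to a nonnegative convex function vanishing at 0; the
affine part has the same integral because the means agree. -/
lemma convexLE_of_call_le (hm : IsP1 m) (hm' : IsP1 m') (hmean : ∫ y, y ∂m = ∫ y, y ∂m')
    (h : ∀ x, call m x ≤ call m' x) : ConvexLE m m' := by
  have := hm.prob
  have := hm'.prob
  intro φ hφ hi
  obtain ⟨β, hβ⟩ := exists_support_of_convexOn hφ 0
  simp only [sub_zero] at hβ
  have hψ : ConvexOn ℝ univ fun x => φ x - (φ 0 + β * x) :=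
    (hφ.add (convexOn_affine (-φ 0) (-β) 0)).of_eq fun x => by
      simp only [Pi.add_apply]; ring
  have hψc := continuous_of_convexOn hψ
  have hψn : ∀ x, 0 ≤ φ x - (φ 0 + β * x) := fun x => by linarith [hβ x]
  have hl := lintegral_convex_le hm hm' hmean h hψ (by simp) hψn
  have ha : ∀ {n : Measure ℝ}, IsP1 n → Integrable (fun x => φ 0 + β * x) n := fun {n} hn =>
    have := hn.prob
    (integrable_const _).add (hn.moment.const_mul β)
  have hi' : Integrable (fun x => φ x - (φ 0 + β * x)) m' := hi.sub (ha hm')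
  have hj : Integrable (fun x => φ x - (φ 0 + β * x)) m := by
    refine ⟨hψc.aestronglyMeasurable, ?_⟩
    rw [hasFiniteIntegral_iff_ofReal (Eventually.of_forall hψn)]
    refine hl.trans_lt ?_
    rw [← hasFiniteIntegral_iff_ofReal (Eventually.of_forall hψn)]
    exact hi'.2
  have hint : Integrable φ m := (hj.add (ha hm)).congr (Eventually.of_forall fun x => by simp)
  refine ⟨hint, ?_⟩
  rw [← ofReal_integral_eq_lintegral_ofReal hj (Eventually.of_forall hψn),
    ← ofReal_integral_eq_lintegral_ofReal hi' (Eventually.of_forall hψn),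
    ENNReal.ofReal_le_ofReal_iff (integral_nonneg hψn), integral_sub hint (ha hm),
    integral_sub hi (ha hm')] at hl
  have e : ∀ {n : Measure ℝ}, IsP1 n → ∫ x, (φ 0 + β * x) ∂n = φ 0 + β * ∫ x, x ∂n := by
    intro n hn
    have := hn.prob
    rw [integral_add (integrable_const _) (hn.moment.const_mul β), integral_const_mul]
    simp
  rw [e hm, e hm', hmean] at hl
  linarith

end Order

/-! ### Limits, averages and measurability -/

section ConvexLimits

variable {h : ℝ → ℝ}

lemma antitone_of_convexOn_of_bdd (hh : ConvexOn ℝ univ h) {C : ℝ} (hC : ∀ᶠ x in atTop, h x ≤ C) :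
    Antitone h := by
  intro x y hxy
  by_contra! hlt
  obtain ⟨β, hβ⟩ := exists_support_of_convexOn hh y
  have h1 := hβ x
  have hne : x < y := lt_of_le_of_ne hxy (by rintro rfl; exact lt_irrefl _ hlt)
  have hβ0 : 0 < β := by
    by_contra! hneg
    nlinarith
  have ht : Tendsto (fun p => h y + β * (p - y)) atTop atTop :=
    tendsto_atTop_add_const_left _ _
      ((tendsto_atTop_add_const_right _ _ tendsto_id).const_mul_atTop hβ0)
  obtain ⟨p, hp1, hp2⟩ := (hC.and (ht.eventually_gt_atTop C)).exists
  linarith [hβ p]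

lemma monotone_of_convexOn_of_bdd (hh : ConvexOn ℝ univ h) {C : ℝ} (hC : ∀ᶠ x in atBot, h x ≤ C) :
    Monotone h := by
  intro x y hxy
  by_contra! hlt
  obtain ⟨β, hβ⟩ := exists_support_of_convexOn hh x
  have h1 := hβ y
  have hne : x < y := lt_of_le_of_ne hxy (by rintro rfl; exact lt_irrefl _ hlt)
  have hβ0 : β < 0 := by
    by_contra! hneg
    nlinarith
  have ht : Tendsto (fun p => h x + β * (p - x)) atBot atTop :=
    tendsto_atTop_add_const_left _ _
      ((tendsto_atBot_add_const_right _ _ tendsto_id).const_mul_atBot_of_neg hβ0)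
  obtain ⟨p, hp1, hp2⟩ := (hC.and (ht.eventually_gt_atTop C)).exists
  linarith [hβ p]

lemma nonpos_of_convexOn_of_tendsto (hh : ConvexOn ℝ univ h) (hb : Tendsto h atBot (𝓝 0))
    (ht : Tendsto h atTop (𝓝 0)) (x : ℝ) : h x ≤ 0 := by
  refine le_of_forall_pos_le_add fun ε hε => ?_
  obtain ⟨p, hp1, hp2⟩ := ((hb.eventually_le_const hε).and (eventually_le_atBot x)).exists
  obtain ⟨q, hq1, hq2⟩ := ((ht.eventually_le_const hε).and (eventually_ge_atTop x)).exists
  have := hh.le_max_of_mem_Icc (mem_univ p) (mem_univ q) ⟨hp2, hq2⟩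
  rw [zero_add]
  exact this.trans (max_le hp1 hq1)

end ConvexLimits

lemma exists_tendsto_of_dense {ι : Type*} {l : Filter ι} [l.NeBot] {φ : ι → ℝ → ℝ}
    (hφ : ∀ᶠ i in l, ∀ x y, |φ i x - φ i y| ≤ |x - y|) (h : ∀ q : ℚ, ∃ v, Tendsto (φ · q) l (𝓝 v))
    (x : ℝ) : ∃ v, Tendsto (φ · x) l (𝓝 v) := by
  refine cauchy_map_iff_exists_tendsto.mp (Metric.cauchy_iff.mpr ⟨inferInstance, fun ε hε => ?_⟩)
  obtain ⟨q, hq1, hq2⟩ := exists_rat_btwn (show x < x + ε / 4 by linarith)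
  obtain ⟨v, hv⟩ := h q
  refine ⟨(φ · x) '' {i | |φ i x - φ i q| ≤ |x - q| ∧ dist (φ i q) v < ε / 4}, ?_, ?_⟩
  · refine image_mem_map ?_
    filter_upwards [hφ, hv.eventually (Metric.ball_mem_nhds v (by positivity : 0 < ε / 4))]
      with i h1 h2
    exact ⟨h1 x q, h2⟩
  · rintro _ ⟨i, ⟨hi1, hi2⟩, rfl⟩ _ ⟨j, ⟨hj1, hj2⟩, rfl⟩
    have hxq : |x - q| ≤ ε / 4 := by rw [abs_le]; constructor <;> linarith
    have hi3 := abs_le.mp (hi1.trans hxq)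
    have hj3 := abs_le.mp (hj1.trans hxq)
    simp only [Real.dist_eq, abs_lt] at *
    constructor <;> linarith [hi3.1, hi3.2, hj3.1, hj3.2]

lemma convexOn_intervalIntegral {u : ℝ → ℝ → ℝ} {a b : ℝ} (hab : a ≤ b)
    (hu : ∀ s, ConvexOn ℝ univ (u s))
    (hi : ∀ x, IntervalIntegrable (fun s => u s x) volume a b) :
    ConvexOn ℝ univ fun x => ∫ s in a..b, u s x := by
  refine ⟨convex_univ, fun x _ y _ p q hp hq hpq => ?_⟩
  simp only [smul_eq_mul]
  rw [← intervalIntegral.integral_const_mul, ← intervalIntegral.integral_const_mul,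
    ← intervalIntegral.integral_add ((hi x).const_mul p) ((hi y).const_mul q)]
  exact intervalIntegral.integral_mono_on hab (hi _) (((hi x).const_mul p).add ((hi y).const_mul q))
    fun s _ => (hu s).2 (mem_univ x) (mem_univ y) hp hq hpq

/-- A family of probability measures is measurable if its call functions are. -/
lemma measurable_of_call {α : Type*} [MeasurableSpace α] {m : α → Measure ℝ} (hm : ∀ a, IsP1 (m a))
    (h : ∀ x, Measurable fun a => call (m a) x) : Measurable m := by
  have := fun a => (hm a).prob
  have hpi : IsPiSystem (range (Ioi : ℝ → Set ℝ)) := isPiSystem_Ioi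
  refine Measurable.measure_of_isPiSystem_of_isProbabilityMeasure (borel_eq_generateFrom_Ioi ℝ) hpi
    ?_
  rintro _ ⟨x, rfl⟩
  have h1 : Measurable fun a => (m a).real (Ioi x) := by
    refine measurable_of_tendsto_metrizable (f := fun (n : ℕ) a =>
      ((n : ℝ) + 1) * (call (m a) x - call (m a) (x + 1 / ((n : ℝ) + 1)))) (fun n => ?_)
      (tendsto_pi_nhds.mpr fun a => (hm a).tendsto_call_slope x)
    exact ((h x).sub (h _)).const_mul _
  have h2 : (fun a => m a (Ioi x)) = fun a => ENNReal.ofReal ((m a).real (Ioi x)) := by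
    ext a; simp [measureReal_def]
  rw [h2]
  exact h1.ennreal_ofReal

lemma measurable_call_comp {α : Type*} [MeasurableSpace α] {m : α → Measure ℝ}
    (hm : ∀ a, IsP1 (m a))
    (h : Measurable m) (x : ℝ) : Measurable fun a => call (m a) x := by
  have e : (fun a => call (m a) x) = fun a => (∫⁻ y, ENNReal.ofReal (y - x) ∂(m a)).toReal := by
    ext a
    have := (hm a).prob
    rw [← ofReal_call (hm a).moment, ENNReal.toReal_ofReal (call_nonneg _ _)]
  rw [e]
  exact ((Measure.measurable_lintegral (by fun_prop)).comp h).ennreal_toReal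

/-! ### Measurable families of peacocks and their accumulated call functions -/

section Peacock

variable {T : Type*} [LinearOrder T] {θ : T → Measure ℝ}

lemma IsPeacock.call_mono (h : IsPeacock θ) {s t : T} (hst : s ≤ t) (x : ℝ) :
    call (θ s) x ≤ call (θ t) x := (h.mono s t hst).call_le (h.mem t) x

lemma IsPeacock.mean_eq (h : IsPeacock θ) {s t : T} (hst : s ≤ t) :
    ∫ y, y ∂θ s = ∫ y, y ∂θ t := (h.mono s t hst).mean_eq (h.mem t)

lemma isPeacock_of_call {a : ℝ} (h : ∀ t, IsP1 (θ t)) (hm : ∀ t, ∫ y, y ∂θ t = a)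
    (hc : ∀ s t, s ≤ t → ∀ x, call (θ s) x ≤ call (θ t) x) : IsPeacock θ :=
  ⟨h, fun s t hst => convexLE_of_call_le (h s) (h t) ((hm s).trans (hm t).symm) (hc s t hst)⟩

end Peacock

/-- A measurable family of peacocks, indexed by the real line, whose mixture over `(0, 1]` is
`μ`. -/
structure IsFlow {T : Type*} [LinearOrder T] (μ : T → Measure ℝ) (θ : ℝ → T → Measure ℝ) :
    Prop where
  peacock : ∀ b, IsPeacock (θ b)
  measurable : Measurable θ
  target_peacock : IsPeacock μ
  mixture : ∀ t B, MeasurableSet B → ∫⁻ b in Ioc (0 : ℝ) 1, θ b t B = μ t B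

/-- The call function of the mixture of `θ b t` over `0 < b ≤ r`. -/
noncomputable def accCall {T : Type*} (θ : ℝ → T → Measure ℝ) (r : ℝ) (t : T) (x : ℝ) : ℝ :=
  ∫ b in (0 : ℝ)..r, call (θ b t) x

namespace IsFlow

variable {T : Type*} [LinearOrder T] {μ : T → Measure ℝ} {θ : ℝ → T → Measure ℝ}

lemma target (h : IsFlow μ θ) (t : T) : IsP1 (μ t) := h.target_peacock.mem t

lemma measurable_call (h : IsFlow μ θ) (t : T) (x : ℝ) : Measurable fun b => call (θ b t) x :=
  measurable_call_comp (fun b => (h.peacock b).mem t) ((measurable_pi_apply t).comp h.measurable) x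

lemma lintegral_eq (h : IsFlow μ θ) (t : T) {f : ℝ → ℝ≥0∞} (hf : Measurable f) :
    ∫⁻ b in Ioc (0 : ℝ) 1, ∫⁻ y, f y ∂(θ b t) = ∫⁻ y, f y ∂(μ t) := by
  have hm : Measurable fun b => θ b t := (measurable_pi_apply t).comp h.measurable
  have e : μ t = (volume.restrict (Ioc (0 : ℝ) 1)).bind fun b => θ b t := by
    ext B hB
    rw [Measure.bind_apply hB hm.aemeasurable, h.mixture t B hB]
  rw [e, Measure.lintegral_bind hm.aemeasurable hf.aemeasurable]

lemma lintegral_call (h : IsFlow μ θ) (t : T) (x : ℝ) :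
    ∫⁻ b in Ioc (0 : ℝ) 1, ENNReal.ofReal (call (θ b t) x) = ENNReal.ofReal (call (μ t) x) := by
  have := (h.target t).prob
  rw [ofReal_call (h.target t).moment, ← h.lintegral_eq t (by fun_prop)]
  refine lintegral_congr fun b => ?_
  have := ((h.peacock b).mem t).prob
  rw [ofReal_call ((h.peacock b).mem t).moment]

lemma integrableOn (h : IsFlow μ θ) (t : T) (x : ℝ) :
    IntegrableOn (fun b => call (θ b t) x) (Ioc 0 1) := by
  refine ⟨(h.measurable_call t x).aestronglyMeasurable, ?_⟩
  rw [hasFiniteIntegral_iff_ofReal (Eventually.of_forall fun b => call_nonneg _ _),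
    h.lintegral_call t x]
  exact ENNReal.ofReal_lt_top

lemma intervalIntegrable (h : IsFlow μ θ) (t : T) (x : ℝ) {r s : ℝ} (hr : r ∈ Icc (0 : ℝ) 1)
    (hs : s ∈ Icc (0 : ℝ) 1) : IntervalIntegrable (fun b => call (θ b t) x) volume r s := by
  rw [intervalIntegrable_iff]
  refine (h.integrableOn t x).mono_set fun b hb => ?_
  rw [uIoc, mem_Ioc] at hb
  exact ⟨(le_min hr.1 hs.1).trans_lt hb.1, hb.2.trans (max_le hr.2 hs.2)⟩

lemma accCall_one (h : IsFlow μ θ) (t : T) (x : ℝ) : accCall θ 1 t x = call (μ t) x := by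
  rw [accCall, intervalIntegral.integral_of_le zero_le_one,
    integral_eq_lintegral_of_nonneg_ae (Eventually.of_forall fun b => call_nonneg _ _)
      (h.measurable_call t x).aestronglyMeasurable, h.lintegral_call t x,
    ENNReal.toReal_ofReal (call_nonneg _ _)]

lemma accCall_sub (h : IsFlow μ θ) (t : T) (x : ℝ) {r s : ℝ} (hr : r ∈ Icc (0 : ℝ) 1)
    (hs : s ∈ Icc (0 : ℝ) 1) : accCall θ s t x - accCall θ r t x = ∫ b in r..s, call (θ b t) x :=
  intervalIntegral.integral_interval_sub_left
    (h.intervalIntegrable t x ⟨le_rfl, zero_le_one⟩ hs)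
    (h.intervalIntegrable t x ⟨le_rfl, zero_le_one⟩ hr)

lemma convexOn_call (h : IsFlow μ θ) (b : ℝ) (t : T) : ConvexOn ℝ univ (call (θ b t)) :=
  have := ((h.peacock b).mem t).prob
  PeacockNSI.convexOn_call ((h.peacock b).mem t).moment

lemma convexOn_integral (h : IsFlow μ θ) (t : T) {r s : ℝ} (hr : 0 ≤ r) (hrs : r ≤ s)
    (hs : s ≤ 1) : ConvexOn ℝ univ fun x => ∫ b in r..s, call (θ b t) x :=
  convexOn_intervalIntegral hrs (fun b => h.convexOn_call b t)
    fun x => h.intervalIntegrable t x ⟨hr, hrs.trans hs⟩ ⟨hr.trans hrs, hs⟩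

lemma integral_mono (h : IsFlow μ θ) {s t : T} (hst : s ≤ t) (x : ℝ) {a b : ℝ} (ha : 0 ≤ a)
    (hab : a ≤ b) (hb : b ≤ 1) :
    ∫ u in a..b, call (θ u s) x ≤ ∫ u in a..b, call (θ u t) x :=
  intervalIntegral.integral_mono_on hab
    (h.intervalIntegrable s x ⟨ha, hab.trans hb⟩ ⟨ha.trans hab, hb⟩)
    (h.intervalIntegrable t x ⟨ha, hab.trans hb⟩ ⟨ha.trans hab, hb⟩)
    fun u _ => (h.peacock u).call_mono hst x

lemma call_mono (h : IsFlow μ θ) {s t : T} (hst : s ≤ t) (x : ℝ) :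
    call (μ s) x ≤ call (μ t) x := h.target_peacock.call_mono hst x

lemma integral_nonneg (_ : IsFlow μ θ) (t : T) (x : ℝ) {a b : ℝ} (hab : a ≤ b) :
    0 ≤ ∫ u in a..b, call (θ u t) x :=
  intervalIntegral.integral_nonneg hab fun _ _ => call_nonneg _ _

lemma convexOn_target (h : IsFlow μ θ) (t : T) : ConvexOn ℝ univ (call (μ t)) :=
  have := (h.target t).prob
  PeacockNSI.convexOn_call (h.target t).moment

variable {o : T}

lemma convexOn_accCall_sub (h : IsFlow μ θ) (t : T) {r s : ℝ} (hr : 0 ≤ r) (hrs : r ≤ s)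
    (hs : s ≤ 1) : ConvexOn ℝ univ fun x => accCall θ s t x - accCall θ r t x :=
  (h.convexOn_integral t hr hrs hs).of_eq fun x =>
    h.accCall_sub t x ⟨hr, hrs.trans hs⟩ ⟨hr.trans hrs, hs⟩

lemma target_sub_tendsto_atBot (h : IsFlow μ θ) (ho : ∀ t, o ≤ t) (t : T) :
    Tendsto (fun x => call (μ t) x - call (μ o) x) atBot (𝓝 0) := by
  have := (h.target t).call_add_tendsto_atBot.sub (h.target o).call_add_tendsto_atBot
  rw [h.target_peacock.mean_eq (ho t), sub_self] at this
  exact this.congr fun x => by ring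

lemma target_tendsto_atTop (h : IsFlow μ θ) (t : T) : Tendsto (call (μ t)) atTop (𝓝 0) :=
  have := (h.target t).prob
  call_tendsto_atTop (h.target t).moment

lemma ae_hasDerivAt_accCall (h : IsFlow μ θ) (t : T) :
    ∀ᵐ b : ℝ, b ∈ Ioo (0 : ℝ) 1 → ∀ q : ℚ,
      HasDerivAt (fun r => accCall θ r t q) (call (θ b t) q) b := by
  have : ∀ᵐ b : ℝ, ∀ q : ℚ, b ∈ uIcc (0 : ℝ) 1 → ∀ c ∈ uIcc (0 : ℝ) 1,
      HasDerivAt (fun r => ∫ u in c..r, call (θ u t) q) (call (θ b t) q) b :=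
    ae_all_iff.mpr fun q => (h.intervalIntegrable t q (r := 0) (s := 1) ⟨le_rfl, zero_le_one⟩
      ⟨zero_le_one, le_rfl⟩).ae_hasDerivAt_integral
  filter_upwards [this] with b hb hmem q
  rw [uIcc_of_le zero_le_one] at hb
  exact hb q (Ioo_subset_Icc_self hmem) 0 ⟨le_rfl, zero_le_one⟩

/-- The initial mass over (r, 1], not yet used, provides the convex `c`: together with the mass up
to r it makes up `μ o`. -/
lemma obstructs [Countable T] [Nonempty T] (h : IsFlow μ θ) (ho : ∀ t, o ≤ t) {r : ℝ}
    (hr : r ∈ Icc (0 : ℝ) 1) :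
    Obstructs (fun t => call (μ t)) (accCall θ r o) fun x => ∫ b in r..1, call (θ b o) x where
  convex_f := h.convexOn_target
  mono_f _ _ hst x := h.call_mono hst x
  convex_g := h.convexOn_integral o le_rfl hr.1 hr.2
  convex_c := h.convexOn_integral o hr.1 hr.2 le_rfl
  add_le t x := by
    rw [← h.accCall_sub o x hr ⟨zero_le_one, le_rfl⟩, h.accCall_one]
    linarith [h.call_mono (ho t) x]

end IsFlow

/-! ### The minimal accumulated call functions -/

variable {T : Type*} [LinearOrder T] [Countable T] [Nonempty T] {μ : T → Measure ℝ}
  {θ : ℝ → T → Measure ℝ} {o : T}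

/-- The call functions of the smallest peacock dominated by `μ` that starts with the mixture of
`θ b o` over `0 < b ≤ r`. -/
noncomputable def minCall (μ : T → Measure ℝ) (θ : ℝ → T → Measure ℝ) (o : T) (r : ℝ) (t : T)
    (x : ℝ) : ℝ :=
  obstructedShadow (fun t => call (μ t)) (accCall θ r o) t x

namespace IsFlow

lemma convexOn_minCall_sub (h : IsFlow μ θ) (ho : ∀ t, o ≤ t) (t : T) {r s : ℝ} (hr : 0 ≤ r)
    (hrs : r ≤ s) (hs : s ≤ 1) :
    ConvexOn ℝ univ fun x => minCall μ θ o s t x - minCall μ θ o r t x :=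
  (h.obstructs ho ⟨hr, hrs.trans hs⟩).convexOn_sub_obstructed (h.obstructs ho ⟨hr.trans hrs, hs⟩)
    (h.convexOn_accCall_sub o hr hrs hs) t

lemma minCall_sub_mono (h : IsFlow μ θ) (ho : ∀ t, o ≤ t) {t u : T} (htu : t ≤ u) {r s : ℝ}
    (hr : 0 ≤ r) (hrs : r ≤ s) (hs : s ≤ 1) (x : ℝ) :
    minCall μ θ o s t x - minCall μ θ o r t x ≤ minCall μ θ o s u x - minCall μ θ o r u x :=
  (h.obstructs ho ⟨hr, hrs.trans hs⟩).sub_le_sub (h.obstructs ho ⟨hr.trans hrs, hs⟩)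
    (h.convexOn_accCall_sub o hr hrs hs) htu x

lemma integral_le_minCall_sub (h : IsFlow μ θ) (ho : ∀ t, o ≤ t) (t : T) {r s : ℝ} (hr : 0 ≤ r)
    (hrs : r ≤ s) (hs : s ≤ 1) (x : ℝ) :
    ∫ b in r..s, call (θ b o) x ≤ minCall μ θ o s t x - minCall μ θ o r t x := by
  have := (h.obstructs ho ⟨hr.trans hrs, hs⟩).add_le_obstructed
    (h.convexOn_accCall_sub o hr hrs hs) t x
  rw [h.accCall_sub o x ⟨hr, hrs.trans hs⟩ ⟨hr.trans hrs, hs⟩] at this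
  unfold minCall
  linarith

lemma minCall_sub_le (h : IsFlow μ θ) (ho : ∀ t, o ≤ t) (t : T) {r s : ℝ} (hr : 0 ≤ r)
    (hrs : r ≤ s) (hs : s ≤ 1) (x : ℝ) :
    minCall μ θ o s t x - minCall μ θ o r t x ≤
      (∫ b in r..s, call (θ b o) x) + (call (μ t) x - call (μ o) x) := by
  have h1 := (h.obstructs ho ⟨hr, hrs.trans hs⟩).le t x
  have h2 := (h.obstructs ho ⟨hr.trans hrs, hs⟩).obstructed_add_le t x
  rw [← h.accCall_sub o x ⟨hr.trans hrs, hs⟩ ⟨zero_le_one, le_rfl⟩, h.accCall_one] at h2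
  rw [← h.accCall_sub o x ⟨hr, hrs.trans hs⟩ ⟨hr.trans hrs, hs⟩]
  unfold minCall
  linarith

lemma minCall_zero (h : IsFlow μ θ) (t : T) (x : ℝ) : minCall μ θ o 0 t x = 0 := by
  have hz : ∀ x, accCall θ 0 o x = 0 := fun x => by simp [accCall]
  refine le_antisymm ?_ ?_
  · exact obstructedShadow_le (W := fun _ _ => 0) (fun t => by simpa using h.convexOn_target t)
      (fun _ _ _ _ => le_rfl) (fun _ x => (hz x).le) t x
  · have hg : ConvexOn ℝ univ (accCall θ 0 o) := (convexOn_const 0 convex_univ).of_eq hz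
    have : Obstructs (fun t => call (μ t)) (accCall θ 0 o) fun _ => 0 :=
      ⟨h.convexOn_target, fun _ _ hst x => h.call_mono hst x, hg, convexOn_const 0 convex_univ,
        fun t x => by simpa [hz] using call_nonneg _ _⟩
    exact (hz x).ge.trans (this.le t x)

lemma minCall_nonneg (h : IsFlow μ θ) (ho : ∀ t, o ≤ t) {r : ℝ} (hr : r ∈ Icc (0 : ℝ) 1) (t : T)
    (x : ℝ) : 0 ≤ minCall μ θ o r t x := by
  have := h.integral_le_minCall_sub ho t le_rfl hr.1 hr.2 x
  rw [h.minCall_zero, sub_zero] at this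
  exact (h.integral_nonneg o x hr.1).trans this

/-- The family θ, accumulated up to r, is itself a competitor: its complement in `μ t` is the
mixture over (r, 1]. -/
lemma minCall_le_accCall (h : IsFlow μ θ) (ho : ∀ t, o ≤ t) {r : ℝ} (hr : r ∈ Icc (0 : ℝ) 1)
    (t : T) (x : ℝ) : minCall μ θ o r t x ≤ accCall θ r t x := by
  refine obstructedShadow_le (W := accCall θ r) (fun t => ?_)
    (fun s t hst x => h.integral_mono hst x le_rfl hr.1 hr.2)
    (fun t x => h.integral_mono (ho t) x le_rfl hr.1 hr.2) t x
  refine (h.convexOn_accCall_sub t hr.1 hr.2 le_rfl).of_eq fun x => ?_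
  rw [h.accCall_one]

lemma minCall_le (h : IsFlow μ θ) (ho : ∀ t, o ≤ t) {r : ℝ} (hr : r ∈ Icc (0 : ℝ) 1) (t : T)
    (x : ℝ) : minCall μ θ o r t x ≤ call (μ t) x := by
  have h2 := (h.obstructs ho hr).obstructed_add_le t x
  have h3 := h.integral_nonneg o x hr.2
  unfold minCall
  linarith

/-- The complement is convex and lies between 0 and call (μ t) - call (μ o), which vanishes at both
ends because the means agree. A convex function vanishing at ±∞ is nonpositive. -/
lemma minCall_one (h : IsFlow μ θ) (ho : ∀ t, o ≤ t) (t : T) (x : ℝ) :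
    minCall μ θ o 1 t x = call (μ t) x := by
  have h1 : (1 : ℝ) ∈ Icc (0 : ℝ) 1 := ⟨zero_le_one, le_rfl⟩
  refine le_antisymm (h.minCall_le ho h1 t x) ?_
  have hc := (h.obstructs ho h1).convexOn_sub t
  have hlo : ∀ x, 0 ≤ call (μ t) x - minCall μ θ o 1 t x := fun x => by
    linarith [h.minCall_le ho h1 t x]
  have hhi : ∀ x, call (μ t) x - minCall μ θ o 1 t x ≤ call (μ t) x - call (μ o) x := fun x => by
    have := (h.obstructs ho h1).le t x
    rw [h.accCall_one] at this
    unfold minCall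
    linarith
  have := nonpos_of_convexOn_of_tendsto hc
    (tendsto_of_tendsto_of_tendsto_of_le_of_le tendsto_const_nhds (h.target_sub_tendsto_atBot ho t)
      hlo hhi)
    (tendsto_of_tendsto_of_tendsto_of_le_of_le tendsto_const_nhds
      (by simpa using (h.target_tendsto_atTop t).sub (h.target_tendsto_atTop o)) hlo hhi) x
  unfold minCall
  linarith

lemma minCall_mono (h : IsFlow μ θ) (ho : ∀ t, o ≤ t) (t : T) {r s : ℝ} (hr : 0 ≤ r)
    (hrs : r ≤ s) (hs : s ≤ 1) (x : ℝ) : minCall μ θ o r t x ≤ minCall μ θ o s t x := by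
  have := h.integral_le_minCall_sub ho t hr hrs hs x
  linarith [h.integral_nonneg o x hrs]

lemma minCall_sub_antitone (h : IsFlow μ θ) (ho : ∀ t, o ≤ t) (t : T) {r s : ℝ} (hr : 0 ≤ r)
    (hrs : r ≤ s) (hs : s ≤ 1) :
    Antitone fun x => minCall μ θ o s t x - minCall μ θ o r t x := by
  refine antitone_of_convexOn_of_bdd (h.convexOn_minCall_sub ho t hr hrs hs) (C := 1) ?_
  filter_upwards [(h.target_tendsto_atTop t).eventually_le_const one_pos] with x hx
  linarith [h.minCall_le ho ⟨hr.trans hrs, hs⟩ t x, h.minCall_nonneg ho ⟨hr, hrs.trans hs⟩ t x]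

lemma minCall_sub_add_monotone (h : IsFlow μ θ) (ho : ∀ t, o ≤ t) (t : T) {r s : ℝ} (hr : 0 ≤ r)
    (hrs : r ≤ s) (hs : s ≤ 1) :
    Monotone fun x => minCall μ θ o s t x - minCall μ θ o r t x + (s - r) * x := by
  refine monotone_of_convexOn_of_bdd (C := 1 + ∫ b in r..s, call (θ b o) 0)
    (((h.convexOn_minCall_sub ho t hr hrs hs).add (convexOn_affine 0 (s - r) 0)).of_eq fun x => by
      simp only [Pi.add_apply]; ring) ?_
  filter_upwards [(h.target_sub_tendsto_atBot ho t).eventually_le_const one_pos,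
    eventually_le_atBot 0] with x hx hx0
  have h1 := h.minCall_sub_le ho t hr hrs hs x
  have h2 : ∫ b in r..s, call (θ b o) x ≤ ∫ b in r..s, (call (θ b o) 0 - x) := by
    have hi := fun x => h.intervalIntegrable o x ⟨hr, hrs.trans hs⟩ ⟨hr.trans hrs, hs⟩
    refine intervalIntegral.integral_mono_on hrs (hi x) ((hi 0).sub intervalIntegrable_const)
      fun b _ => ?_
    have := ((h.peacock b).mem o).call_add_mono hx0
    simp only at this
    linarith
  rw [intervalIntegral.integral_sub (h.intervalIntegrable o 0 ⟨hr, hrs.trans hs⟩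
    ⟨hr.trans hrs, hs⟩) intervalIntegrable_const, intervalIntegral.integral_const,
    smul_eq_mul] at h2
  linarith

/-- The increment over (r, s] behaves like the call function of a measure of mass s - r, so its
slopes lie in [-(s - r), 0]. This bound serves twice: difference quotients in r are 1-Lipschitz in
x, and differences in x are Lipschitz in r. -/
lemma abs_minCall_sub_sub_le (h : IsFlow μ θ) (ho : ∀ t, o ≤ t) (t : T) {r s : ℝ} (hr : 0 ≤ r)
    (hrs : r ≤ s) (hs : s ≤ 1) (x y : ℝ) :
    |(minCall μ θ o s t x - minCall μ θ o r t x) - (minCall μ θ o s t y - minCall μ θ o r t y)| ≤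
      (s - r) * |x - y| := by
  wlog hxy : x ≤ y generalizing x y
  · rw [abs_sub_comm, abs_sub_comm x]
    exact this y x (le_of_not_ge hxy)
  have h1 := h.minCall_sub_antitone ho t hr hrs hs hxy
  have h2 := h.minCall_sub_add_monotone ho t hr hrs hs hxy
  simp only at h1 h2
  rw [abs_of_nonneg (by linarith), abs_of_nonpos (by linarith)]
  linarith

end IsFlow

/-! ### Differentiating the minimal call functions in r -/

variable {T : Type*} [LinearOrder T] [Countable T] [Nonempty T] {μ : T → Measure ℝ}
  {θ : ℝ → T → Measure ℝ} {o : T}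

/-- The rate at which the minimal call function grows. -/
noncomputable def callRate (μ : T → Measure ℝ) (θ : ℝ → T → Measure ℝ) (o : T) (b : ℝ) (t : T)
    (x : ℝ) : ℝ :=
  deriv (fun r => minCall μ θ o r t x) b

lemma measurable_callRate (t : T) (x : ℝ) : Measurable fun b => callRate μ θ o b t x :=
  measurable_deriv _

/-- By Fatou the lower limit vanishes almost everywhere. Smallness along a subsequence is enough
later, since the rates are monotone in x, after adding x in the case of -∞. -/
lemma frequently_lt_of_tendsto_integral {w : ℕ → ℝ → ℝ} {s : Set ℝ}
    (hw : ∀ n, Measurable (w n)) (h0 : ∀ᵐ b ∂volume.restrict s, ∀ n, 0 ≤ w n b)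
    (hi : ∀ n, IntegrableOn (w n) s) (hlim : Tendsto (fun n => ∫ b in s, w n b) atTop (𝓝 0)) :
    ∀ᵐ b ∂volume.restrict s, ∀ ε > 0, ∃ᶠ n in atTop, w n b < ε := by
  have hl : Tendsto (fun n => ∫⁻ b in s, ENNReal.ofReal (w n b)) atTop (𝓝 0) := by
    have := ENNReal.tendsto_ofReal hlim
    rw [ENNReal.ofReal_zero] at this
    refine this.congr fun n => ?_
    exact ofReal_integral_eq_lintegral_ofReal (hi n) (h0.mono fun b hb => hb n)
  have hF := lintegral_liminf_le (μ := volume.restrict s) (u := atTop)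
    fun n => (hw n).ennreal_ofReal
  rw [hl.liminf_eq, nonpos_iff_eq_zero, lintegral_eq_zero_iff
    (Measurable.liminf fun n => (hw n).ennreal_ofReal)] at hF
  filter_upwards [hF] with b hb ε hε
  have : liminf (fun n => ENNReal.ofReal (w n b)) atTop < ENNReal.ofReal ε := by
    rw [hb]; simpa using hε
  exact (frequently_lt_of_liminf_lt (by isBoundedDefault) this).mono fun n hn =>
    (ENNReal.ofReal_lt_ofReal_iff hε).mp hn

/-- The parameters at which the minimal call functions have a derivative with the behaviour of the
call functions of a peacock. -/
structure IsRegular (μ : T → Measure ℝ) (θ : ℝ → T → Measure ℝ) (o : T) (b : ℝ) : Prop where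
  mem : b ∈ Ioo (0 : ℝ) 1
  diff : ∀ t (q : ℚ), DifferentiableAt ℝ (fun r => minCall μ θ o r t q) b
  init : ∀ q : ℚ, HasDerivAt (fun r => accCall θ r o q) (call (θ b o) q) b
  top : ∀ t, ∀ ε > 0, ∃ᶠ n : ℕ in atTop, callRate μ θ o b t n - call (θ b o) n < ε
  bot : ∀ t, ∀ ε > 0, ∃ᶠ n : ℕ in atTop, callRate μ θ o b t (-n) - call (θ b o) (-n) < ε

namespace IsFlow

lemma slope_sub_slope_le (h : IsFlow μ θ) (ho : ∀ t, o ≤ t) (t : T) {b s : ℝ}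
    (hb : b ∈ Ioo (0 : ℝ) 1) (hs : s ∈ Ioo (0 : ℝ) 1) (hsb : s ≠ b) (x y : ℝ) :
    |slope (fun r => minCall μ θ o r t x) b s - slope (fun r => minCall μ θ o r t y) b s| ≤
      |x - y| := by
  have key : ∀ {r s : ℝ}, 0 ≤ r → r < s → s ≤ 1 →
      |slope (fun r => minCall μ θ o r t x) r s - slope (fun r => minCall μ θ o r t y) r s| ≤
        |x - y| := by
    intro r s hr hrs hs
    have := h.abs_minCall_sub_sub_le ho t hr hrs.le hs x y
    have hp : 0 < s - r := by linarith
    rw [slope_def_field, slope_def_field, ← sub_div, abs_div, abs_of_pos hp, div_le_iff₀ hp]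
    linarith
  rcases lt_or_gt_of_ne hsb with hlt | hlt
  · rw [slope_comm, slope_comm (fun r => minCall μ θ o r t y)]
    exact key hs.1.le hlt hb.2.le
  · exact key hb.1.le hlt hs.2.le

lemma eventually_mem_Ioo {b : ℝ} (hb : b ∈ Ioo (0 : ℝ) 1) :
    ∀ᶠ s in 𝓝[≠] b, s ∈ Ioo (0 : ℝ) 1 ∧ s ≠ b := by
  filter_upwards [mem_nhdsWithin_of_mem_nhds (isOpen_Ioo.mem_nhds hb), self_mem_nhdsWithin]
    with s h1 h2 using ⟨h1, h2⟩

/-- The difference quotients are equi-Lipschitz in x, so differentiability at rational x spreads to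
all x, and one null set of parameters suffices. -/
lemma hasDerivAt_minCall (h : IsFlow μ θ) (ho : ∀ t, o ≤ t) {b : ℝ} (hb : b ∈ Ioo (0 : ℝ) 1)
    {t : T} (hd : ∀ q : ℚ, DifferentiableAt ℝ (fun r => minCall μ θ o r t q) b) (x : ℝ) :
    HasDerivAt (fun r => minCall μ θ o r t x) (callRate μ θ o b t x) b := by
  obtain ⟨v, hv⟩ := exists_tendsto_of_dense (l := 𝓝[≠] b)
    (φ := fun s x => slope (fun r => minCall μ θ o r t x) b s)
    ((eventually_mem_Ioo hb).mono fun s hs x y => h.slope_sub_slope_le ho t hb hs.1 hs.2 x y)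
    (fun q => ⟨_, (hd q).hasDerivAt.tendsto_slope⟩) x
  have := hasDerivAt_iff_tendsto_slope.mpr hv
  rwa [callRate, this.deriv]

section Rate

variable {b : ℝ}

lemma tendsto_callRate (h : IsFlow μ θ) (ho : ∀ t, o ≤ t) (hb : IsRegular μ θ o b) (t : T) (x : ℝ) :
    Tendsto (fun s => (minCall μ θ o s t x - minCall μ θ o b t x) / (s - b)) (𝓝[>] b)
      (𝓝 (callRate μ θ o b t x)) := by
  have := (h.hasDerivAt_minCall ho hb.mem (hb.diff t) x).tendsto_slope.mono_left
    (nhdsGT_le_nhdsNE b)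
  exact this.congr fun s => slope_def_field _ _ _

lemma eventually_Ioo_gt (hb : b ∈ Ioo (0 : ℝ) 1) : ∀ᶠ s in 𝓝[>] b, b < s ∧ s ≤ 1 := by
  filter_upwards [Ioc_mem_nhdsGT hb.2] with s hs using hs

lemma convexOn_callRate (h : IsFlow μ θ) (ho : ∀ t, o ≤ t) (hb : IsRegular μ θ o b) (t : T) :
    ConvexOn ℝ univ (callRate μ θ o b t) := by
  refine convexOn_of_tendsto ?_ (h.tendsto_callRate ho hb t)
  filter_upwards [eventually_Ioo_gt hb.mem] with s hs
  refine ((h.convexOn_minCall_sub ho t hb.mem.1.le hs.1.le hs.2).smul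
    (inv_nonneg.mpr (sub_nonneg.mpr hs.1.le))).of_eq fun x => ?_
  rw [smul_eq_mul, div_eq_inv_mul]

lemma callRate_mono (h : IsFlow μ θ) (ho : ∀ t, o ≤ t) (hb : IsRegular μ θ o b) {t u : T}
    (htu : t ≤ u) (x : ℝ) : callRate μ θ o b t x ≤ callRate μ θ o b u x := by
  refine le_of_tendsto_of_tendsto (h.tendsto_callRate ho hb t x) (h.tendsto_callRate ho hb u x) ?_
  filter_upwards [eventually_Ioo_gt hb.mem] with s hs
  have := h.minCall_sub_mono ho htu hb.mem.1.le hs.1.le hs.2 x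
  have : 0 < s - b := sub_pos.mpr hs.1
  gcongr

lemma callRate_antitone (h : IsFlow μ θ) (ho : ∀ t, o ≤ t) (hb : IsRegular μ θ o b) (t : T) :
    Antitone (callRate μ θ o b t) := by
  intro x y hxy
  refine le_of_tendsto_of_tendsto (h.tendsto_callRate ho hb t y) (h.tendsto_callRate ho hb t x) ?_
  filter_upwards [eventually_Ioo_gt hb.mem] with s hs
  have := h.minCall_sub_antitone ho t hb.mem.1.le hs.1.le hs.2 hxy
  have : 0 < s - b := sub_pos.mpr hs.1
  simp only at *
  gcongr

lemma callRate_add_monotone (h : IsFlow μ θ) (ho : ∀ t, o ≤ t) (hb : IsRegular μ θ o b) (t : T) :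
    Monotone fun x => callRate μ θ o b t x + x := by
  intro x y hxy
  refine le_of_tendsto_of_tendsto ((h.tendsto_callRate ho hb t x).add_const x)
    ((h.tendsto_callRate ho hb t y).add_const y) ?_
  filter_upwards [eventually_Ioo_gt hb.mem] with s hs
  have h1 := h.minCall_sub_add_monotone ho t hb.mem.1.le hs.1.le hs.2 hxy
  have : 0 < s - b := sub_pos.mpr hs.1
  simp only at h1
  rw [div_add' _ _ _ this.ne', div_add' _ _ _ this.ne', div_le_div_iff_of_pos_right this]
  linarith

lemma call_le_callRate (h : IsFlow μ θ) (ho : ∀ t, o ≤ t) (hb : IsRegular μ θ o b) (t : T)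
    (x : ℝ) : call (θ b o) x ≤ callRate μ θ o b t x := by
  have hc1 := continuous_of_convexOn (h.convexOn_callRate ho hb t)
  have hc2 := continuous_of_convexOn (h.convexOn_call b o)
  have hcl : IsClosed {x | call (θ b o) x ≤ callRate μ θ o b t x} := isClosed_le hc2 hc1
  refine (Rat.isDenseEmbedding_coe_real.dense.induction (P := fun x => call (θ b o) x ≤
    callRate μ θ o b t x) ?_ hcl) x
  rintro _ ⟨q, rfl⟩
  have h1 := (hb.init q).tendsto_slope.mono_left (nhdsGT_le_nhdsNE b)
  refine le_of_tendsto_of_tendsto h1 (h.tendsto_callRate ho hb t q) ?_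
  filter_upwards [eventually_Ioo_gt hb.mem] with s hs
  rw [slope_def_field, h.accCall_sub o q (Ioo_subset_Icc_self hb.mem)
    ⟨(hb.mem.1.trans hs.1).le, hs.2⟩]
  have := h.integral_le_minCall_sub ho t hb.mem.1.le hs.1.le hs.2 q
  have : 0 < s - b := sub_pos.mpr hs.1
  gcongr

lemma callRate_bot (h : IsFlow μ θ) (ho : ∀ t, o ≤ t) (hb : IsRegular μ θ o b) :
    callRate μ θ o b o = call (θ b o) := by
  have hc1 := continuous_of_convexOn (h.convexOn_callRate ho hb o)
  have hc2 := continuous_of_convexOn (h.convexOn_call b o)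
  refine Rat.isDenseEmbedding_coe_real.dense.equalizer hc1 hc2 (funext fun q => ?_)
  have h1 := h.hasDerivAt_minCall ho hb.mem (hb.diff o) q
  refine h1.unique ((hb.init q).congr_of_eventuallyEq ?_)
  filter_upwards [isOpen_Ioo.mem_nhds hb.mem] with r hr
  refine (h.obstructs ho (Ioo_subset_Icc_self hr)).obstructed_bot ho ?_ q
  refine (h.convexOn_accCall_sub o hr.1.le hr.2.le le_rfl).of_eq fun x => ?_
  rw [h.accCall_one]

lemma callRate_tendsto_atTop (h : IsFlow μ θ) (ho : ∀ t, o ≤ t) (hb : IsRegular μ θ o b) (t : T) :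
    Tendsto (callRate μ θ o b t) atTop (𝓝 0) := by
  have := ((h.peacock b).mem o).prob
  have hn : ∀ x, 0 ≤ callRate μ θ o b t x := fun x =>
    (call_nonneg _ _).trans (h.call_le_callRate ho hb t x)
  rw [Metric.tendsto_atTop]
  intro ε hε
  have h1 := (call_tendsto_atTop ((h.peacock b).mem o).moment).comp tendsto_natCast_atTop_atTop
  obtain ⟨n, hn1, hn2⟩ := ((hb.top t (ε / 2) (by positivity)).and_eventually
    (h1.eventually_lt_const (by positivity : 0 < ε / 2))).exists
  refine ⟨n, fun x hx => ?_⟩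
  have := h.callRate_antitone ho hb t hx
  simp only [Function.comp] at hn2
  rw [Real.dist_eq, sub_zero, abs_of_nonneg (hn x)]
  linarith

lemma callRate_add_tendsto_atBot (h : IsFlow μ θ) (ho : ∀ t, o ≤ t) (hb : IsRegular μ θ o b)
    (t : T) : Tendsto (fun x => callRate μ θ o b t x + x) atBot (𝓝 (∫ y, y ∂θ b o)) := by
  have hP := (h.peacock b).mem o
  have hn : ∀ x, ∫ y, y ∂θ b o ≤ callRate μ θ o b t x + x := fun x =>
    (hP.mean_le x).trans (by linarith [h.call_le_callRate ho hb t x])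
  rw [Metric.tendsto_nhds]
  intro ε hε
  have h1 := hP.call_add_tendsto_atBot.comp
    (tendsto_neg_atTop_atBot.comp tendsto_natCast_atTop_atTop)
  obtain ⟨n, hn1, hn2⟩ := ((hb.bot t (ε / 2) (by positivity)).and_eventually
    (h1.eventually_lt_const (show ∫ y, y ∂θ b o < ∫ y, y ∂θ b o + ε / 2 by linarith))).exists
  filter_upwards [eventually_le_atBot (-n : ℝ)] with x hx
  have := h.callRate_add_monotone ho hb t hx
  simp only [Function.comp] at hn2 this
  rw [Real.dist_eq, abs_of_nonneg (by linarith [hn x])]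
  linarith

/-- At a regular parameter the rates are the call functions of a peacock. -/
lemma exists_peacock_call_eq (h : IsFlow μ θ) (ho : ∀ t, o ≤ t) (hb : IsRegular μ θ o b) :
    ∃ η : T → Measure ℝ, IsPeacock η ∧ η o = θ b o ∧
      ∀ t, call (η t) = callRate μ θ o b t := by
  choose η h1 h2 h3 using fun t => exists_isP1_call_eq (h.convexOn_callRate ho hb t)
    (h.callRate_tendsto_atTop ho hb t)
    (fun x => (call_nonneg _ _).trans (h.call_le_callRate ho hb t x))
    (h.callRate_add_tendsto_atBot ho hb t)
  refine ⟨η, isPeacock_of_call h1 h3 fun s t hst x => ?_, ?_, h2⟩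
  · rw [h2, h2]
    exact h.callRate_mono ho hb hst x
  · refine (h1 o).ext_of_call ((h.peacock b).mem o) fun q => ?_
    rw [h2, h.callRate_bot ho hb]

end Rate

lemma monotoneOn_minCall (h : IsFlow μ θ) (ho : ∀ t, o ≤ t) (t : T) (x : ℝ) :
    MonotoneOn (fun r => minCall μ θ o r t x) (Icc 0 1) := fun _ hr _ hs hrs =>
  h.minCall_mono ho t hr.1 hrs hs.2 x

lemma ae_differentiableAt_minCall (h : IsFlow μ θ) (ho : ∀ t, o ≤ t) :
    ∀ᵐ b : ℝ, b ∈ Ioo (0 : ℝ) 1 → ∀ t (q : ℚ),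
      DifferentiableAt ℝ (fun r => minCall μ θ o r t q) b := by
  have : ∀ᵐ b : ℝ, ∀ t (q : ℚ), b ∈ Icc (0 : ℝ) 1 →
      DifferentiableWithinAt ℝ (fun r => minCall μ θ o r t q) (Icc 0 1) b :=
    ae_all_iff.mpr fun t => ae_all_iff.mpr fun q =>
      (h.monotoneOn_minCall ho t q).ae_differentiableWithinAt_of_mem
  filter_upwards [this] with b hb hmem t q
  exact (hb t q (Ioo_subset_Icc_self hmem)).differentiableAt (Icc_mem_nhds hmem.1 hmem.2)

lemma ae_hasDerivAt_minCall (h : IsFlow μ θ) (ho : ∀ t, o ≤ t) :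
    ∀ᵐ b : ℝ, b ∈ Ioo (0 : ℝ) 1 → ∀ t x,
      HasDerivAt (fun r => minCall μ θ o r t x) (callRate μ θ o b t x) b := by
  filter_upwards [h.ae_differentiableAt_minCall ho] with b hb hmem t x
  exact h.hasDerivAt_minCall ho hmem (hb hmem t) x

lemma intervalIntegrable_callRate (h : IsFlow μ θ) (ho : ∀ t, o ≤ t) (t : T) (x : ℝ) {r : ℝ}
    (hr : r ∈ Icc (0 : ℝ) 1) :
    IntervalIntegrable (fun b => callRate μ θ o b t x) volume 0 r := by
  refine MonotoneOn.intervalIntegrable_deriv ((h.monotoneOn_minCall ho t x).mono ?_)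
  rw [uIcc_of_le hr.1]
  exact Icc_subset_Icc_right hr.2

lemma integral_callRate_le (h : IsFlow μ θ) (ho : ∀ t, o ≤ t) (t : T) (x : ℝ) {r : ℝ}
    (hr : r ∈ Icc (0 : ℝ) 1) : ∫ b in (0 : ℝ)..r, callRate μ θ o b t x ≤ minCall μ θ o r t x := by
  have := MonotoneOn.intervalIntegral_deriv_mem_uIcc (a := 0) (b := r)
    (f := fun r => minCall μ θ o r t x) ((h.monotoneOn_minCall ho t x).mono (by
      rw [uIcc_of_le hr.1]
      exact Icc_subset_Icc_right hr.2))
  rw [h.minCall_zero, sub_zero, uIcc_of_le (h.minCall_nonneg ho hr t x)] at this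
  exact this.2

/-- Differences in x are Lipschitz in r, hence absolutely continuous, so the fundamental theorem of
calculus applies to them. A single `minCall` is so far known only to be monotone in r. -/
lemma integral_callRate_sub (h : IsFlow μ θ) (ho : ∀ t, o ≤ t) (t : T) (x y : ℝ) {r : ℝ}
    (hr : r ∈ Icc (0 : ℝ) 1) :
    (∫ b in (0 : ℝ)..r, callRate μ θ o b t x) - ∫ b in (0 : ℝ)..r, callRate μ θ o b t y =
      minCall μ θ o r t x - minCall μ θ o r t y := by
  rw [← intervalIntegral.integral_sub (h.intervalIntegrable_callRate ho t x hr)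
    (h.intervalIntegrable_callRate ho t y hr)]
  have hL : LipschitzOnWith (Real.toNNReal |x - y|)
      (fun r => minCall μ θ o r t x - minCall μ θ o r t y) (uIcc 0 r) := by
    refine LipschitzOnWith.of_dist_le_mul fun u hu v hv => ?_
    rw [uIcc_of_le hr.1] at hu hv
    rw [Real.coe_toNNReal _ (abs_nonneg _)]
    wlog huv : u ≤ v generalizing u v
    · rw [dist_comm, dist_comm u]
      exact this v hv u hu (le_of_not_ge huv)
    have := h.abs_minCall_sub_sub_le ho t hu.1 huv (hv.2.trans hr.2) x y
    rw [dist_comm, dist_comm u, Real.dist_eq, Real.dist_eq, abs_of_nonneg (sub_nonneg.mpr huv)]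
    calc _ = _ := by congr 1; ring
      _ ≤ _ := this
      _ = _ := by ring
  have := hL.absolutelyContinuousOnInterval.integral_deriv_eq_sub
  simp only [h.minCall_zero, sub_zero] at this
  rw [← this]
  refine intervalIntegral.integral_congr_ae ?_
  have h1 : ∀ᵐ b : ℝ, b ≠ 1 := by simp [ae_iff, measure_singleton]
  filter_upwards [h.ae_hasDerivAt_minCall ho, h1] with b hb hb1 hmem
  rw [uIoc_of_le hr.1] at hmem
  have hb' := hb ⟨hmem.1, lt_of_le_of_ne (hmem.2.trans hr.2) hb1⟩ t
  exact ((hb' x).sub (hb' y)).deriv.symm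

/-- Monotonicity in r gives one inequality. By the previous lemma the deficit does not depend on x,
and it is at most call (μ t) y for every y, which tends to 0 as y → ∞. -/
lemma integral_callRate (h : IsFlow μ θ) (ho : ∀ t, o ≤ t) (t : T) (x : ℝ) {r : ℝ}
    (hr : r ∈ Icc (0 : ℝ) 1) : ∫ b in (0 : ℝ)..r, callRate μ θ o b t x = minCall μ θ o r t x := by
  refine le_antisymm (h.integral_callRate_le ho t x hr) ?_
  have hn : ∀ y, 0 ≤ ∫ b in (0 : ℝ)..r, callRate μ θ o b t y := by
    intro y
    have := MonotoneOn.intervalIntegral_deriv_mem_uIcc (a := 0) (b := r)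
      (f := fun r => minCall μ θ o r t y) ((h.monotoneOn_minCall ho t y).mono (by
        rw [uIcc_of_le hr.1]
        exact Icc_subset_Icc_right hr.2))
    rw [h.minCall_zero, sub_zero, uIcc_of_le (h.minCall_nonneg ho hr t y)] at this
    exact this.1
  have : ∀ y, minCall μ θ o r t x - ∫ b in (0 : ℝ)..r, callRate μ θ o b t x ≤ call (μ t) y := by
    intro y
    have h1 := h.integral_callRate_sub ho t x y hr
    have h2 := h.minCall_le ho hr t y
    linarith [hn y]
  have := ge_of_tendsto' (h.target_tendsto_atTop t) this
  linarith

/-- A version for fixed x that does not presuppose regularity, since it is needed to prove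
regularity almost everywhere. -/
lemma ae_call_le_callRate (h : IsFlow μ θ) (ho : ∀ t, o ≤ t) (t : T) (x : ℝ) :
    ∀ᵐ b : ℝ, b ∈ Ioo (0 : ℝ) 1 → call (θ b o) x ≤ callRate μ θ o b t x := by
  have hd := (h.intervalIntegrable o x (r := 0) (s := 1) ⟨le_rfl, zero_le_one⟩
      ⟨zero_le_one, le_rfl⟩).ae_hasDerivAt_integral
  filter_upwards [hd, h.ae_hasDerivAt_minCall ho] with b hb hb2 hmem
  rw [uIcc_of_le zero_le_one] at hb
  have h1 := hb (Ioo_subset_Icc_self hmem) 0 ⟨le_rfl, zero_le_one⟩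
  have h2 := hb2 hmem t x
  refine le_of_tendsto_of_tendsto (h1.tendsto_slope.mono_left (nhdsGT_le_nhdsNE b))
    (h2.tendsto_slope.mono_left (nhdsGT_le_nhdsNE b)) ?_
  filter_upwards [eventually_Ioo_gt hmem] with s hs
  rw [slope_def_field, slope_def_field]
  have h3 := h.integral_le_minCall_sub ho t hmem.1.le hs.1.le hs.2 x
  have h4 := h.accCall_sub o x (Ioo_subset_Icc_self hmem) ⟨(hmem.1.trans hs.1).le, hs.2⟩
  have : 0 < s - b := sub_pos.mpr hs.1
  unfold accCall at h4
  rw [h4]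
  gcongr

/-- The difference is nonnegative almost everywhere, and its integral over the parameter is call (μ
t) - call (μ o) at `x n`, which tends to 0. -/
lemma ae_frequently (h : IsFlow μ θ) (ho : ∀ t, o ≤ t) (t : T) {x : ℕ → ℝ}
    (hx : Tendsto (fun n => call (μ t) (x n) - call (μ o) (x n)) atTop (𝓝 0)) :
    ∀ᵐ b : ℝ, b ∈ Ioo (0 : ℝ) 1 → ∀ ε > 0, ∃ᶠ n in atTop,
      callRate μ θ o b t (x n) - call (θ b o) (x n) < ε := by
  have hi := fun x => h.intervalIntegrable_callRate ho t x (r := 1) ⟨zero_le_one, le_rfl⟩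
  have hj := fun x => h.intervalIntegrable o x (r := 0) (s := 1) ⟨le_rfl, zero_le_one⟩
    ⟨zero_le_one, le_rfl⟩
  have := frequently_lt_of_tendsto_integral (s := Ioo 0 1)
    (w := fun n b => callRate μ θ o b t (x n) - call (θ b o) (x n))
    (fun n => (measurable_callRate t _).sub (h.measurable_call o _)) ?_ ?_ ?_
  · exact (ae_restrict_iff' measurableSet_Ioo).mp this
  · rw [ae_restrict_iff' measurableSet_Ioo]
    have : ∀ᵐ b : ℝ, ∀ n : ℕ, b ∈ Ioo (0 : ℝ) 1 → call (θ b o) (x n) ≤ callRate μ θ o b t (x n) :=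
      ae_all_iff.mpr fun n => h.ae_call_le_callRate ho t (x n)
    filter_upwards [this] with b hb hmem n
    exact sub_nonneg.mpr (hb n hmem)
  · intro n
    have := (hi (x n)).sub (hj (x n))
    rw [intervalIntegrable_iff, uIoc_of_le zero_le_one] at this
    exact this.mono_set Ioo_subset_Ioc_self
  · refine hx.congr fun n => ?_
    rw [← integral_Ioc_eq_integral_Ioo, ← intervalIntegral.integral_of_le zero_le_one,
      intervalIntegral.integral_sub (hi _) (hj _), h.integral_callRate ho t _ ⟨zero_le_one, le_rfl⟩,
      h.minCall_one ho]
    congr 1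
    exact (h.accCall_one o _).symm

lemma ae_isRegular (h : IsFlow μ θ) (ho : ∀ t, o ≤ t) :
    ∀ᵐ b : ℝ, b ∈ Ioo (0 : ℝ) 1 → IsRegular μ θ o b := by
  have h1 : ∀ᵐ b : ℝ, ∀ t, b ∈ Ioo (0 : ℝ) 1 → ∀ ε > 0, ∃ᶠ n : ℕ in atTop,
      callRate μ θ o b t n - call (θ b o) n < ε :=
    ae_all_iff.mpr fun t => h.ae_frequently ho t (x := fun n => (n : ℝ))
      (Tendsto.comp (g := fun x => call (μ t) x - call (μ o) x)
        (by simpa using (h.target_tendsto_atTop t).sub (h.target_tendsto_atTop o))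
        tendsto_natCast_atTop_atTop)
  have h2 : ∀ᵐ b : ℝ, ∀ t, b ∈ Ioo (0 : ℝ) 1 → ∀ ε > 0, ∃ᶠ n : ℕ in atTop,
      callRate μ θ o b t (-n) - call (θ b o) (-n) < ε :=
    ae_all_iff.mpr fun t => h.ae_frequently ho t (x := fun n => -(n : ℝ))
      ((h.target_sub_tendsto_atBot ho t).comp
        (tendsto_neg_atTop_atBot.comp tendsto_natCast_atTop_atTop))
  filter_upwards [h.ae_differentiableAt_minCall ho, h.ae_hasDerivAt_accCall o, h1, h2]
    with b hb1 hb2 hb3 hb4 hmem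
  exact ⟨hmem, hb1 hmem, hb2 hmem, fun t => hb3 t hmem, fun t => hb4 t hmem⟩

end IsFlow

/-! ### The cost as an integral of call functions -/

section Cost

lemma sqrt_support (x p : ℝ) :
    √(1 + x ^ 2) + x / √(1 + x ^ 2) * (p - x) ≤ √(1 + p ^ 2) := by
  have hx : 0 < √(1 + x ^ 2) := Real.sqrt_pos.mpr (by positivity)
  have hsq : √(1 + x ^ 2) * √(1 + x ^ 2) = 1 + x ^ 2 := Real.mul_self_sqrt (by positivity)
  have h1 : 1 + x * p ≤ √(1 + x ^ 2) * √(1 + p ^ 2) := by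
    rw [← Real.sqrt_mul (by positivity)]
    refine Real.le_sqrt_of_sq_le ?_
    nlinarith [sq_nonneg (x - p)]
  have h2 : √(1 + x ^ 2) + x / √(1 + x ^ 2) * (p - x) = (1 + x * p) / √(1 + x ^ 2) := by
    field_simp
    nlinarith
  rw [h2, div_le_iff₀ hx]
  linarith

lemma convexOn_sqrt_sub : ConvexOn ℝ univ fun x : ℝ => √(1 + x ^ 2) - x :=
  convexOn_of_support fun x => ⟨x / √(1 + x ^ 2) - 1, fun p => by linarith [sqrt_support x p]⟩

lemma sqrt_sub_pos (x : ℝ) : 0 < √(1 + x ^ 2) - x := by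
  have : |x| < √(1 + x ^ 2) := by
    rw [← Real.sqrt_sq_eq_abs]
    exact Real.sqrt_lt_sqrt (by positivity) (by linarith)
  linarith [le_abs_self x]

lemma sqrt_sub_tendsto : Tendsto (fun x : ℝ => √(1 + x ^ 2) - x) atTop (𝓝 0) := by
  refine tendsto_of_tendsto_of_tendsto_of_le_of_le' tendsto_const_nhds tendsto_inv_atTop_zero
    (Eventually.of_forall fun x => (sqrt_sub_pos x).le) ?_
  filter_upwards [eventually_gt_atTop 0] with x hx
  have : √(1 + x ^ 2) ≤ x + x⁻¹ := by
    refine Real.sqrt_le_iff.mpr ⟨by positivity, ?_⟩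
    have : x * x⁻¹ = 1 := mul_inv_cancel₀ hx.ne'
    nlinarith [sq_nonneg x⁻¹]
  linarith

lemma sqrt_midpoint_lt {a b : ℝ} (hab : a < b) :
    2 * √(1 + ((a + b) / 2) ^ 2) < √(1 + a ^ 2) + √(1 + b ^ 2) := by
  have ha : 0 < √(1 + a ^ 2) := Real.sqrt_pos.mpr (by positivity)
  have hb : 0 < √(1 + b ^ 2) := Real.sqrt_pos.mpr (by positivity)
  have ha2 : √(1 + a ^ 2) ^ 2 = 1 + a ^ 2 := Real.sq_sqrt (by positivity)
  have hb2 : √(1 + b ^ 2) ^ 2 = 1 + b ^ 2 := Real.sq_sqrt (by positivity)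
  have h1 : 1 + a * b < √(1 + a ^ 2) * √(1 + b ^ 2) := by
    rw [← Real.sqrt_mul (by positivity)]
    refine Real.lt_sqrt_of_sq_lt ?_
    nlinarith [sq_pos_of_pos (sub_pos.mpr hab)]
  have h2 : √(1 + ((a + b) / 2) ^ 2) < (√(1 + a ^ 2) + √(1 + b ^ 2)) / 2 := by
    rw [Real.sqrt_lt' (by positivity)]
    nlinarith
  linarith

lemma integrable_add_sqrt {m : Measure ℝ} (hm : IsP1 m) :
    Integrable (fun x : ℝ => x + √(1 + x ^ 2)) m := by
  have := hm.prob
  have hb : Integrable (fun x : ℝ => 1 + |x|) m := (integrable_const 1).add hm.moment.abs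
  refine hm.moment.add (hb.mono' (by fun_prop) (Eventually.of_forall fun x => ?_))
  rw [Real.norm_of_nonneg (Real.sqrt_nonneg _)]
  refine Real.sqrt_le_iff.mpr ⟨by positivity, ?_⟩
  nlinarith [abs_nonneg x, sq_abs x]

/-- The cost of a measure is an integral of its call function against a measure of full support. -/
lemma exists_cost_measure : ∃ κ : Measure ℝ, SFinite κ ∧ (∀ a b, a < b → κ (Ioo a b) ≠ 0) ∧
    ∀ m : Measure ℝ, IsP1 m → ENNReal.ofReal (∫ x, (x + √(1 + x ^ 2)) ∂m) =
      ∫⁻ z, ENNReal.ofReal (call m (-z)) ∂κ := by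
  obtain ⟨κ, hκs, hκ⟩ := exists_measure_lintegral_eq convexOn_sqrt_sub sqrt_sub_tendsto
  refine ⟨κ, hκs, fun a b hab h0 => ?_, fun m hm => ?_⟩
  -- Off (a, b) the functions (y - a)⁺ + (y - b)⁺ and 2(y - (a + b)/2)⁺ agree. If κ missed the
  -- interval, √(1 + x²) - x would have equality at the midpoint, against strict convexity.
  · have hae : ∀ᵐ y ∂κ, ENNReal.ofReal (y - a) + ENNReal.ofReal (y - b) =
        2 * ENNReal.ofReal (y - (a + b) / 2) := by
      have : ∀ᵐ y ∂κ, y ∉ Ioo a b := measure_eq_zero_iff_ae_notMem.mp h0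
      filter_upwards [this] with y hy
      simp only [mem_Ioo, not_and_or, not_lt] at hy
      rcases hy with hy | hy
      · rw [ENNReal.ofReal_of_nonpos (by linarith), ENNReal.ofReal_of_nonpos (by linarith),
          ENNReal.ofReal_of_nonpos (by linarith)]
        simp
      · rw [← ENNReal.ofReal_add (by linarith) (by linarith),
          show (2 : ℝ≥0∞) = ENNReal.ofReal 2 by simp, ← ENNReal.ofReal_mul (by norm_num)]
        congr 1; ring
    have h1 := lintegral_congr_ae hae
    rw [lintegral_add_left (by fun_prop), lintegral_const_mul _ (by fun_prop), hκ, hκ, hκ,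
      ← ENNReal.ofReal_add (sqrt_sub_pos _).le (sqrt_sub_pos _).le,
      show (2 : ℝ≥0∞) = ENNReal.ofReal 2 by simp, ← ENNReal.ofReal_mul (by norm_num),
      ENNReal.ofReal_eq_ofReal_iff (by linarith [sqrt_sub_pos a, sqrt_sub_pos b])
        (by linarith [sqrt_sub_pos ((a + b) / 2)])] at h1
    linarith [sqrt_midpoint_lt hab]
  · have := hm.prob
    have e : ∀ x : ℝ, x + √(1 + x ^ 2) = √(1 + (-x) ^ 2) - (-x) := fun x => by ring_nf
    rw [ofReal_integral_eq_lintegral_ofReal (integrable_add_sqrt hm)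
      (Eventually.of_forall fun x => by
        change 0 ≤ x + √(1 + x ^ 2)
        rw [e]; exact (sqrt_sub_pos (-x)).le)]
    simp only [e, ← hκ]
    rw [lintegral_lintegral_swap (by fun_prop)]
    refine lintegral_congr fun y => ?_
    rw [ofReal_call hm.moment]
    simp [add_comm]

/-- The weight 1 - b is the length of [b, 1]; Tonelli turns it into an integral of accumulations
over (0, r]. -/
lemma lintegral_one_sub_mul {w : ℝ → ℝ≥0∞} (hw : Measurable w) :
    ∫⁻ b in Ioc (0 : ℝ) 1, ENNReal.ofReal (1 - b) * w b =
      ∫⁻ r in Ioc (0 : ℝ) 1, ∫⁻ b in Ioc (0 : ℝ) r, w b := by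
  have hS : MeasurableSet {p : ℝ × ℝ | p.2 ≤ p.1} := measurableSet_le measurable_snd measurable_fst
  have e1 : ∀ r ∈ Ioc (0 : ℝ) 1, ∫⁻ b in Ioc (0 : ℝ) r, w b =
      ∫⁻ b in Ioc (0 : ℝ) 1, {p : ℝ × ℝ | p.2 ≤ p.1}.indicator (fun p => w p.2) (r, b) := by
    intro r hr
    have e : ∀ b, {p : ℝ × ℝ | p.2 ≤ p.1}.indicator (fun p => w p.2) (r, b) =
        (Iic r).indicator w b := fun b => by
      by_cases h : b ≤ r <;> simp [h]
    simp only [e]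
    rw [lintegral_indicator measurableSet_Iic, Measure.restrict_restrict measurableSet_Iic]
    congr 2
    ext b
    simp only [mem_Ioc, mem_inter_iff, mem_Iic]
    constructor
    · rintro ⟨h1, h2⟩; exact ⟨h2, h1, h2.trans hr.2⟩
    · rintro ⟨h1, h2, -⟩; exact ⟨h2, h1⟩
  rw [setLIntegral_congr_fun measurableSet_Ioc e1, lintegral_lintegral_swap
    (f := fun r b => {p : ℝ × ℝ | p.2 ≤ p.1}.indicator (fun p => w p.2) (r, b))
    (((hw.comp measurable_snd).indicator hS).aemeasurable)]
  refine setLIntegral_congr_fun measurableSet_Ioc fun b hb => ?_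
  have e : ∀ r, {p : ℝ × ℝ | p.2 ≤ p.1}.indicator (fun p => w p.2) (r, b) =
      (Ici b).indicator (fun _ => w b) r := fun r => by
    by_cases h : b ≤ r <;> simp [h]
  simp only [e]
  rw [lintegral_indicator measurableSet_Ici, Measure.restrict_restrict measurableSet_Ici,
    setLIntegral_const, mul_comm]
  congr 1
  have : Ici b ∩ Ioc 0 1 = Icc b 1 := by
    ext r
    simp only [mem_Ioc, mem_inter_iff, mem_Ici, mem_Icc]
    constructor
    · rintro ⟨h1, -, h2⟩; exact ⟨h1, h2⟩
    · rintro ⟨h1, h2⟩; exact ⟨h1, hb.1.trans_le h1, h2⟩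
  rw [this, Real.volume_Icc]

end Cost

/-- Equal means bound a negative part by the positive part; this yields the first moment of the
competitor's mixture. -/
lemma IsP1.lintegral_neg_le {m m' : Measure ℝ} (hm : IsP1 m) (hm' : IsP1 m')
    (h : ∫ y, y ∂m = ∫ y, y ∂m') :
    ∫⁻ y, ENNReal.ofReal (-y) ∂m ≤
      ∫⁻ y, ENNReal.ofReal y ∂m + ∫⁻ y, ENNReal.ofReal (-y) ∂m' := by
  have f1 : ∫⁻ y, ENNReal.ofReal y ∂m ≠ ⊤ := hm.moment.lintegral_lt_top.ne
  have f2 : ∫⁻ y, ENNReal.ofReal (-y) ∂m ≠ ⊤ := hm.moment.neg.lintegral_lt_top.ne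
  have f3 : ∫⁻ y, ENNReal.ofReal (-y) ∂m' ≠ ⊤ := hm'.moment.neg.lintegral_lt_top.ne
  rw [integral_eq_lintegral_pos_part_sub_lintegral_neg_part hm.moment,
    integral_eq_lintegral_pos_part_sub_lintegral_neg_part hm'.moment] at h
  rw [← ENNReal.toReal_le_toReal f2 (ENNReal.add_ne_top.mpr ⟨f1, f3⟩), ENNReal.toReal_add f1 f3]
  have : 0 ≤ (∫⁻ y, ENNReal.ofReal y ∂m').toReal := ENNReal.toReal_nonneg
  linarith

/-! ### The competitor, and minimality of the accumulated call functions -/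

/-- The total cost at the index `t` of a family of measures over `(0, 1]`. -/
noncomputable def flowCost {T : Type*} (θ : ℝ → T → Measure ℝ) (t : T) : ℝ≥0∞ :=
  ∫⁻ b in Ioc (0 : ℝ) 1, ENNReal.ofReal ((1 - b) * ∫ x, (x + √(1 + x ^ 2)) ∂(θ b t))

namespace IsFlow

section

variable {T : Type*} [LinearOrder T] {μ : T → Measure ℝ} {θ : ℝ → T → Measure ℝ}

lemma accCall_antitone (h : IsFlow μ θ) (t : T) {r : ℝ} (hr : r ∈ Icc (0 : ℝ) 1) :
    Antitone (accCall θ r t) := fun x y hxy =>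
  intervalIntegral.integral_mono_on hr.1
    (h.intervalIntegrable t y ⟨le_rfl, zero_le_one⟩ hr)
    (h.intervalIntegrable t x ⟨le_rfl, zero_le_one⟩ hr) fun b _ =>
      have := ((h.peacock b).mem t).prob
      call_antitone ((h.peacock b).mem t).moment hxy

/-- The cost is thus monotone in the accumulated call functions. -/
lemma flowCost_eq (h : IsFlow μ θ) {κ : Measure ℝ} [SFinite κ]
    (hκ : ∀ m : Measure ℝ, IsP1 m → ENNReal.ofReal (∫ x, (x + √(1 + x ^ 2)) ∂m) =
      ∫⁻ z, ENNReal.ofReal (call m (-z)) ∂κ) (t : T) :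
    flowCost θ t = ∫⁻ z, (∫⁻ r in Ioc (0 : ℝ) 1, ENNReal.ofReal (accCall θ r t (-z))) ∂κ := by
  have hmeas : Measurable (Function.uncurry fun b z => call (θ b t) (-z)) := by
    have := measurable_uncurry_of_continuous_of_measurable (u := fun z b => call (θ b t) (-z))
      (fun b => (((h.peacock b).mem t).continuous_call).comp continuous_neg)
      (fun z => h.measurable_call t (-z))
    exact this.comp measurable_swap
  have e1 : ∀ b ∈ Ioc (0 : ℝ) 1,
      ENNReal.ofReal ((1 - b) * ∫ x, (x + √(1 + x ^ 2)) ∂(θ b t)) =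
        ∫⁻ z, ENNReal.ofReal (1 - b) * ENNReal.ofReal (call (θ b t) (-z)) ∂κ := by
    intro b hb
    rw [ENNReal.ofReal_mul (by linarith [hb.2]), hκ _ ((h.peacock b).mem t),
      lintegral_const_mul]
    exact (((h.peacock b).mem t).continuous_call.measurable.comp measurable_neg).ennreal_ofReal
  rw [flowCost, setLIntegral_congr_fun measurableSet_Ioc e1, lintegral_lintegral_swap]
  · refine lintegral_congr fun z => ?_
    rw [lintegral_one_sub_mul (h.measurable_call t (-z)).ennreal_ofReal]
    refine setLIntegral_congr_fun measurableSet_Ioc fun r hr => ?_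
    have hr' : r ∈ Icc (0 : ℝ) 1 := ⟨hr.1.le, hr.2⟩
    have hi := h.intervalIntegrable t (-z) (r := 0) ⟨le_rfl, zero_le_one⟩ hr'
    rw [intervalIntegrable_iff, uIoc_of_le hr.1.le] at hi
    rw [accCall, intervalIntegral.integral_of_le hr.1.le, ofReal_integral_eq_lintegral_ofReal hi
      (Eventually.of_forall fun b => call_nonneg _ _)]
  · refine Measurable.aemeasurable ?_
    exact ((by fun_prop : Measurable fun p : ℝ × ℝ => ENNReal.ofReal (1 - p.1))).mul
      hmeas.ennreal_ofReal

end

variable {T : Type*} [LinearOrder T] [Countable T] [Nonempty T] {μ : T → Measure ℝ}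
  {θ : ℝ → T → Measure ℝ} {o : T}

/-- The minimal call functions are the accumulated call functions of a competitor. -/
lemma exists_competitor (h : IsFlow μ θ) (ho : ∀ t, o ≤ t) :
    ∃ θ' : ℝ → T → Measure ℝ, IsFlow μ θ' ∧ (∀ b, θ' b o = θ b o) ∧
      ∀ r ∈ Icc (0 : ℝ) 1, ∀ t x, accCall θ' r t x = minCall μ θ o r t x := by
  classical
  -- A measurable null set keeps the spliced family measurable: off `N` it is given by the rates, on
  -- `N` by θ itself, so every slice remains a peacock with the right initial law.
  obtain ⟨N, hN1, hN2, hN3⟩ := exists_measurable_superset_of_null (h.ae_isRegular ho)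
  have hreg : ∀ b ∈ Ioo (0 : ℝ) 1 \ N, IsRegular μ θ o b := by
    intro b hb
    by_contra hcon
    exact hb.2 (hN1 fun h => hcon (h hb.1))
  have hGm : MeasurableSet (Ioo (0 : ℝ) 1 \ N) := measurableSet_Ioo.diff hN2
  have hex : ∀ b, ∃ η : T → Measure ℝ, b ∈ Ioo (0 : ℝ) 1 \ N →
      IsPeacock η ∧ η o = θ b o ∧ ∀ t, call (η t) = callRate μ θ o b t := by
    intro b
    by_cases hb : b ∈ Ioo (0 : ℝ) 1 \ N
    · obtain ⟨η, hη⟩ := h.exists_peacock_call_eq ho (hreg b hb)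
      exact ⟨η, fun _ => hη⟩
    · exact ⟨θ b, fun hb' => absurd hb' hb⟩
  choose η hη using hex
  set θ' : ℝ → T → Measure ℝ := fun b => if b ∈ Ioo (0 : ℝ) 1 \ N then η b else θ b with hθ'
  have hpos : ∀ {b}, b ∈ Ioo (0 : ℝ) 1 \ N → θ' b = η b := fun {b} hb => by
    simp only [hθ', if_pos hb]
  have hneg : ∀ {b}, b ∉ Ioo (0 : ℝ) 1 \ N → θ' b = θ b := fun {b} hb => by
    simp only [hθ', if_neg hb]
  have hpeacock : ∀ b, IsPeacock (θ' b) := by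
    intro b
    by_cases hb : b ∈ Ioo (0 : ℝ) 1 \ N
    · rw [hpos hb]; exact (hη b hb).1
    · rw [hneg hb]; exact h.peacock b
  have hcall : ∀ b t x, call (θ' b t) x =
      if b ∈ Ioo (0 : ℝ) 1 \ N then callRate μ θ o b t x else call (θ b t) x := by
    intro b t x
    by_cases hb : b ∈ Ioo (0 : ℝ) 1 \ N
    · rw [hpos hb, if_pos hb, (hη b hb).2.2 t]
    · rw [hneg hb, if_neg hb]
  have hcm : ∀ t x, Measurable fun b => call (θ' b t) x := by
    intro t x
    simp only [hcall]
    exact Measurable.ite hGm (measurable_callRate t x) (h.measurable_call t x)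
  have hmt : ∀ t, Measurable fun b => θ' b t := fun t =>
    measurable_of_call (fun b => (hpeacock b).mem t) (hcm t)
  have hm : Measurable θ' := measurable_pi_lambda _ hmt
  have hae : ∀ t x, ∀ᵐ b : ℝ, b ∈ Ioc (0 : ℝ) 1 → call (θ' b t) x = callRate μ θ o b t x := by
    intro t x
    have h1 : ∀ᵐ b : ℝ, b ≠ 1 := by simp [ae_iff, measure_singleton]
    filter_upwards [h1, measure_eq_zero_iff_ae_notMem.mp hN3] with b hb1 hbN hmem
    rw [hcall, if_pos ⟨⟨hmem.1, lt_of_le_of_ne hmem.2 hb1⟩, hbN⟩]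
  have hacc : ∀ r ∈ Icc (0 : ℝ) 1, ∀ t x, accCall θ' r t x = minCall μ θ o r t x := by
    intro r hr t x
    rw [← h.integral_callRate ho t x hr, accCall]
    refine intervalIntegral.integral_congr_ae ?_
    filter_upwards [hae t x] with b hb hmem
    rw [uIoc_of_le hr.1] at hmem
    exact hb ⟨hmem.1, hmem.2.trans hr.2⟩
  have hinit : ∀ b, θ' b o = θ b o := by
    intro b
    by_cases hb : b ∈ Ioo (0 : ℝ) 1 \ N
    · rw [hpos hb, (hη b hb).2.1]
    · rw [hneg hb]
  refine ⟨θ', ⟨hpeacock, hm, h.target_peacock, fun t B hB => ?_⟩, hinit, hacc⟩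
  · have hprob : ∀ b, IsProbabilityMeasure (θ' b t) := fun b => ((hpeacock b).mem t).prob
    have : IsProbabilityMeasure (volume.restrict (Ioc (0 : ℝ) 1)) := ⟨by simp⟩
    have := (h.target t).prob
    have hbp : IsProbabilityMeasure ((volume.restrict (Ioc (0 : ℝ) 1)).bind fun b => θ' b t) :=
      isProbabilityMeasure_bind (hmt t).aemeasurable (Eventually.of_forall hprob)
    have hcl : ∀ x, ∫⁻ b in Ioc (0 : ℝ) 1, ENNReal.ofReal (call (θ' b t) x) =
        ENNReal.ofReal (call (μ t) x) := by
      intro x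
      have h1 := h.intervalIntegrable_callRate ho t x (r := 1) ⟨zero_le_one, le_rfl⟩
      rw [intervalIntegrable_iff, uIoc_of_le zero_le_one] at h1
      have h2 : IntegrableOn (fun b => call (θ' b t) x) (Ioc 0 1) := by
        refine Integrable.congr h1 ((ae_restrict_iff' measurableSet_Ioc).mpr ?_)
        filter_upwards [hae t x] with b hb hmem using (hb hmem).symm
      rw [← ofReal_integral_eq_lintegral_ofReal h2 (Eventually.of_forall fun b => call_nonneg _ _),
        ← intervalIntegral.integral_of_le zero_le_one, ← h.minCall_one ho t x,
        ← hacc 1 ⟨zero_le_one, le_rfl⟩ t x, accCall]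
    set β := (volume.restrict (Ioc (0 : ℝ) 1)).bind fun b => θ' b t with hβ
    have hbind : ∀ {f : ℝ → ℝ≥0∞}, Measurable f →
        ∫⁻ y, f y ∂β = ∫⁻ b in Ioc (0 : ℝ) 1, ∫⁻ y, f y ∂(θ' b t) := fun hf =>
      Measure.lintegral_bind (hmt t).aemeasurable hf.aemeasurable
    have hβc : ∀ x, ∫⁻ y, ENNReal.ofReal (y - x) ∂β = ENNReal.ofReal (call (μ t) x) := by
      intro x
      rw [hbind (by fun_prop), ← hcl x]
      exact lintegral_congr fun b => (ofReal_call ((hpeacock b).mem t).moment x).symm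
    -- The call function at 0 controls only the positive part. For the negative part, each slice has
    -- the mean of its initial law, and the initial laws mix to `μ o`.
    have hβn : ∫⁻ y, ENNReal.ofReal (-y) ∂β ≠ ⊤ := by
      have h1 : ∫⁻ y, ENNReal.ofReal (-y) ∂β ≤
          ∫⁻ b in Ioc (0 : ℝ) 1, (∫⁻ y, ENNReal.ofReal y ∂(θ' b t) +
            ∫⁻ y, ENNReal.ofReal (-y) ∂(θ b o)) := by
        rw [hbind (by fun_prop)]
        refine lintegral_mono fun b => ((hpeacock b).mem t).lintegral_neg_le
          ((h.peacock b).mem o) ?_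
        rw [← hinit b]
        exact ((hpeacock b).mean_eq (ho t)).symm
      have hmo : Measurable fun b => ∫⁻ y, ENNReal.ofReal (-y) ∂(θ b o) :=
        (Measure.measurable_lintegral (by fun_prop)).comp
          ((measurable_pi_apply o).comp h.measurable)
      rw [lintegral_add_right _ hmo, ← hbind (by fun_prop),
        h.lintegral_eq o (by fun_prop)] at h1
      have h2 := hβc 0
      simp only [sub_zero] at h2
      have h3 := (h.target o).moment.neg.lintegral_lt_top
      refine (h1.trans_lt (ENNReal.add_lt_top.mpr ⟨?_, h3⟩)).ne
      rw [h2]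
      exact ENNReal.ofReal_lt_top
    have hβP : IsP1 β := by
      refine ⟨hbp, measurable_id.aestronglyMeasurable, ?_⟩
      rw [hasFiniteIntegral_iff_norm]
      have e : ∀ y : ℝ, ENNReal.ofReal ‖y‖ ≤ ENNReal.ofReal (y - 0) + ENNReal.ofReal (-y) := by
        intro y
        rw [Real.norm_eq_abs]
        rcases abs_cases y with ⟨h1, -⟩ | ⟨h1, -⟩ <;> rw [h1]
        · simp
        · exact le_add_self
      refine (lintegral_mono e).trans_lt ?_
      rw [lintegral_add_left (by fun_prop), hβc]
      exact ENNReal.add_lt_top.mpr ⟨ENNReal.ofReal_lt_top, hβn.lt_top⟩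
    have hβe : β = μ t := hβP.ext_of_call (h.target t) fun q => by
      rw [← ENNReal.ofReal_eq_ofReal_iff (call_nonneg _ _) (call_nonneg _ _),
        ofReal_call hβP.moment, hβc]
    rw [← hβe, hβ, Measure.bind_apply hB (hmt t).aemeasurable]

/-- If the cost cannot be improved at any index, the accumulated call functions are minimal. -/
lemma accCall_eq_minCall (h : IsFlow μ θ) (ho : ∀ t, o ≤ t) {t : T} (hfin : flowCost θ t ≠ ⊤)
    (hopt : ∀ θ', IsFlow μ θ' → (∀ b, θ' b o = θ b o) → flowCost θ t ≤ flowCost θ' t) {r : ℝ}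
    (hr : r ∈ Icc (0 : ℝ) 1) (x : ℝ) : accCall θ r t x = minCall μ θ o r t x := by
  obtain ⟨θ', h', hinit, hacc⟩ := h.exists_competitor ho
  obtain ⟨κ, hκs, hκ0, hκ⟩ := exists_cost_measure
  have hle : ∀ r ∈ Icc (0 : ℝ) 1, ∀ x, accCall θ' r t x ≤ accCall θ r t x := fun r hr x => by
    rw [hacc r hr]; exact h.minCall_le_accCall ho hr t x
  rw [← hacc r hr]
  have hcont : ∀ {θ : ℝ → T → Measure ℝ}, IsFlow μ θ → ∀ x,
      ContinuousOn (fun r => accCall θ r t x) (Icc 0 1) := by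
    intro θ h x
    have := intervalIntegral.continuousOn_primitive_interval (a := 0) (b := 1)
      (f := fun b => call (θ b t) x) (μ := volume) (by
        rw [uIcc_of_le zero_le_one, integrableOn_Icc_iff_integrableOn_Ioc]
        exact h.integrableOn t x)
    rwa [uIcc_of_le zero_le_one] at this
  have hcontx : ∀ {θ : ℝ → T → Measure ℝ}, IsFlow μ θ → Continuous (accCall θ r t) := fun h =>
    continuous_of_convexOn (h.convexOn_integral t le_rfl hr.1 hr.2)
  have hmz : ∀ {θ : ℝ → T → Measure ℝ}, IsFlow μ θ →
      Measurable fun z => ∫⁻ r in Ioc (0 : ℝ) 1, ENNReal.ofReal (accCall θ r t (-z)) := by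
    intro θ h
    refine Monotone.measurable fun z w hzw => ?_
    exact setLIntegral_mono' measurableSet_Ioc fun r hr => ENNReal.ofReal_le_ofReal
      (h.accCall_antitone t ⟨hr.1.le, hr.2⟩ (neg_le_neg hzw))
  -- The integrands are ordered, and optimality gives the reverse inequality between their finite
  -- integrals, so they agree κ-almost everywhere.
  have hz : ∀ᵐ z ∂κ, ∫⁻ r in Ioc (0 : ℝ) 1, ENNReal.ofReal (accCall θ' r t (-z)) =
      ∫⁻ r in Ioc (0 : ℝ) 1, ENNReal.ofReal (accCall θ r t (-z)) := by
    refine ae_eq_of_ae_le_of_lintegral_le (Eventually.of_forall fun z => ?_) ?_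
      (hmz h).aemeasurable ?_
    · exact setLIntegral_mono' measurableSet_Ioc fun r hr => ENNReal.ofReal_le_ofReal
        (hle r ⟨hr.1.le, hr.2⟩ _)
    · rw [← h'.flowCost_eq hκ]
      refine ne_top_of_le_ne_top hfin ?_
      rw [h'.flowCost_eq hκ, h.flowCost_eq hκ]
      exact lintegral_mono fun z => setLIntegral_mono' measurableSet_Ioc fun r hr =>
        ENNReal.ofReal_le_ofReal (hle r ⟨hr.1.le, hr.2⟩ _)
    · rw [← h'.flowCost_eq hκ, ← h.flowCost_eq hκ]
      exact hopt θ' h' hinit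
  -- The same argument in r gives equality for almost every r, and continuity in r extends it to
  -- every r.
  have hz' : ∀ᵐ z ∂κ, accCall θ' r t (-z) = accCall θ r t (-z) := by
    filter_upwards [hz] with z hz
    have hae : (fun r => ENNReal.ofReal (accCall θ' r t (-z))) =ᵐ[volume.restrict (Ioc (0 : ℝ) 1)]
        fun r => ENNReal.ofReal (accCall θ r t (-z)) := by
      have hmr : ∀ {θ : ℝ → T → Measure ℝ}, IsFlow μ θ →
          AEMeasurable (fun r => ENNReal.ofReal (accCall θ r t (-z)))
            (volume.restrict (Ioc (0 : ℝ) 1)) := fun h =>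
        (((hcont h (-z)).mono Ioc_subset_Icc_self).aemeasurable measurableSet_Ioc).ennreal_ofReal
      refine ae_eq_of_ae_le_of_lintegral_le ?_ ?_ (hmr h) hz.ge
      · refine (ae_restrict_iff' measurableSet_Ioc).mpr (Eventually.of_forall fun r hr => ?_)
        exact ENNReal.ofReal_le_ofReal (hle r ⟨hr.1.le, hr.2⟩ _)
      · have : ∫⁻ r in Ioc (0 : ℝ) 1, ENNReal.ofReal (accCall θ' r t (-z)) ≤
            ∫⁻ _ in Ioc (0 : ℝ) 1, ENNReal.ofReal (call (μ t) (-z)) := by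
          refine setLIntegral_mono' measurableSet_Ioc fun r hr => ENNReal.ofReal_le_ofReal ?_
          rw [← h'.accCall_one t]
          have h2 := h'.accCall_sub t (-z) (r := r) (s := 1) ⟨hr.1.le, hr.2⟩ ⟨zero_le_one, le_rfl⟩
          have h3 := h'.integral_nonneg t (-z) hr.2
          linarith
        refine (this.trans_lt ?_).ne
        simp
    have hEq : EqOn (fun r => accCall θ' r t (-z)) (fun r => accCall θ r t (-z)) (Ioc 0 1) := by
      refine Measure.eqOn_Ioc_of_ae_eq (μ := volume) ?_
        ((hcont h' _).mono Ioc_subset_Icc_self) ((hcont h _).mono Ioc_subset_Icc_self)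
      filter_upwards [hae, ae_restrict_mem measurableSet_Ioc] with s hs hmem
      exact (ENNReal.ofReal_eq_ofReal_iff (h'.integral_nonneg t _ hmem.1.le)
        (h.integral_nonneg t _ hmem.1.le)).mp hs
    rcases eq_or_lt_of_le hr.1 with h0 | h0
    · simp [accCall, ← h0]
    · exact hEq ⟨h0, hr.2⟩
  -- A discrepancy at one x persists on an open interval, which κ charges.
  by_contra hne
  have hopen : IsOpen {z | accCall θ' r t (-z) ≠ accCall θ r t (-z)} :=
    isOpen_ne_fun ((hcontx h').comp continuous_neg) ((hcontx h).comp continuous_neg)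
  obtain ⟨a, b, hab, hsub⟩ := (mem_nhds_iff_exists_Ioo_subset).mp
    (hopen.mem_nhds (show -x ∈ _ by simpa using fun h => hne h.symm))
  exact hκ0 a b (hab.1.trans hab.2) (measure_mono_null hsub hz')

end IsFlow

/-! ### Uniform convergence of call functions -/

section Uniform

/-- The elementary bounds shared by call functions of probability measures with mean `A`, and by
their averages. -/
structure CallBounds (φ : ℝ → ℝ) (A : ℝ) : Prop where
  antitone : Antitone φ
  monotone : Monotone fun x => φ x + x
  nonneg : ∀ x, 0 ≤ φ x
  le : ∀ x, A ≤ φ x + x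

lemma IsP1.callBounds {m : Measure ℝ} (hm : IsP1 m) : CallBounds (call m) (∫ y, y ∂m) :=
  have := hm.prob
  ⟨call_antitone hm.moment, hm.call_add_mono, call_nonneg m, hm.mean_le⟩

/-- Pointwise convergence of call functions and of their means is uniform. -/
lemma CallBounds.eventually_abs_sub_le {ι : Type*} {l : Filter ι} {φ : ι → ℝ → ℝ} {A : ι → ℝ}
    {ψ : ℝ → ℝ} {B : ℝ} (hφ : ∀ᶠ i in l, CallBounds (φ i) (A i)) (hψ : CallBounds ψ B)
    (htop : Tendsto ψ atTop (𝓝 0)) (hbot : Tendsto (fun x => ψ x + x) atBot (𝓝 B))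
    (hq : ∀ q : ℚ, Tendsto (φ · q) l (𝓝 (ψ q))) (hA : Tendsto A l (𝓝 B)) {δ : ℝ} (hδ : 0 < δ) :
    ∀ᶠ i in l, ∀ x, |φ i x - ψ x| ≤ δ := by
  obtain ⟨r, hr⟩ := ((htop.comp tendsto_natCast_atTop_atTop).eventually_lt_const
    (by positivity : 0 < δ / 2)).exists
  obtain ⟨s, hs⟩ := ((hbot.comp (tendsto_neg_atTop_atBot.comp
    tendsto_natCast_atTop_atTop)).eventually_lt_const (by linarith : B < B + δ / 2)).exists
  simp only [Function.comp] at hr hs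
  obtain ⟨n, hn⟩ := exists_nat_one_div_lt (show 0 < δ / 4 by positivity)
  -- A finite rational grid from -s to r with mesh 1/(n + 1) < δ/4. The bounds in `CallBounds` make
  -- all functions 1-Lipschitz, so errors between grid points are controlled.
  have hgrid : ∀ᶠ i in l, ∀ k ∈ Finset.range ((s + r) * (n + 1) + 1),
      |φ i ((-s + k / (n + 1) : ℚ) : ℝ) - ψ ((-s + k / (n + 1) : ℚ) : ℝ)| < δ / 4 := by
    rw [Finset.eventually_all]
    intro k _
    exact (hq _).eventually (Metric.ball_mem_nhds _ (by positivity))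
  have hAe : ∀ᶠ i in l, |A i - B| < δ / 4 := hA.eventually (Metric.ball_mem_nhds _ (by positivity))
  filter_upwards [hφ, hgrid, hAe] with i hi hg hAi x
  have hn0 : (0 : ℝ) < (n : ℝ) + 1 := by positivity
  push_cast at hg
  have hgr : |φ i r - ψ r| < δ / 4 := by
    have := hg ((s + r) * (n + 1)) (Finset.self_mem_range_succ _)
    push_cast at this
    rwa [mul_div_assoc, div_self hn0.ne', mul_one, neg_add_cancel_left] at this
  have hgs : |φ i (-s) - ψ (-s)| < δ / 4 := by
    simpa using hg 0 (by simp)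
  rw [abs_lt] at hgr hgs hAi
  rw [abs_le]
  -- To the right of r both functions lie between 0 and their small values at r; to the left of -s
  -- the same holds after adding x and comparing with the means.
  rcases le_total (r : ℝ) x with hrx | hrx
  · have h1 := hi.antitone hrx
    have h2 := hψ.antitone hrx
    have h3 := hi.nonneg x
    have h4 := hψ.nonneg x
    constructor <;> linarith
  rcases le_total x (-(s : ℝ)) with hsx | hsx
  · have h1 := hi.monotone hsx
    have h2 := hψ.monotone hsx
    have h3 := hi.le x
    have h4 := hψ.le x
    simp only at h1 h2
    constructor <;> linarith
  · have hx0 : 0 ≤ (x + s) * (n + 1) := mul_nonneg (by linarith) hn0.le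
    set k := ⌊(x + s) * (n + 1)⌋₊ with hk
    have hk1 : (k : ℝ) ≤ (x + s) * (n + 1) := Nat.floor_le hx0
    have hk2 : (x + s) * (n + 1) < k + 1 := Nat.lt_floor_add_one _
    have hk3 : k ∈ Finset.range ((s + r) * (n + 1) + 1) := by
      rw [Finset.mem_range, Nat.lt_succ_iff]
      refine Nat.floor_le_of_le ?_
      push_cast
      exact mul_le_mul_of_nonneg_right (by linarith) hn0.le
    have h0 := abs_lt.mp (hg k hk3)
    set p : ℝ := -s + k / (n + 1) with hp
    have hpx : p ≤ x := by
      have : (k : ℝ) / (n + 1) ≤ x + s := (div_le_iff₀ hn0).mpr hk1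
      linarith
    have hxp : x < p + δ / 4 := by
      have : x + s < ((k : ℝ) + 1) / (n + 1) := (lt_div_iff₀ hn0).mpr hk2
      rw [add_div] at this
      linarith
    have h1 := hi.antitone hpx
    have h2 := hψ.antitone hpx
    have h3 := hi.monotone hpx
    have h4 := hψ.monotone hpx
    simp only at h3 h4
    constructor <;> linarith

end Uniform

/-! ### From minimal accumulation to NSI slices -/

/-- The potential functions of the smallest peacock dominated by twice the peacock `θ` that starts
above `θ o`. -/
noncomputable def improvedCall {T : Type*} [LinearOrder T] [Countable T] [Nonempty T]
    (θ : T → Measure ℝ) (o : T) (t : T) (x : ℝ) : ℝ :=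
  obstructedShadow (fun t x => 2 * call (θ t) x) (call (θ o)) t x

section NSI

variable {T : Type*} [LinearOrder T] {θ : T → Measure ℝ} {o : T}

lemma IsPeacock.obstructs (h : IsPeacock θ) (ho : ∀ t, o ≤ t) :
    Obstructs (fun t x => 2 * call (θ t) x) (call (θ o)) (call (θ o)) where
  convex_f t := by
    have := (h.mem t).prob
    exact (convexOn_call (h.mem t).moment).smul zero_le_two
  mono_f s t hst x := by linarith [h.call_mono hst x]
  convex_g := have := (h.mem o).prob; convexOn_call (h.mem o).moment
  convex_c := have := (h.mem o).prob; convexOn_call (h.mem o).moment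
  add_le t x := by linarith [h.call_mono (ho t) x]

variable [Countable T] [Nonempty T]

/-- Since 2θ - ζ is a measure, its call function is convex, so the call functions of ζ are
competitors for the obstructed shadow. -/
lemma improvedCall_le_call {ζ : T → Measure ℝ} (h : IsPeacock θ) (hζ : IsPeacock ζ)
    (ho : ∀ t, o ≤ t) (hinit : ζ o = θ o) (hle : ∀ t, ζ t ≤ (2 : ℝ≥0∞) • θ t) (t : T) (x : ℝ) :
    improvedCall θ o t x ≤ call (ζ t) x := by
  refine obstructedShadow_le (W := fun t => call (ζ t)) (fun t => ?_)
    (fun s t hst => hζ.call_mono hst) (fun t x => ?_) t x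
  · have := (h.mem t).prob
    have := (hζ.mem t).prob
    have hfin : IsFiniteMeasure ((2 : ℝ≥0∞) • θ t) := Measure.smul_finite _ (by simp)
    have hi : Integrable (fun x : ℝ => x) ((2 : ℝ≥0∞) • θ t) :=
      (h.mem t).moment.smul_measure (by simp)
    have hsub : (2 : ℝ≥0∞) • θ t - ζ t ≤ (2 : ℝ≥0∞) • θ t := Measure.sub_le
    have hfin' : IsFiniteMeasure ((2 : ℝ≥0∞) • θ t - ζ t) := isFiniteMeasure_of_le _ hsub
    refine (convexOn_call (hi.mono_measure hsub)).of_eq fun x => ?_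
    have h1 := call_add (hi.mono_measure hsub) (hζ.mem t).moment x
    rw [Measure.sub_add_cancel_of_le (hle t)] at h1
    have h2 : call ((2 : ℝ≥0∞) • θ t) x = 2 * call (θ t) x := by
      simp [call, integral_smul_measure]
    linarith
  · rw [← hinit]
    exact hζ.call_mono (ho t) x

/-- Replaces the quantifier over all peacocks η by one inequality between two functions that depend
measurably on the parameter; by continuity in x it need only be checked at rational points. -/
lemma IsPeacock.isNSI (h : IsPeacock θ) (ho : ∀ t, o ≤ t)
    (hle : ∀ t x, call (θ t) x ≤ improvedCall θ o t x) : IsNSI o θ := by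
  refine ⟨h, fun ζ hζ hinit hζle t => convexLE_of_call_le (h.mem t) (hζ.mem t) ?_ fun x =>
    (hle t x).trans (improvedCall_le_call h hζ ho hinit hζle t x)⟩
  rw [← h.mean_eq (ho t), ← hζ.mean_eq (ho t), hinit]

end NSI

lemma tendsto_two_mul_nhdsGT : Tendsto (fun s : ℝ => 2 * s) (𝓝[>] 0) (𝓝[>] 0) := by
  refine tendsto_nhdsWithin_iff.mpr ⟨?_, ?_⟩
  · exact ((continuous_const.mul continuous_id).tendsto' 0 0 (by simp)).mono_left
      nhdsWithin_le_nhds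
  · filter_upwards [self_mem_nhdsWithin] with s hs
    exact mul_pos two_pos (mem_Ioi.mp hs)

lemma tendsto_average {f : ℝ → ℝ} {a : ℝ} (ha : a ∈ Ioo (0 : ℝ) 1)
    (hf : ∀ r ∈ Icc (0 : ℝ) 1, IntervalIntegrable f volume 0 r)
    (hd : HasDerivAt (fun r => ∫ b in (0 : ℝ)..r, f b) (f a) a) :
    Tendsto (fun s => s⁻¹ * ∫ b in a..(a + s), f b) (𝓝[>] 0) (𝓝 (f a)) := by
  refine hd.tendsto_slope_zero_right.congr' ?_
  filter_upwards [Ioo_mem_nhdsGT (show 0 < 1 - a by linarith [ha.2])] with s hs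
  rw [smul_eq_mul, intervalIntegral.integral_interval_sub_left
    (hf _ ⟨by linarith [ha.1, hs.1], by linarith [hs.2]⟩) (hf _ (Ioo_subset_Icc_self ha))]

lemma tendsto_average_two {f : ℝ → ℝ} {a c : ℝ}
    (h : Tendsto (fun s => s⁻¹ * ∫ b in a..(a + s), f b) (𝓝[>] 0) (𝓝 c)) :
    Tendsto (fun s => s⁻¹ * ((∫ b in a..(a + 2 * s), f b) / 2)) (𝓝[>] 0) (𝓝 c) := by
  refine (h.comp tendsto_two_mul_nhdsGT).congr fun s => ?_
  simp only [Function.comp, mul_inv]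
  ring

namespace IsFlow

section

variable {T : Type*} [LinearOrder T] {μ : T → Measure ℝ} {θ : ℝ → T → Measure ℝ}

lemma integrableOn_mean (h : IsFlow μ θ) (t : T) :
    IntegrableOn (fun b => ∫ y, y ∂θ b t) (Ioc 0 1) := by
  refine ⟨?_, ?_⟩
  · refine (measurable_of_tendsto_metrizable (f := fun (n : ℕ) b => call (θ b t) (-n) + (-n))
      (fun n => (h.measurable_call t _).add_const _) (tendsto_pi_nhds.mpr fun b =>
        ((h.peacock b).mem t).call_add_tendsto_atBot.comp
          (tendsto_neg_atTop_atBot.comp tendsto_natCast_atTop_atTop))).aestronglyMeasurable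
  · refine (lintegral_mono fun b => enorm_integral_le_lintegral_enorm _).trans_lt ?_
    rw [h.lintegral_eq t measurable_enorm]
    exact (h.target t).moment.2

lemma callBounds_average (h : IsFlow μ θ) (t : T) {a s : ℝ} (ha : 0 ≤ a) (hs : 0 < s)
    (has : a + s ≤ 1) : CallBounds (fun x => s⁻¹ * ∫ b in a..(a + s), call (θ b t) x)
      (s⁻¹ * ∫ b in a..(a + s), ∫ y, y ∂θ b t) := by
  have hi := fun x => h.intervalIntegrable t x (r := a) (s := a + s) ⟨ha, by linarith⟩
    ⟨by linarith, has⟩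
  have hl : a ≤ a + s := by linarith
  have hs' : 0 ≤ s⁻¹ := inv_nonneg.mpr hs.le
  have hx : ∀ x, (s⁻¹ * ∫ b in a..(a + s), call (θ b t) x) + x =
      s⁻¹ * ∫ b in a..(a + s), (call (θ b t) x + x) := by
    intro x
    rw [intervalIntegral.integral_add (hi x) intervalIntegrable_const,
      intervalIntegral.integral_const, smul_eq_mul]
    field_simp
    ring
  have hb := fun b => ((h.peacock b).mem t).callBounds
  refine ⟨fun x y hxy => ?_, fun x y hxy => ?_, fun x => ?_, fun x => ?_⟩
  · exact mul_le_mul_of_nonneg_left (intervalIntegral.integral_mono_on hl (hi _) (hi _)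
      fun b _ => (hb b).antitone hxy) hs'
  · simp only [hx]
    exact mul_le_mul_of_nonneg_left (intervalIntegral.integral_mono_on hl
      ((hi _).add intervalIntegrable_const) ((hi _).add intervalIntegrable_const)
      fun b _ => (hb b).monotone hxy) hs'
  · exact mul_nonneg hs' (h.integral_nonneg t x hl)
  · rw [hx]
    refine mul_le_mul_of_nonneg_left (intervalIntegral.integral_mono_on hl ?_
      ((hi _).add intervalIntegrable_const) fun b _ => (hb b).le x) hs'
    rw [intervalIntegrable_iff, uIoc_of_le hl]
    exact (h.integrableOn_mean t).mono_set (Ioc_subset_Ioc ha has)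

end

variable {T : Type*} [LinearOrder T] [Countable T] [Nonempty T] {μ : T → Measure ℝ}
  {θ : ℝ → T → Measure ℝ} {o : T}

lemma measurable_improvedCall (h : IsFlow μ θ) (t : T) (x : ℝ) :
    Measurable fun b => improvedCall (θ b) o t x :=
  measurable_obstructedShadow (fun t x => (h.measurable_call t x).const_mul 2)
    (fun x => h.measurable_call o x) t x

lemma intervalIntegrable_improvedCall (h : IsFlow μ θ) (ho : ∀ t, o ≤ t) (t : T) (x : ℝ) {r s : ℝ}
    (hr : r ∈ Icc (0 : ℝ) 1) (hs : s ∈ Icc (0 : ℝ) 1) :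
    IntervalIntegrable (fun b => improvedCall (θ b) o t x) volume r s := by
  refine ((h.intervalIntegrable t x hr hs).const_mul 2).mono_fun
    (h.measurable_improvedCall t x).aestronglyMeasurable (Eventually.of_forall fun b => ?_)
  have hobs := (h.peacock b).obstructs ho
  have h1 := hobs.le t x
  have h2 := hobs.obstructed_add_le t x
  have h3 := call_nonneg (θ b o) x
  simp only
  rw [Real.norm_of_nonneg (show 0 ≤ improvedCall (θ b) o t x from h3.trans h1),
    Real.norm_of_nonneg (by linarith)]
  unfold improvedCall
  linarith

/-- The competitor `W` for `minCall` at a + s is the accumulation up to a plus half of the improved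
potentials over (a, a + 2s] plus `ε`. The half matches the factor 2 in η ≤ 2θ and leaves a convex
complement inside the accumulation up to a + 2s. The constant `ε` keeps the complement convex and
absorbs the mismatch between the initial mass over (a, a + s] and half of that over (a, a + 2s]. -/
lemma integral_call_le (h : IsFlow μ θ) (ho : ∀ t, o ≤ t)
    (hmin : ∀ r ∈ Icc (0 : ℝ) 1, ∀ t x, accCall θ r t x = minCall μ θ o r t x) {a s ε : ℝ}
    (ha : 0 ≤ a) (hs : 0 ≤ s) (has : a + 2 * s ≤ 1)
    (hε : ∀ x, ∫ b in a..(a + s), call (θ b o) x ≤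
      (∫ b in a..(a + 2 * s), call (θ b o) x) / 2 + ε) (t : T) (x : ℝ) :
    ∫ b in a..(a + s), call (θ b t) x ≤
      (∫ b in a..(a + 2 * s), improvedCall (θ b) o t x) / 2 + ε := by
  have ma : a ∈ Icc (0 : ℝ) 1 := ⟨ha, by linarith⟩
  have m1 : a + s ∈ Icc (0 : ℝ) 1 := ⟨by linarith, by linarith⟩
  have m2 : a + 2 * s ∈ Icc (0 : ℝ) 1 := ⟨by linarith, has⟩
  have hl : a ≤ a + 2 * s := by linarith
  have hobs := fun b => (h.peacock b).obstructs ho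
  have key := obstructedShadow_le (f := fun t => call (μ t)) (g := accCall θ (a + s) o)
    (W := fun t x => accCall θ a t x + ((∫ b in a..(a + 2 * s), improvedCall (θ b) o t x) / 2 + ε))
    ?_ ?_ ?_ t x
  · have h1 := hmin _ m1 t x
    rw [minCall] at h1
    rw [← h.accCall_sub t x ma m1]
    linarith
  · intro t
    have c1 := h.convexOn_accCall_sub t m2.1 m2.2 le_rfl
    have c2 := convexOn_intervalIntegral (u := fun b x => 2 * call (θ b t) x -
      improvedCall (θ b) o t x) hl (fun b => (hobs b).convexOn_sub t)
      (fun x => ((h.intervalIntegrable t x ma m2).const_mul 2).sub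
        (h.intervalIntegrable_improvedCall ho t x ma m2))
    refine ((c1.add (c2.smul (show (0 : ℝ) ≤ 1 / 2 by norm_num))).add
      (convexOn_const (-ε) convex_univ)).of_eq fun x => ?_
    simp only [Pi.add_apply, smul_eq_mul]
    rw [h.accCall_one, intervalIntegral.integral_sub
      ((h.intervalIntegrable t x ma m2).const_mul 2)
      (h.intervalIntegrable_improvedCall ho t x ma m2), intervalIntegral.integral_const_mul,
      ← h.accCall_sub t x ma m2]
    ring
  · intro t u htu x
    have h1 : ∫ b in a..(a + 2 * s), improvedCall (θ b) o t x ≤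
        ∫ b in a..(a + 2 * s), improvedCall (θ b) o u x :=
      intervalIntegral.integral_mono_on hl (h.intervalIntegrable_improvedCall ho t x ma m2)
        (h.intervalIntegrable_improvedCall ho u x ma m2) fun b _ => (hobs b).mono htu x
    have h2 : accCall θ a t x ≤ accCall θ a u x := h.integral_mono htu x le_rfl ma.1 ma.2
    linarith
  · intro t x
    have h1 : ∫ b in a..(a + 2 * s), call (θ b o) x ≤
        ∫ b in a..(a + 2 * s), improvedCall (θ b) o t x :=
      intervalIntegral.integral_mono_on hl (h.intervalIntegrable o x ma m2)
        (h.intervalIntegrable_improvedCall ho t x ma m2) fun b _ => (hobs b).le t x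
    have h2 : accCall θ a o x ≤ accCall θ a t x := h.integral_mono (ho t) x le_rfl ma.1 ma.2
    have h3 := h.accCall_sub o x ma m1
    have h4 := hε x
    linarith

/-- At a differentiation point both initial averages, over (a, a + s] and (a, a + 2s], converge to
call (θ a o) uniformly in x. The previous lemma thus applies with `ε` = s δ; divide by s, let s → 0,
then δ → 0. -/
lemma call_le_improvedCall (h : IsFlow μ θ) (ho : ∀ t, o ≤ t)
    (hmin : ∀ r ∈ Icc (0 : ℝ) 1, ∀ t x, accCall θ r t x = minCall μ θ o r t x) {a : ℝ}
    (ha : a ∈ Ioo (0 : ℝ) 1)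
    (hd : ∀ t, ∀ q : ℚ, HasDerivAt (fun r => accCall θ r t q) (call (θ a t) q) a)
    (hm : HasDerivAt (fun r => ∫ b in (0 : ℝ)..r, ∫ y, y ∂θ b o) (∫ y, y ∂θ a o) a)
    (hη : ∀ t, ∀ q : ℚ, HasDerivAt (fun r => ∫ b in (0 : ℝ)..r, improvedCall (θ b) o t q)
      (improvedCall (θ a) o t q) a) (t : T) (x : ℝ) :
    call (θ a t) x ≤ improvedCall (θ a) o t x := by
  have := ((h.peacock a).mem o).prob
  have hcl : IsClosed {x | call (θ a t) x ≤ improvedCall (θ a) o t x} :=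
    isClosed_le (continuous_of_convexOn (h.convexOn_call a t))
      (continuous_of_convexOn (((h.peacock a).obstructs ho).convexOn t))
  refine (Rat.isDenseEmbedding_coe_real.dense.induction (P := fun x => call (θ a t) x ≤
    improvedCall (θ a) o t x) ?_ hcl) x
  rintro _ ⟨q, rfl⟩
  refine le_of_forall_pos_le_add fun δ hδ => ?_
  have hc : ∀ t (q : ℚ), Tendsto (fun s => s⁻¹ * ∫ b in a..(a + s), call (θ b t) q) (𝓝[>] 0)
      (𝓝 (call (θ a t) q)) := fun t q => tendsto_average ha
    (fun r hr => h.intervalIntegrable t q ⟨le_rfl, zero_le_one⟩ hr) (hd t q)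
  have hmean : Tendsto (fun s => s⁻¹ * ∫ b in a..(a + s), ∫ y, y ∂θ b o) (𝓝[>] 0)
      (𝓝 (∫ y, y ∂θ a o)) := by
    refine tendsto_average ha (fun r hr => ?_) hm
    rw [intervalIntegrable_iff, uIoc_of_le hr.1]
    exact (h.integrableOn_mean o).mono_set (Ioc_subset_Ioc_right hr.2)
  have himp := tendsto_average_two (tendsto_average ha
    (fun r hr => h.intervalIntegrable_improvedCall ho t q ⟨le_rfl, zero_le_one⟩ hr) (hη t q))
  have hunif := CallBounds.eventually_abs_sub_le (l := 𝓝[>] (0 : ℝ))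
    (φ := fun s x => s⁻¹ * ∫ b in a..(a + s), call (θ b o) x)
    (A := fun s => s⁻¹ * ∫ b in a..(a + s), ∫ y, y ∂θ b o) (by
      filter_upwards [Ioo_mem_nhdsGT (show 0 < 1 - a by linarith [ha.2])] with s hs
      exact h.callBounds_average o ha.1.le hs.1 (by linarith [hs.2]))
    ((h.peacock a).mem o).callBounds (call_tendsto_atTop ((h.peacock a).mem o).moment)
    ((h.peacock a).mem o).call_add_tendsto_atBot (hc o) hmean (δ := δ / 2) (by positivity)
  have hunif2 : ∀ᶠ s in 𝓝[>] (0 : ℝ), ∀ x,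
      |(2 * s)⁻¹ * (∫ b in a..(a + 2 * s), call (θ b o) x) - call (θ a o) x| ≤ δ / 2 := by
    exact tendsto_two_mul_nhdsGT.eventually hunif
  refine le_of_tendsto_of_tendsto (hc t q) (himp.add_const δ) ?_
  filter_upwards [Ioo_mem_nhdsGT (show 0 < (1 - a) / 2 by linarith [ha.2]), hunif, hunif2]
    with s hs h1 h2
  have hs0 : 0 < s := hs.1
  have hle := h.integral_call_le ho hmin ha.1.le hs0.le (by linarith [hs.2]) (ε := s * δ) (by
    intro x
    have e1 := (abs_le.mp (h1 x)).2
    have e2 := (abs_le.mp (h2 x)).1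
    rw [inv_mul_eq_div, sub_le_iff_le_add, div_le_iff₀ hs0] at e1
    rw [inv_mul_eq_div, le_sub_iff_add_le, le_div_iff₀ (by positivity)] at e2
    linarith) t q
  rw [inv_mul_le_iff₀ hs0, mul_add, mul_inv_cancel_left₀ hs0.ne']
  exact hle

/-- Lebesgue differentiation for countably many functions, indexed by T and the rationals, leaves a
single exceptional null set. -/
lemma ae_isNSI (h : IsFlow μ θ) (ho : ∀ t, o ≤ t)
    (hmin : ∀ r ∈ Icc (0 : ℝ) 1, ∀ t x, accCall θ r t x = minCall μ θ o r t x) :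
    ∀ᵐ a : ℝ, a ∈ Ioo (0 : ℝ) 1 → IsNSI o (θ a) := by
  have m0 : (0 : ℝ) ∈ Icc (0 : ℝ) 1 := ⟨le_rfl, zero_le_one⟩
  have m1 : (1 : ℝ) ∈ Icc (0 : ℝ) 1 := ⟨zero_le_one, le_rfl⟩
  have h1 : ∀ᵐ a : ℝ, ∀ t, a ∈ Ioo (0 : ℝ) 1 → ∀ q : ℚ,
      HasDerivAt (fun r => accCall θ r t q) (call (θ a t) q) a :=
    ae_all_iff.mpr h.ae_hasDerivAt_accCall
  have h2 : ∀ᵐ a : ℝ, ∀ t, ∀ q : ℚ, a ∈ uIcc (0 : ℝ) 1 → ∀ c ∈ uIcc (0 : ℝ) 1,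
      HasDerivAt (fun r => ∫ b in c..r, improvedCall (θ b) o t q) (improvedCall (θ a) o t q) a :=
    ae_all_iff.mpr fun t => ae_all_iff.mpr fun q =>
      (h.intervalIntegrable_improvedCall ho t q m0 m1).ae_hasDerivAt_integral
  have hi : IntervalIntegrable (fun b => ∫ y, y ∂θ b o) volume 0 1 := by
    rw [intervalIntegrable_iff, uIoc_of_le zero_le_one]
    exact h.integrableOn_mean o
  filter_upwards [h1, h2, hi.ae_hasDerivAt_integral] with a ha1 ha2 ha3 hmem
  rw [uIcc_of_le zero_le_one] at ha2 ha3
  have ha := Ioo_subset_Icc_self hmem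
  exact (h.peacock a).isNSI ho (h.call_le_improvedCall ho hmin hmem (fun t => ha1 t hmem)
    (ha3 ha 0 m0) fun t q => ha2 t q ha 0 m0)

end IsFlow

/-! ### Transfer between the unit interval and the real line -/

lemma lintegral_unitInterval (f : ℝ → ℝ≥0∞) :
    ∫⁻ a : unitInterval, f a = ∫⁻ b in Ioc (0 : ℝ) 1, f b := by
  rw [unitInterval.measurePreserving_coe.lintegral_comp_emb unitInterval.measurableEmbedding_coe,
    Measure.restrict_congr_set Ioc_ae_eq_Icc]

lemma projIcc_coe (a : unitInterval) : projIcc (0 : ℝ) 1 zero_le_one (a : ℝ) = a :=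
  projIcc_val zero_le_one a

variable {T : Type*} [LinearOrder T] {μ : T → Measure ℝ} {ν : unitInterval → Measure ℝ}
  {θ : unitInterval → T → Measure ℝ} {o : T}

/-- The family is extended constantly outside [0, 1], so that calculus on the line applies; only (0,
1] enters the mixture. -/
lemma IsAdmissible.isFlow (hμ : IsPeacock μ) (h : IsAdmissible o ν μ θ) :
    IsFlow μ fun b => θ (projIcc (0 : ℝ) 1 zero_le_one b) where
  peacock b := h.peacock _
  measurable := h.measurable.comp continuous_projIcc.measurable
  target_peacock := hμ
  mixture t B hB := by
    rw [← h.mixture t B hB, ← lintegral_unitInterval]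
    simp only [projIcc_coe]

lemma IsFlow.isAdmissible {θ' : ℝ → T → Measure ℝ} (h : IsFlow μ θ')
    (hinit : ∀ a : unitInterval, θ' a o = ν a) :
    IsAdmissible o ν μ fun a : unitInterval => θ' a where
  peacock a := h.peacock _
  measurable := h.measurable.comp measurable_subtype_coe
  init := hinit
  mixture t B hB := by
    rw [← h.mixture t B hB, ← lintegral_unitInterval]

lemma totalCost_cost {T : Type*} (θ' : ℝ → T → Measure ℝ) (t : T) :
    totalCost (cost t) (fun a : unitInterval => θ' a) = flowCost θ' t := by
  rw [flowCost, ← lintegral_unitInterval]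
  rfl

/-- A simultaneous minimizer consists almost everywhere of NSI peacocks. -/
lemma ae_isNSI_of_isMinimizer [Countable T] [Nonempty T] (ho : ∀ t, o ≤ t) (hμ : IsPeacock μ)
    (hfin : ∀ t, optValue o ν μ (cost t) < ⊤) (hθ : ∀ t, IsMinimizer o ν μ (cost t) θ) :
    ∀ᵐ a : unitInterval, IsNSI o (θ a) := by
  have hadm := (hθ o).admissible
  set θ' : ℝ → T → Measure ℝ := fun b => θ (projIcc (0 : ℝ) 1 zero_le_one b) with hθ'
  have hcoe : (fun a : unitInterval => θ' a) = θ := funext fun a => by simp only [hθ', projIcc_coe]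
  have h : IsFlow μ θ' := hadm.isFlow hμ
  have hcost : ∀ t, flowCost θ' t = optValue o ν μ (cost t) := fun t => by
    rw [← (hθ t).optimal, ← totalCost_cost, hcoe]
  have hmin : ∀ r ∈ Icc (0 : ℝ) 1, ∀ t x, accCall θ' r t x = minCall μ θ' o r t x := by
    intro r hr t x
    refine h.accCall_eq_minCall ho ?_ (fun η hη hinit => ?_) hr x
    · rw [hcost]
      exact (hfin t).ne
    · rw [hcost, ← totalCost_cost]
      refine iInf₂_le _ (hη.isAdmissible fun a => ?_)
      rw [hinit, ← hadm.init]
      exact congrArg (· o) (congrFun hcoe a)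
  have hae := h.ae_isNSI ho hmin
  have h0 : ∀ᵐ b : ℝ, b ≠ 0 := by simp [ae_iff, measure_singleton]
  have h1 : ∀ᵐ b : ℝ, b ≠ 1 := by simp [ae_iff, measure_singleton]
  have hall : ∀ᵐ b ∂(volume.restrict unitInterval), b ∈ unitInterval → IsNSI o (θ' b) := by
    refine ae_restrict_of_ae ?_
    filter_upwards [hae, h0, h1] with b hb hb0 hb1 hmem
    exact hb ⟨lt_of_le_of_ne hmem.1 hb0.symm, lt_of_le_of_ne hmem.2 hb1⟩
  filter_upwards [unitInterval.measurePreserving_coe.quasiMeasurePreserving.ae hall] with a ha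
  have := ha a.2
  rwa [show θ' a = θ a from congrFun hcoe a] at this

end PeacockNSI

theorem proposition5p11
    (T : Set ℝ) (hTc : T.Countable) (hT : T ⊆ Set.Ici 0) (h0 : (0 : ℝ) ∈ T)
    (hmax : ∃ m, IsGreatest T m)
    (μ : T → MeasureTheory.Measure ℝ) (hμ : PeacockNSI.IsPeacock μ)
    (ν : unitInterval → MeasureTheory.Measure ℝ) (hν : ∀ a, PeacockNSI.IsP1 (ν a))
    (hνm : Measurable ν)
    (θ : unitInterval → T → MeasureTheory.Measure ℝ)
    (hfin : ∀ t : T, PeacockNSI.optValue ⟨0, h0⟩ ν μ (PeacockNSI.cost t) < ⊤)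
    (hθ : ∀ t : T, PeacockNSI.IsMinimizer ⟨0, h0⟩ ν μ (PeacockNSI.cost t) θ) :
    ∀ᵐ a : unitInterval, PeacockNSI.IsNSI (⟨0, h0⟩ : T) (θ a) := by
  have : Countable T := hTc.to_subtype
  have : Nonempty T := ⟨⟨0, h0⟩⟩
  exact PeacockNSI.ae_isNSI_of_isMinimizer (fun t => hT t.2) hμ hfin hθ
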